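/- For $s\ge 0$, $b>0$ let $H^s_b=\{f\in H^s(\mathbf R;\mathbf R):\cosh(\cdot)^b f\in H^s\}$ with norm $\|f\|_{s,b}=\|\cosh(\cdot)^b f\|_{H^s}$; let $E^s_b$ be the subspace of even functions in $H^s_b$ and $E^s_{b,0}=\{f\in E^s_b:\int_{\mathbf R} f\,dx=0\}$. Functions in $H^2_b$ are identified with their continuous representatives. Let $\delta f(x)=f(x+\tfrac12)-f(x-\tfrac12)$. A real number $c$ is called a $W$-admissible wave speed, with witnesses $\beta>0$ and $0\ne\sigma\in E^2_\beta$, if $c^2\sigma''-\delta^2W'(\sigma)=0$ and the operator $\mathcal H f=c^2f''-\delta^2\big(W''(\sigma)f\big)$ is a homeomorphism from $E^2_\beta$ onto $E^0_{\beta,0}$, and if moreover, in case $W$ is $C^\infty$, $\sigma$ is $C^\infty$ and $\mathcal H$ is a homeomorphism from $E^{s+2}_\beta$ onto $E^s_{\beta,0}$ for every $s\ge0$. **Theorem 2.** Fix $\mu>0$. Assume that $V:\mathbf R\to\mathbf R$ is $C^5$, that $V'(0)=0$, and that $c\neq0$ is a $(1+\mu)^{-1}V$-admissible wave speed with witnesses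 $\beta$ and $\sigma$. For $n\in\mathbf N$ put $$\kappa_n=\frac{4\pi^2c^2n^2\mu}{1+\mu}.$$ Then there exist $C>0$ and an integer $N\ge1$ such that for every $n\ge N$ there is exactly one pair of functions $\rho_1,\rho_2\in H^2_\beta$ with the following three properties: (i) $\rho_1,\rho_2$ solve, with $\kappa=\kappa_n$, the system $$c^2\rho_1''-\delta^2V'(\rho_1)-\kappa\,\delta\rho_2=0,\qquad c^2\mu\rho_2''+\kappa(1+\mu)\rho_2+\mu\,\delta V'(\rho_1)=0;$$ (ii) $\rho_1$ is even and $\rho_2$ is odd; (iii) $\|\sigma-\rho_1\|_{2,\beta}+\|\rho_2\|_{2,\beta}\le C/n$. Moreover, if $V$ is $C^\infty$, then for every $n\ge N$ these functions $\rho_1$ and $\rho_2$ are $C^\infty$, and for every real $s\ge0$ they lie in $H^s_\beta$ and there is a constant $C_s>0$, independent of $n$, such that $\|\sigma-\rho_1\|_{s,\beta}+\|\rho_2\|_{s,\beta}\le C_s/n^2$ for all $n\ge N$. -/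

import Mathlib

open MeasureTheory
open scoped ContDiff ENNReal FourierTransform

noncomputable section

namespace MassInMass

/-! Profiles are represented by functions `ℝ → ℝ`; Sobolev norms, weak derivatives and the
equations below depend only on the class of a function modulo equality almost everywhere. -/

/-- The norm of the Sobolev space `H^s(ℝ)`, `s ≥ 0`, with values in `[0, ∞]`: the `L²` norm of
`(1 + |ξ|²)^(s/2)` times the (`L²`) Fourier transform of `f`; it is `∞` if `f` is not in `L²`. -/
def eHsNorm (s : ℝ) (f : ℝ → ℝ) : ℝ≥0∞ :=
  ⨅ h : MemLp (fun x => (f x : ℂ)) 2 (volume : Measure ℝ),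
    eLpNorm (fun ξ : ℝ =>
      (((1 + ‖ξ‖ ^ 2) ^ (s / 2) : ℝ) : ℂ) * (𝓕 (h.toLp (fun x => (f x : ℂ))) : Lp ℂ 2 (volume : Measure ℝ)) ξ)
      2 volume

/-- `f ∈ H^s(ℝ)`, for `s ≥ 0`. -/
def MemHs (s : ℝ) (f : ℝ → ℝ) : Prop :=
  ∃ h : MemLp (fun x => (f x : ℂ)) 2 (volume : Measure ℝ),
    TemperedDistribution.MemSobolev s 2
      (Lp.toTemperedDistribution (h.toLp (fun x => (f x : ℂ))))

open TemperedDistribution in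
/-- Membership in `H^s(ℝ)` means that the `H^s` norm is finite. -/
theorem memHs_iff (s : ℝ) (hs : 0 ≤ s) (f : ℝ → ℝ) : MemHs s f ↔ eHsNorm s f < ⊤ := by
  unfold MemHs eHsNorm
  rw [iInf_lt_iff]
  symm
  refine exists_congr fun h => ?_
  set F : Lp ℂ 2 (volume : Measure ℝ) := h.toLp (fun x => (f x : ℂ))
  rw [memSobolev_iff_exists_smulLeftCLM_fourier, Lp.fourier_toTemperedDistribution_eq]
  have hw : (fun ξ : ℝ => (((1 + ‖ξ‖ ^ 2) ^ (s / 2) : ℝ) : ℂ)).HasTemperateGrowth := by fun_prop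
  have hw' : (fun ξ : ℝ => (((1 + ‖ξ‖ ^ 2) ^ (-(s / 2)) : ℝ) : ℂ)).HasTemperateGrowth := by fun_prop
  have hmeas : AEStronglyMeasurable (fun ξ : ℝ =>
      (((1 + ‖ξ‖ ^ 2) ^ (s / 2) : ℝ) : ℂ) * (𝓕 F : Lp ℂ 2 (volume : Measure ℝ)) ξ) volume :=
    hw.1.continuous.aestronglyMeasurable.mul (Lp.aestronglyMeasurable _)
  constructor
  · intro hlt
    have hm : MemLp _ 2 volume := ⟨hmeas, hlt⟩
    refine ⟨hm.toLp _, ?_⟩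
    ext g
    rw [smulLeftCLM_apply_apply, Lp.toTemperedDistribution_apply, Lp.toTemperedDistribution_apply]
    apply integral_congr_ae
    filter_upwards [hm.coeFn_toLp] with x hx
    rw [hx, SchwartzMap.smulLeftCLM_apply_apply hw]
    simp; ring
  · rintro ⟨f', hf'⟩
    have hb : MemLp (fun ξ : ℝ => (((1 + ‖ξ‖ ^ 2) ^ (-(s / 2)) : ℝ) : ℂ)) ⊤ volume := by
      apply memLp_top_of_bound hw'.1.continuous.aestronglyMeasurable 1
      filter_upwards with x
      rw [Complex.norm_real, Real.norm_eq_abs, abs_of_nonneg (by positivity)]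
      exact Real.rpow_le_one_of_one_le_of_nonpos (by simpa using sq_nonneg x) (by linarith)
    have key : (𝓕 F : Lp ℂ 2 (volume : Measure ℝ)) = hb.toLp _ • f' := by
      have : Lp.toTemperedDistributionCLM ℂ (volume : Measure ℝ) 2 (𝓕 F)
          = Lp.toTemperedDistributionCLM ℂ (volume : Measure ℝ) 2 (hb.toLp _ • f') := by
        rw [Lp.toTemperedDistributionCLM_apply, Lp.toTemperedDistributionCLM_apply,
          Lp.toTemperedDistribution_smul_eq hw' hb, ← hf', smulLeftCLM_smulLeftCLM_apply hw hw']
        have h1 : ((fun ξ : ℝ => (((1 + ‖ξ‖ ^ 2) ^ (s / 2) : ℝ) : ℂ)) *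
            fun ξ : ℝ => (((1 + ‖ξ‖ ^ 2) ^ (-(s / 2)) : ℝ) : ℂ)) = fun _ => 1 := by
          ext x
          simp only [Pi.mul_apply]
          rw [← Complex.ofReal_mul, ← Real.rpow_add (by positivity)]
          simp
        rw [h1]
        ext g
        simp
      exact LinearMap.ker_eq_bot.1 (Lp.ker_toTemperedDistributionCLM_eq_bot
        (F := ℂ) (μ := (volume : Measure ℝ)) (p := 2)) this
    refine lt_of_eq_of_lt (eLpNorm_congr_ae ?_) (Lp.memLp f').2
    rw [key]
    filter_upwards [Lp.coeFn_lpSMul (r := 2) (hb.toLp _) f', hb.coeFn_toLp] with x h1 h2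
    rw [h1, Pi.smul_apply', h2, smul_eq_mul, ← mul_assoc, ← Complex.ofReal_mul,
      ← Real.rpow_add (by positivity)]
    simp

/-- The function `cosh(·)^b f`. -/
def coshWeight (b : ℝ) (f : ℝ → ℝ) : ℝ → ℝ := fun x => Real.cosh x ^ b * f x

/-- The norm of `H^s_b`: the `H^s` norm of `cosh(·)^b f`. -/
def eHsbNorm (s b : ℝ) (f : ℝ → ℝ) : ℝ≥0∞ := eHsNorm s (coshWeight b f)

/-- `f ∈ H^s_b`. -/
def MemHsb (s b : ℝ) (f : ℝ → ℝ) : Prop := MemHs s f ∧ MemHs s (coshWeight b f)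

/-- `f ∈ E^s_b`: the even functions in `H^s_b`. -/
def MemEsb (s b : ℝ) (f : ℝ → ℝ) : Prop := MemHsb s b f ∧ Function.Even f

/-- `f ∈ E^s_{b,0}`: the even functions in `H^s_b` with integral zero. -/
def MemEsbZero (s b : ℝ) (f : ℝ → ℝ) : Prop := MemEsb s b f ∧ ∫ x, f x = 0

/-- `g = f''` in the sense of distributions on `ℝ`. -/
def HasWeakSecondDeriv (f g : ℝ → ℝ) : Prop :=
  LocallyIntegrable f ∧ LocallyIntegrable g ∧
    ∀ φ : ℝ → ℝ, ContDiff ℝ ∞ φ → HasCompactSupport φ →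
      ∫ x, f x * deriv (deriv φ) x = ∫ x, g x * φ x

/-- The difference operator `δ f (x) = f (x + 1/2) - f (x - 1/2)`. -/
def delta (f : ℝ → ℝ) : ℝ → ℝ := fun x => f (x + 1 / 2) - f (x - 1 / 2)

/-- `c² σ'' - δ² V'(σ) = 0`. -/
def SolvesMonatomic (V : ℝ → ℝ) (c : ℝ) (σ : ℝ → ℝ) : Prop :=
  ∃ σ'' : ℝ → ℝ, HasWeakSecondDeriv σ σ'' ∧
    ∀ᵐ x, c ^ 2 * σ'' x - delta (delta fun y => deriv V (σ y)) x = 0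

/-- `g = ℋ f` almost everywhere, where `ℋ f = c² f'' - δ² (V''(σ) f)`. -/
def IsLinearized (V : ℝ → ℝ) (c : ℝ) (σ f g : ℝ → ℝ) : Prop :=
  ∃ f'' : ℝ → ℝ, HasWeakSecondDeriv f f'' ∧
    ∀ᵐ x, g x = c ^ 2 * f'' x - delta (delta fun y => deriv (deriv V) (σ y) * f y) x

/-- The linear operator `ℋ` is a homeomorphism from `E^{s+2}_β` onto `E^s_{β,0}`: it maps the
first space into the second and onto it, and it is bounded and bounded below (so that it is
injective, with a bounded inverse). -/
def LinearizedIsHomeo (V : ℝ → ℝ) (c β : ℝ) (σ : ℝ → ℝ) (s : ℝ) : Prop :=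
  (∀ f, MemEsb (s + 2) β f → ∃ g, MemEsbZero s β g ∧ IsLinearized V c σ f g) ∧
  (∀ g, MemEsbZero s β g → ∃ f, MemEsb (s + 2) β f ∧ IsLinearized V c σ f g) ∧
  ∃ K : ℝ, ∀ f g, MemEsb (s + 2) β f → MemEsbZero s β g → IsLinearized V c σ f g →
    eHsbNorm s β g ≤ ENNReal.ofReal K * eHsbNorm (s + 2) β f ∧
    eHsbNorm (s + 2) β f ≤ ENNReal.ofReal K * eHsbNorm s β g

/-- `c` is a `V`-admissible wave speed, as witnessed by the decay rate `β` and the profile `σ`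
(taken to be the continuous representative of its class in `H²_β`). -/
structure IsAdmissibleWith (V : ℝ → ℝ) (c β : ℝ) (σ : ℝ → ℝ) : Prop where
  beta_pos : 0 < β
  continuous : Continuous σ
  mem : MemEsb 2 β σ
  ne_zero : σ ≠ 0
  solves : SolvesMonatomic V c σ
  homeo : LinearizedIsHomeo V c β σ 0
  smooth : ContDiff ℝ ∞ V → ContDiff ℝ ∞ σ ∧ ∀ s : ℝ, 0 ≤ s → LinearizedIsHomeo V c β σ s

/-- The traveling wave system of the mass-in-mass lattice:
`c² ρ₁'' - δ² V'(ρ₁) - κ δ ρ₂ = 0` and `c² μ ρ₂'' + κ (1 + μ) ρ₂ + μ δ V'(ρ₁) = 0`. -/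
def SolvesTraveling (V : ℝ → ℝ) (c μ κ : ℝ) (ρ₁ ρ₂ : ℝ → ℝ) : Prop :=
  (∃ ρ₁'' : ℝ → ℝ, HasWeakSecondDeriv ρ₁ ρ₁'' ∧
    ∀ᵐ x, c ^ 2 * ρ₁'' x - delta (delta fun y => deriv V (ρ₁ y)) x - κ * delta ρ₂ x = 0) ∧
  (∃ ρ₂'' : ℝ → ℝ, HasWeakSecondDeriv ρ₂ ρ₂'' ∧
    ∀ᵐ x, c ^ 2 * μ * ρ₂'' x + κ * (1 + μ) * ρ₂ x
      + μ * delta (fun y => deriv V (ρ₁ y)) x = 0)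

/-- The spring constant `κ_n = 4 π² c² n² μ / (1 + μ)`. -/
def kappa (c μ : ℝ) (n : ℕ) : ℝ := 4 * Real.pi ^ 2 * c ^ 2 * (n : ℝ) ^ 2 * μ / (1 + μ)

/-- The pair `ρ = (ρ₁, ρ₂)` of functions in `H²_β` (continuous representatives) solves the
traveling wave system with spring constant `κ`, `ρ₁` is even, `ρ₂` is odd, and
`‖σ - ρ₁‖_{2,β} + ‖ρ₂‖_{2,β} ≤ ε`. -/
structure IsSolitaryWave (V : ℝ → ℝ) (c μ κ β : ℝ) (σ : ℝ → ℝ) (ε : ℝ)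
    (ρ : (ℝ → ℝ) × (ℝ → ℝ)) : Prop where
  continuous_fst : Continuous ρ.1
  continuous_snd : Continuous ρ.2
  mem_fst : MemHsb 2 β ρ.1
  mem_snd : MemHsb 2 β ρ.2
  solves : SolvesTraveling V c μ κ ρ.1 ρ.2
  even_fst : Function.Even ρ.1
  odd_snd : Function.Odd ρ.2
  bound : eHsbNorm 2 β (fun x => σ x - ρ.1 x) + eHsbNorm 2 β ρ.2 ≤ ENNReal.ofReal ε

end MassInMass

end

/-!
Write `W = (1 + μ)⁻¹ V`, `G = W'` and `ω = 2πn`, so that `κ_n = c² ω² μ / (1 + μ)`.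

*Eliminating the internal wave.* The second equation is a forced oscillator of frequency `ω`,
namely `ρ₂'' + ω² ρ₂ = -(1+μ)/c² δ G(ρ₁)`. For general `κ` its solutions oscillate at infinity, but
`ω` is an integer multiple of `2π`: the sine kernel has period dividing the length `1` of the step
of `δ`, and therefore `δ h` is answered by the *localized* solution
`S h (x) = ω⁻¹ ∫_{x-1/2}^{x+1/2} sin(ω(x + 1/2 - t)) h(t) dt` (`osc`, with `hasDerivAt_osc`,
`hasDerivAt_oscDeriv`). It is bounded on the weighted spaces, commutes with derivatives, and has
norm `O(1/ω)` (`L2Bound.osc`). By conservation of energy no other solution is square integrable, so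
`ρ₂ = -(1+μ)/c² S G(ρ₁)` (`eq_internalWave`).

*The fixed point problem.* Substituting this and `ρ₁ = σ + f` into the first equation turns it into
`ℋ f = δ Θ(f)` with `Θ(f) = δ(G(σ+f) - G(σ) - G'(σ) f) + μ S (G(σ+f))''` (`first_equation_iff`).
The Taylor remainder is quadratic in `f` and `S = O(1/n)`, so on a ball of radius `O(1/n)` the map
`Θ` has a Lipschitz constant `O(1/n)` (`exists_Theta_lipschitz`), and `Θ(0) = O(1/n)`. Since `Θ(f)`
is odd, `δ Θ(f)` is even with mean zero, in the range of `ℋ`; admissibility inverts `ℋ`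
(`IsAdmissibleWith.exists_inverse`), and the contraction principle yields the solution and its
uniqueness (`IsAdmissibleWith.exists_solution`, `IsAdmissibleWith.existsUnique_solitaryWave`).

*Smooth potentials.* The equation expresses `ρ₁''` by terms with as many derivatives as `ρ₁`, for
fixed `n`, and with one derivative more, uniformly in `n`; so the waves are smooth and bounded in
all `H^k_β` uniformly in `n` (`contDiff_of_travelingForce_eq`,
`sobolevBounded_of_travelingForce_eq`). Given these bounds, the identity `ω² S h = δ h - S h''` shows
that `S` is in fact `O(1/n²)` on `G(ρ₁)` and its derivatives (`SobolevBounded.sq_mul_osc`). Hence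
`Θ(f) = O(1/n²)`, which the inverse of `ℋ` passes on to `f` in `H²_β`, and the equation for `f''`
to all `H^k_β` (`IsAdmissibleWith.smooth_solitaryWaves`). Only the invertibility of `ℋ` on `E²_β` is
needed for this.

*Sobolev spaces.* The norms are defined on the Fourier side, the equations with weak derivatives.
All estimates are made with classical derivatives of locally absolutely continuous functions
(`IsPrimitive`, `H2Bound`); the du Bois-Reymond lemma (`HasWeakSecondDeriv.exists_isPrimitive`) and
`‖u‖_{H^{s+2}} ≤ ‖u‖_{H^s} + ‖u''‖_{H^s}` (`eHsNorm_add_two_le`) translate between the two. Real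
orders `s` are reached by monotonicity of the norm from even integers.
-/

noncomputable section

namespace MassInMass

/-! ### Locally absolutely continuous functions -/

/-- `f` is locally absolutely continuous on `ℝ` with a.e. derivative `g`, expressed by the
fundamental theorem of calculus: `f` is an indefinite integral of the locally integrable `g`. -/
structure IsPrimitive (f g : ℝ → ℝ) : Prop where
  locallyIntegrable : LocallyIntegrable g
  sub_eq : ∀ a b : ℝ, f b - f a = ∫ x in a..b, g x

theorem intervalIntegrable_of_locallyIntegrable {g : ℝ → ℝ} (hg : LocallyIntegrable g) (a b : ℝ) :
    IntervalIntegrable g volume a b :=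
  (hg.integrableOn_isCompact isCompact_uIcc).intervalIntegrable

namespace IsPrimitive

variable {f g f' g' : ℝ → ℝ}

theorem intervalIntegrable (h : IsPrimitive f g) (a b : ℝ) : IntervalIntegrable g volume a b :=
  intervalIntegrable_of_locallyIntegrable h.locallyIntegrable a b

theorem eq_add (h : IsPrimitive f g) (a x : ℝ) : f x = f a + ∫ t in a..x, g t := by
  rw [← h.sub_eq a x]; ring

theorem eq_fun (h : IsPrimitive f g) (a : ℝ) : f = fun x => f a + ∫ t in a..x, g t := by
  ext x; exact h.eq_add a x

theorem continuous (h : IsPrimitive f g) : Continuous f := by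
  rw [h.eq_fun 0]
  exact continuous_const.add (intervalIntegral.continuous_primitive h.intervalIntegrable 0)

theorem hasDerivAt (h : IsPrimitive f g) (hg : Continuous g) (x : ℝ) : HasDerivAt f (g x) x := by
  rw [h.eq_fun 0]
  exact (intervalIntegral.integral_hasDerivAt_right (h.intervalIntegrable 0 x)
    hg.stronglyMeasurable.stronglyMeasurableAtFilter hg.continuousAt).const_add _

theorem of_hasDerivAt (h : ∀ x, HasDerivAt f (g x) x) (hg : Continuous g) : IsPrimitive f g :=
  ⟨hg.locallyIntegrable, fun a b => (intervalIntegral.integral_eq_sub_of_hasDerivAt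
    (fun x _ => h x) (hg.intervalIntegrable a b)).symm⟩

theorem integral (hg : LocallyIntegrable g) (a : ℝ) : IsPrimitive (fun x => ∫ t in a..x, g t) g :=
  ⟨hg, fun _ _ => intervalIntegral.integral_interval_sub_left
    (intervalIntegrable_of_locallyIntegrable hg _ _)
    (intervalIntegrable_of_locallyIntegrable hg _ _)⟩

theorem ae_hasDerivAt (h : IsPrimitive f g) : ∀ᵐ x, HasDerivAt f (g x) x := by
  have : ∀ n : ℕ, ∀ᵐ x, x ∈ Set.uIcc (-(n : ℝ)) n → HasDerivAt f (g x) x := by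
    intro n
    filter_upwards [(h.intervalIntegrable (-(n : ℝ)) n).ae_hasDerivAt_integral] with x hx hxn
    rw [h.eq_fun (-(n : ℝ))]
    exact (hx hxn _ Set.left_mem_uIcc).const_add _
  filter_upwards [ae_all_iff.2 this] with x hx
  obtain ⟨n, hn⟩ := exists_nat_ge |x|
  refine hx n ?_
  rw [Set.uIcc_of_le (by linarith [abs_nonneg x])]
  exact abs_le.1 hn

theorem absolutelyContinuousOnInterval (h : IsPrimitive f g) (a b : ℝ) :
    AbsolutelyContinuousOnInterval f a b := by
  have h1 := (h.intervalIntegrable a b).absolutelyContinuousOnInterval_intervalIntegral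
    (c := a) Set.left_mem_uIcc
  have h2 : AbsolutelyContinuousOnInterval (fun _ : ℝ => f a) a b :=
    (contDiff_const (n := 1)).contDiffOn.absolutelyContinuousOnInterval
  rw [h.eq_fun a]
  exact h2.add h1

theorem congr_right (h : IsPrimitive f g) (hg : g =ᵐ[volume] g') : IsPrimitive f g' := by
  refine ⟨fun x => (h.locallyIntegrable x).congr hg, fun a b => ?_⟩
  rw [h.sub_eq]
  exact intervalIntegral.integral_congr_ae (hg.mono fun x hx _ => hx)

theorem add (h : IsPrimitive f g) (h' : IsPrimitive f' g') :
    IsPrimitive (fun x => f x + f' x) (fun x => g x + g' x) := by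
  refine ⟨h.locallyIntegrable.add h'.locallyIntegrable, fun a b => ?_⟩
  rw [intervalIntegral.integral_add (h.intervalIntegrable a b) (h'.intervalIntegrable a b),
    ← h.sub_eq, ← h'.sub_eq]
  ring

theorem const_mul (h : IsPrimitive f g) (c : ℝ) :
    IsPrimitive (fun x => c * f x) (fun x => c * g x) := by
  refine ⟨h.locallyIntegrable.smul c, fun a b => ?_⟩
  rw [intervalIntegral.integral_const_mul, ← h.sub_eq]
  ring

theorem sub (h : IsPrimitive f g) (h' : IsPrimitive f' g') :
    IsPrimitive (fun x => f x - f' x) (fun x => g x - g' x) := by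
  simpa [sub_eq_add_neg] using h.add (h'.const_mul (-1))

theorem mul (h : IsPrimitive f g) (h' : IsPrimitive f' g') :
    IsPrimitive (fun x => f x * f' x) (fun x => g x * f' x + f x * g' x) := by
  refine ⟨(h.locallyIntegrable.mul_continuous h'.continuous).add
    (h'.locallyIntegrable.continuous_mul h.continuous), fun a b => ?_⟩
  rw [← (h.absolutelyContinuousOnInterval a b).integral_deriv_mul_eq_sub
    (h'.absolutelyContinuousOnInterval a b)]
  refine intervalIntegral.integral_congr_ae ?_
  filter_upwards [h.ae_hasDerivAt, h'.ae_hasDerivAt] with x h1 h2 _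
  rw [h1.deriv, h2.deriv]

/-- The derivative of a locally absolutely continuous function that is integrable together with
its derivative has integral zero. -/
theorem integral_eq_zero (h : IsPrimitive f g) (hf : Integrable f) (hg : Integrable g) :
    ∫ x, g x = 0 := by
  have key : ∀ (l : Filter ℝ) (L : ℝ), (∀ s ∈ l, (volume : Measure ℝ) s = ⊤) →
      Filter.Tendsto f l (nhds L) → L = 0 := fun l L hl ht =>
    (IntegrableAtFilter.eq_zero_of_tendsto ⟨Set.univ, Filter.univ_mem, hf.integrableOn⟩ hl ht)
  have top : Filter.Tendsto f Filter.atTop (nhds (f 0 + ∫ x in Set.Ioi 0, g x)) := by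
    rw [h.eq_fun 0]
    simpa using (intervalIntegral_tendsto_integral_Ioi 0 hg.integrableOn
      Filter.tendsto_id).const_add (f 0)
  have bot : Filter.Tendsto f Filter.atBot (nhds (f 0 - ∫ x in Set.Iic 0, g x)) := by
    have := (intervalIntegral_tendsto_integral_Iic 0 hg.integrableOn
      Filter.tendsto_id).const_sub (f 0)
    refine this.congr fun x => ?_
    rw [id, ← h.sub_eq]; ring
  have h1 := key _ _ (fun s hs => ?_) top
  · have h2 := key _ _ (fun s hs => ?_) bot
    · rw [← intervalIntegral.integral_Iic_add_Ioi (b := 0) hg.integrableOn hg.integrableOn]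
      linarith
    · obtain ⟨a, ha⟩ := Filter.mem_atBot_sets.1 hs
      exact top_unique ((Real.volume_Iic (a := a)).symm.le.trans (measure_mono ha))
  · obtain ⟨a, ha⟩ := Filter.mem_atTop_sets.1 hs
    exact top_unique ((Real.volume_Ici (a := a)).symm.le.trans (measure_mono ha))

theorem integral_mul_eq (h : IsPrimitive f g) (h' : IsPrimitive f' g') (a b : ℝ) :
    ∫ x in a..b, f x * g' x = f b * f' b - f a * f' a - ∫ x in a..b, g x * f' x := by
  rw [(h.mul h').sub_eq a b, intervalIntegral.integral_add]
  · ring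
  · exact intervalIntegrable_of_locallyIntegrable
      (h.locallyIntegrable.mul_continuous h'.continuous) _ _
  · exact intervalIntegrable_of_locallyIntegrable
      (h'.locallyIntegrable.continuous_mul h.continuous) _ _

/-- Integration by parts on the line. -/
theorem integral_mul_eq_neg (h : IsPrimitive f g) (h' : IsPrimitive f' g')
    (h1 : Integrable fun x => f x * f' x) (h2 : Integrable fun x => g x * f' x)
    (h3 : Integrable fun x => f x * g' x) :
    ∫ x, f x * g' x = -∫ x, g x * f' x := by
  have := (h.mul h').integral_eq_zero h1 (h2.add h3)
  rw [integral_add h2 h3] at this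
  linarith

end IsPrimitive

/-! ### Weighted `L²` bounds and window averages -/

theorem one_le_weight {β : ℝ} (hβ : 0 ≤ β) (x : ℝ) : 1 ≤ Real.cosh x ^ β :=
  Real.one_le_rpow (Real.one_le_cosh x) hβ

theorem weight_pos (β x : ℝ) : 0 < Real.cosh x ^ β := Real.rpow_pos_of_pos (Real.cosh_pos x) β

theorem continuous_weight (β : ℝ) : Continuous fun x => Real.cosh x ^ β :=
  Real.continuous_cosh.rpow_const fun x => Or.inl (Real.cosh_pos x).ne'

theorem cosh_le_exp_mul_cosh (x y : ℝ) : Real.cosh x ≤ Real.exp |x - y| * Real.cosh y := by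
  rw [Real.cosh_eq, Real.cosh_eq]
  have h1 := abs_le.1 (le_refl |x - y|)
  have : Real.exp x ≤ Real.exp |x - y| * Real.exp y := by
    rw [← Real.exp_add]; apply Real.exp_le_exp.2; linarith
  have : Real.exp (-x) ≤ Real.exp |x - y| * Real.exp (-y) := by
    rw [← Real.exp_add]; apply Real.exp_le_exp.2; linarith
  linarith

/-- The weight `cosh^β` varies by at most a constant factor over bounded distances; this is what
makes convolution-type operators with compactly supported kernels bounded on weighted spaces. -/
theorem weight_le_exp_mul_weight {β : ℝ} (hβ : 0 ≤ β) (x y : ℝ) :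
    Real.cosh x ^ β ≤ Real.exp (β * |x - y|) * Real.cosh y ^ β := by
  calc Real.cosh x ^ β ≤ (Real.exp |x - y| * Real.cosh y) ^ β :=
        Real.rpow_le_rpow (Real.cosh_pos x).le (cosh_le_exp_mul_cosh x y) hβ
    _ = _ := by
        rw [Real.mul_rpow (Real.exp_pos _).le (Real.cosh_pos y).le, ← Real.exp_mul, mul_comm β]

/-- The `L²` norm of `cosh^β u` is at most `R`. -/
structure L2Bound (β R : ℝ) (u : ℝ → ℝ) : Prop where
  aestronglyMeasurable : AEStronglyMeasurable u
  le : eLpNorm (fun x => Real.cosh x ^ β * u x) 2 volume ≤ ENNReal.ofReal R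

namespace L2Bound

variable {β R R' M : ℝ} {u v : ℝ → ℝ}

theorem aestronglyMeasurable_weight (h : L2Bound β R u) :
    AEStronglyMeasurable (fun x => Real.cosh x ^ β * u x) :=
  (continuous_weight β).aestronglyMeasurable.mul h.aestronglyMeasurable

theorem memLp_weight (h : L2Bound β R u) : MemLp (fun x => Real.cosh x ^ β * u x) 2 :=
  ⟨h.aestronglyMeasurable_weight, h.le.trans_lt ENNReal.ofReal_lt_top⟩

theorem mono (h : L2Bound β R u) (hR : R ≤ R') : L2Bound β R' u :=
  ⟨h.1, h.2.trans (ENNReal.ofReal_le_ofReal hR)⟩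

theorem of_norm_le (h : L2Bound β R u) (hv : AEStronglyMeasurable v)
    (huv : ∀ᵐ x, |v x| ≤ |u x|) : L2Bound β R v := by
  refine ⟨hv, (eLpNorm_mono_ae ?_).trans h.2⟩
  filter_upwards [huv] with x hx
  rw [norm_mul, norm_mul]
  exact mul_le_mul_of_nonneg_left hx (norm_nonneg _)

theorem congr (h : L2Bound β R u) (huv : u =ᵐ[volume] v) : L2Bound β R v :=
  h.of_norm_le (h.1.congr huv) (huv.mono fun x hx => by rw [hx])

theorem add (hu : L2Bound β R u) (hv : L2Bound β R' v) (hR : 0 ≤ R) (hR' : 0 ≤ R') :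
    L2Bound β (R + R') fun x => u x + v x := by
  refine ⟨hu.1.add hv.1, ?_⟩
  rw [ENNReal.ofReal_add hR hR']
  refine le_trans (le_of_eq_of_le ?_ (eLpNorm_add_le hu.aestronglyMeasurable_weight
    hv.aestronglyMeasurable_weight one_le_two)) (add_le_add hu.2 hv.2)
  congr 1
  ext x
  simp [mul_add]

theorem const_mul (hu : L2Bound β R u) (c : ℝ) : L2Bound β (|c| * R) fun x => c * u x := by
  refine ⟨hu.1.const_mul c, ?_⟩
  have : (fun x => Real.cosh x ^ β * (c * u x)) = c • fun x => Real.cosh x ^ β * u x := by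
    ext x; simp; ring
  rw [this, eLpNorm_const_smul, ENNReal.ofReal_mul (abs_nonneg c), Real.enorm_eq_ofReal_abs]
  gcongr
  exact hu.2

theorem neg (hu : L2Bound β R u) : L2Bound β R fun x => -u x :=
  hu.of_norm_le hu.1.neg (by simp)

theorem sub (hu : L2Bound β R u) (hv : L2Bound β R' v) (hR : 0 ≤ R) (hR' : 0 ≤ R') :
    L2Bound β (R + R') fun x => u x - v x := by
  simpa [sub_eq_add_neg] using hu.add hv.neg hR hR'

theorem bdd_mul (hu : L2Bound β R u) {m : ℝ → ℝ} (hm : AEStronglyMeasurable m)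
    (hM : ∀ x, |m x| ≤ M) : L2Bound β (M * R) fun x => m x * u x := by
  have hM0 : 0 ≤ M := (abs_nonneg _).trans (hM 0)
  rw [← abs_of_nonneg hM0]
  refine (hu.const_mul M).of_norm_le (hm.mul hu.1) (Filter.Eventually.of_forall fun x => ?_)
  rw [abs_mul, abs_mul, abs_of_nonneg hM0]
  exact mul_le_mul_of_nonneg_right (hM x) (abs_nonneg _)

theorem zero : L2Bound β 0 fun _ => 0 :=
  ⟨aestronglyMeasurable_const, by simp⟩

theorem ae_eq_zero (h : L2Bound β 0 u) : u =ᵐ[volume] 0 := by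
  have h1 := h.2
  rw [ENNReal.ofReal_zero, nonpos_iff_eq_zero, eLpNorm_eq_zero_iff h.aestronglyMeasurable_weight
    two_ne_zero] at h1
  filter_upwards [h1] with x hx
  simpa [(weight_pos β x).ne'] using hx

theorem memLp (hβ : 0 ≤ β) (h : L2Bound β R u) : MemLp u 2 :=
  h.memLp_weight.mono h.1 (Filter.Eventually.of_forall fun x => by
    rw [norm_mul]
    refine le_mul_of_one_le_left (norm_nonneg _) ?_
    exact (one_le_weight hβ x).trans (le_abs_self _))

theorem locallyIntegrable (hβ : 0 ≤ β) (h : L2Bound β R u) : LocallyIntegrable u :=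
  (h.memLp hβ).locallyIntegrable one_le_two

theorem comp_neg (h : L2Bound β R u) : L2Bound β R fun x => u (-x) := by
  have hm : MeasurePreserving (fun x : ℝ => -x) := Measure.measurePreserving_neg volume
  refine ⟨h.1.comp_measurePreserving hm, ?_⟩
  refine le_of_eq_of_le ?_ h.2
  rw [← eLpNorm_comp_measurePreserving h.aestronglyMeasurable_weight hm]
  congr 1
  ext x
  simp

theorem comp_add_right (hβ : 0 ≤ β) (h : L2Bound β R u) (a : ℝ) :
    L2Bound β (Real.exp (β * |a|) * R) fun x => u (x + a) := by
  have hm : MeasurePreserving (fun x : ℝ => x + a) := measurePreserving_add_right volume a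
  refine ⟨h.1.comp_measurePreserving hm, ?_⟩
  rw [ENNReal.ofReal_mul (Real.exp_pos _).le]
  refine le_trans ?_ (mul_le_mul_right h.2 _)
  rw [← eLpNorm_comp_measurePreserving h.aestronglyMeasurable_weight hm,
    ← Real.enorm_of_nonneg (Real.exp_pos _).le, ← eLpNorm_const_smul]
  refine eLpNorm_mono fun x => ?_
  simp only [Function.comp_apply, Pi.smul_apply, smul_eq_mul]
  rw [norm_mul, norm_mul, norm_mul, ← mul_assoc]
  refine mul_le_mul_of_nonneg_right ?_ (norm_nonneg _)
  rw [Real.norm_of_nonneg (weight_pos _ _).le, Real.norm_of_nonneg (weight_pos _ _).le,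
    Real.norm_of_nonneg (Real.exp_pos _).le]
  simpa using weight_le_exp_mul_weight hβ x (x + a)

end L2Bound

/-- The interval of length one centred at `x`. -/
def window (x : ℝ) : Set ℝ := Set.Ioc (x - 1 / 2) (x + 1 / 2)

theorem weight_mul_lintegral_window_le {β : ℝ} (hβ : 0 ≤ β) (u : ℝ → ℝ)
    (hu : AEStronglyMeasurable u) (x : ℝ) :
    ENNReal.ofReal (Real.cosh x ^ β) * ∫⁻ t in window x, ‖u t‖ₑ ≤
      ENNReal.ofReal (Real.exp (β / 2)) *
        eLpNorm (fun t => Real.cosh t ^ β * u t) 2 (volume.restrict (window x)) := by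
  have hm : AEStronglyMeasurable (fun t => Real.cosh t ^ β * u t) (volume.restrict (window x)) :=
    ((continuous_weight β).aestronglyMeasurable.mul hu).restrict
  have h1 := eLpNorm_le_eLpNorm_mul_rpow_measure_univ (p := 1) (q := 2) one_le_two hm
  have hvol : volume (window x) = 1 := by
    rw [window, Real.volume_Ioc]; norm_num
  rw [Measure.restrict_apply_univ, hvol, ENNReal.one_rpow, mul_one, eLpNorm_one_eq_lintegral_enorm]
    at h1
  refine le_trans ?_ (mul_le_mul_right h1 _)
  rw [← lintegral_const_mul' _ _ ENNReal.ofReal_ne_top,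
    ← lintegral_const_mul' _ _ ENNReal.ofReal_ne_top]
  refine setLIntegral_mono' measurableSet_Ioc fun t ht => ?_
  rw [enorm_mul, ← mul_assoc, Real.enorm_of_nonneg (weight_pos β t).le,
    ← ENNReal.ofReal_mul (Real.exp_pos _).le]
  gcongr
  refine (weight_le_exp_mul_weight hβ x t).trans ?_
  refine mul_le_mul_of_nonneg_right (Real.exp_le_exp.2 ?_) (weight_pos β t).le
  have : |x - t| ≤ 1 / 2 := by
    rw [abs_le]; constructor <;> linarith [ht.1, ht.2]
  nlinarith

theorem eLpNorm_two_sq {μ : Measure ℝ} (u : ℝ → ℝ) :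
    eLpNorm u 2 μ ^ 2 = ∫⁻ x, ‖u x‖ₑ ^ 2 ∂μ := by
  have := eLpNorm_nnreal_pow_eq_lintegral (μ := μ) (f := u) (p := 2) two_ne_zero
  simpa using this

theorem lintegral_window_lintegral {F : ℝ → ℝ≥0∞} (hF : AEMeasurable F) :
    ∫⁻ x, ∫⁻ t in window x, F t = ∫⁻ t, F t := by
  have hS : MeasurableSet {p : ℝ × ℝ | p.1 - 1 / 2 < p.2 ∧ p.2 ≤ p.1 + 1 / 2} :=
    (measurableSet_lt (f := fun p : ℝ × ℝ => p.1 - 1 / 2) (g := fun p : ℝ × ℝ => p.2)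
      (by fun_prop) (by fun_prop)).inter
      (measurableSet_le (f := fun p : ℝ × ℝ => p.2) (g := fun p : ℝ × ℝ => p.1 + 1 / 2)
        (by fun_prop) (by fun_prop))
  have h1 : ∀ x, ∫⁻ t in window x, F t = ∫⁻ t, {p : ℝ × ℝ | p.1 - 1 / 2 < p.2 ∧
      p.2 ≤ p.1 + 1 / 2}.indicator (fun p => F p.2) (x, t) := fun x => by
    rw [window, ← lintegral_indicator measurableSet_Ioc]
    rfl
  simp_rw [h1]
  rw [lintegral_lintegral_swap]
  · refine lintegral_congr fun t => ?_
    have h2 : (fun x => {p : ℝ × ℝ | p.1 - 1 / 2 < p.2 ∧ p.2 ≤ p.1 + 1 / 2}.indicator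
        (fun p => F p.2) (x, t)) = (Set.Ico (t - 1 / 2) (t + 1 / 2)).indicator fun _ => F t := by
      ext x
      simp only [Set.indicator_apply, Set.mem_ofPred_eq, Set.mem_Ico]
      refine if_congr ⟨fun h => ⟨?_, ?_⟩, fun h => ⟨?_, ?_⟩⟩ rfl rfl <;> linarith [h.1, h.2]
    rw [h2, lintegral_indicator measurableSet_Ico, setLIntegral_const, Real.volume_Ico]
    norm_num
  · exact (hF.comp_quasiMeasurePreserving Measure.quasiMeasurePreserving_snd).indicator hS

namespace L2Bound

variable {β R R' : ℝ} {u v p q : ℝ → ℝ}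

/-- Operators dominated by averages over unit windows are bounded on weighted `L²`. -/
theorem of_window (hβ : 0 ≤ β) (hu : L2Bound β R u) (hv : AEStronglyMeasurable v)
    (h : ∀ x, ‖v x‖ₑ ≤ ∫⁻ t in window x, ‖u t‖ₑ) :
    L2Bound β (Real.exp (β / 2) * R) v := by
  refine ⟨hv, ?_⟩
  rw [ENNReal.ofReal_mul (Real.exp_pos _).le]
  refine le_trans ?_ (mul_le_mul_right hu.2 _)
  rw [← ENNReal.pow_le_pow_left_iff two_ne_zero, mul_pow, eLpNorm_two_sq, eLpNorm_two_sq,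
    ← lintegral_window_lintegral (hu.aestronglyMeasurable_weight.enorm.pow_const 2),
    ← lintegral_const_mul' _ _ (by finiteness)]
  refine lintegral_mono fun x => ?_
  rw [← eLpNorm_two_sq, ← mul_pow]
  refine pow_le_pow_left₀ zero_le (le_trans ?_
    (weight_mul_lintegral_window_le hβ u hu.1 x)) 2
  rw [enorm_mul, Real.enorm_of_nonneg (weight_pos β x).le]
  exact mul_le_mul_right (h x) _

/-- Averages over unit windows of a weighted `L²` function obey the weighted sup bound. -/
theorem abs_le_of_window (hβ : 0 ≤ β) (hu : L2Bound β R u) (hR : 0 ≤ R) {x y : ℝ}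
    (h : ‖y‖ₑ ≤ ∫⁻ t in window x, ‖u t‖ₑ) :
    Real.cosh x ^ β * |y| ≤ Real.exp (β / 2) * R := by
  rw [← ENNReal.ofReal_le_ofReal_iff (by positivity), ENNReal.ofReal_mul (Real.exp_pos _).le,
    ENNReal.ofReal_mul (weight_pos β x).le, ← Real.enorm_eq_ofReal_abs]
  refine (mul_le_mul_right h _).trans ((weight_mul_lintegral_window_le hβ u hu.1 x).trans ?_)
  gcongr
  exact (eLpNorm_mono_measure _ Measure.restrict_le_self).trans hu.2

end L2Bound

theorem window_subset_uIcc (x : ℝ) : window x ⊆ Set.uIcc (x - 1 / 2) (x + 1 / 2) := by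
  rw [Set.uIcc_of_le (by linarith)]
  exact Set.Ioc_subset_Icc_self

theorem IsPrimitive.abs_sub_le {f g : ℝ → ℝ} (h : IsPrimitive f g) {x s t : ℝ}
    (hs : s ∈ Set.Icc (x - 1 / 2) (x + 1 / 2)) (ht : t ∈ Set.Icc (x - 1 / 2) (x + 1 / 2)) :
    |f t - f s| ≤ ∫ r in (x - 1 / 2)..(x + 1 / 2), |g r| := by
  have hst : Set.uIoc s t ⊆ Set.Ioc (x - 1 / 2) (x + 1 / 2) := fun r hr => by
    rcases Set.mem_uIoc.1 hr with hr | hr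
    · exact ⟨by linarith [hs.1, hr.1], by linarith [ht.2, hr.2]⟩
    · exact ⟨by linarith [ht.1, hr.1], by linarith [hs.2, hr.2]⟩
  rw [h.sub_eq s t, intervalIntegral.integral_of_le (by linarith : x - 1 / 2 ≤ x + 1 / 2),
    ← Real.norm_eq_abs]
  refine intervalIntegral.norm_integral_le_integral_norm_uIoc.trans ?_
  have hi := h.intervalIntegrable (x - 1 / 2) (x + 1 / 2)
  rw [intervalIntegrable_iff_integrableOn_Ioc_of_le (by linarith)] at hi
  exact setIntegral_mono_set hi.norm (Filter.Eventually.of_forall fun _ => norm_nonneg _)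
    (Filter.Eventually.of_forall hst)

theorem enorm_le_lintegral_window {y : ℝ} {x : ℝ} {F : ℝ → ℝ} (hF : LocallyIntegrable F)
    (h : |y| ≤ ∫ r in (x - 1 / 2)..(x + 1 / 2), |F r|) :
    ‖y‖ₑ ≤ ∫⁻ t in window x, ‖F t‖ₑ := by
  rw [intervalIntegral.integral_of_le (by linarith)] at h
  have hi : IntegrableOn F (window x) :=
    (hF.integrableOn_isCompact isCompact_uIcc).mono_set (window_subset_uIcc x)
  rw [← ofReal_integral_norm_eq_lintegral_enorm hi, ← ofReal_norm]
  exact ENNReal.ofReal_le_ofReal h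

/-- A one-dimensional Sobolev inequality on the unit window. -/
theorem IsPrimitive.abs_le {f g : ℝ → ℝ} (h : IsPrimitive f g) (x : ℝ) :
    |f x| ≤ ∫ r in (x - 1 / 2)..(x + 1 / 2), |(|f r| + |g r|)| := by
  have hf : ∀ a b, IntervalIntegrable (fun r => |f r|) volume a b := fun a b =>
    h.continuous.abs.intervalIntegrable a b
  have hg : IntervalIntegrable (fun r => |g r|) volume (x - 1 / 2) (x + 1 / 2) :=
    (h.intervalIntegrable _ _).abs
  have e : ∀ r, |(|f r| + |g r|)| = |f r| + |g r| := fun r => abs_of_nonneg (by positivity)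
  simp_rw [e]
  rw [intervalIntegral.integral_add (hf _ _) hg]
  set A := ∫ r in (x - 1 / 2)..(x + 1 / 2), |g r|
  have h1 : ∫ r in (x - 1 / 2)..(x + 1 / 2), (|f x| - A) ≤
      ∫ r in (x - 1 / 2)..(x + 1 / 2), |f r| := by
    refine intervalIntegral.integral_mono_on (by linarith) (by simp) (hf _ _) fun r hr => ?_
    have h2 : |f x - f r| ≤ A := h.abs_sub_le hr ⟨by linarith, by linarith⟩
    have h3 := abs_sub_abs_le_abs_sub (f x) (f r)
    linarith
  rw [intervalIntegral.integral_const] at h1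
  norm_num at h1
  linarith

/-- The derivative is controlled, on a unit window, by the function and its second derivative. -/
theorem IsPrimitive.abs_deriv_le {f p q : ℝ → ℝ} (hf : IsPrimitive f p) (hp : IsPrimitive p q)
    (x : ℝ) :
    |p x| ≤ ∫ r in (x - 1 / 2)..(x + 1 / 2), |(4 * |f r| + |q r|)| := by
  have hfi : ∀ a b, IntervalIntegrable (fun r => |f r|) volume a b := fun a b =>
    hf.continuous.abs.intervalIntegrable a b
  have hq : IntervalIntegrable (fun r => |q r|) volume (x - 1 / 2) (x + 1 / 2) :=
    (hp.intervalIntegrable _ _).abs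
  have e : ∀ r, |(4 * |f r| + |q r|)| = 4 * |f r| + |q r| := fun r => abs_of_nonneg (by positivity)
  simp_rw [e]
  rw [intervalIntegral.integral_add ((hfi _ _).const_mul 4) hq, intervalIntegral.integral_const_mul]
  set A := ∫ r in (x - 1 / 2)..(x + 1 / 2), |q r|
  -- For `a` in the left half of the window, `f (a + 1/2) - f a` is the integral of `p` over
  -- an interval of length `1/2`, on which `p` differs from `p x` by at most `A`.
  have key : ∀ a ∈ Set.Icc (x - 1 / 2) x, (1 / 2) * (|p x| - A) ≤ |f (a + 1 / 2)| + |f a| := by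
    intro a ha
    have h1 : |∫ r in a..(a + 1 / 2), (p r - p x)| ≤ A * |a + 1 / 2 - a| := by
      refine intervalIntegral.norm_integral_le_of_norm_le_const (E := ℝ) fun r hr => ?_
      rw [Set.uIoc_of_le (by linarith)] at hr
      exact hp.abs_sub_le ⟨by linarith, by linarith⟩
        ⟨by linarith [ha.1, hr.1], by linarith [ha.2, hr.2]⟩
    rw [intervalIntegral.integral_sub (hp.continuous.intervalIntegrable _ _) (by simp),
      ← hf.sub_eq, intervalIntegral.integral_const] at h1
    norm_num at h1
    have h2 : |1 / 2 * p x| = 1 / 2 * |p x| := by rw [abs_mul]; norm_num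
    have h3 : |1 / 2 * p x| ≤ |f (a + 1 / 2) - f a - 1 / 2 * p x| + |f (a + 1 / 2)| + |f a| := by
      have e : 1 / 2 * p x = -(f (a + 1 / 2) - f a - 1 / 2 * p x) + f (a + 1 / 2) + -f a := by ring
      calc |1 / 2 * p x| = |-(f (a + 1 / 2) - f a - 1 / 2 * p x) + f (a + 1 / 2) + -f a| := by
            rw [← e]
        _ ≤ _ := by
            refine (abs_add_three _ _ _).trans ?_
            rw [abs_neg, abs_neg]
    linarith
  have h1 : ∫ a in (x - 1 / 2)..x, (1 / 2) * (|p x| - A) ≤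
      ∫ a in (x - 1 / 2)..x, (|f (a + 1 / 2)| + |f a|) := by
    have hc := hf.continuous
    refine intervalIntegral.integral_mono_on (by linarith) (by simp) ?_ key
    exact Continuous.intervalIntegrable (by fun_prop) _ _
  rw [intervalIntegral.integral_const, intervalIntegral.integral_add
    (Continuous.intervalIntegrable (by have := hf.continuous; fun_prop) _ _) (hfi _ _),
    intervalIntegral.integral_comp_add_right (fun r => |f r|), add_comm,
    show x - 1 / 2 + 1 / 2 = x by ring,
    intervalIntegral.integral_add_adjacent_intervals (hfi _ _) (hfi _ _)] at h1
  norm_num at h1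
  norm_num
  linarith

namespace L2Bound

variable {β R R' : ℝ} {u v p q : ℝ → ℝ}

theorem abs (h : L2Bound β R u) : L2Bound β R fun x => |u x| :=
  h.of_norm_le (by simpa using h.1.norm) (by simp)

/-- Weighted interpolation: the first derivative is controlled by the function and its second
derivative. -/
theorem deriv_of_second (hβ : 0 ≤ β) (hu : IsPrimitive u p) (hp : IsPrimitive p q)
    (h : L2Bound β R u) (hq : L2Bound β R' q) (hR : 0 ≤ R) (hR' : 0 ≤ R') :
    L2Bound β (Real.exp (β / 2) * (4 * R + R')) p := by
  have h1 : L2Bound β (4 * R + R') fun r => 4 * |u r| + |q r| := by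
    have := h.abs.const_mul 4
    rw [show |(4 : ℝ)| = 4 by norm_num] at this
    exact this.add hq.abs (by positivity) hR'
  exact h1.of_window hβ hp.continuous.aestronglyMeasurable fun x =>
    enorm_le_lintegral_window (h1.locallyIntegrable hβ) (hu.abs_deriv_le hp x)

/-- Weighted Sobolev inequality `cosh^β |u| ≲ ‖u‖_{L²_β} + ‖u'‖_{L²_β}`. -/
theorem weight_mul_abs_le (hβ : 0 ≤ β) (hu : IsPrimitive u p)
    (h : L2Bound β R u) (hp : L2Bound β R' p) (hR : 0 ≤ R) (hR' : 0 ≤ R') (x : ℝ) :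
    Real.cosh x ^ β * |u x| ≤ Real.exp (β / 2) * (R + R') := by
  have h1 : L2Bound β (R + R') fun r => |u r| + |p r| := h.abs.add hp.abs hR hR'
  exact h1.abs_le_of_window hβ (by positivity)
    (enorm_le_lintegral_window (h1.locallyIntegrable hβ) (hu.abs_le x))

theorem abs_le (hβ : 0 ≤ β) (hu : IsPrimitive u p)
    (h : L2Bound β R u) (hp : L2Bound β R' p) (hR : 0 ≤ R) (hR' : 0 ≤ R') (x : ℝ) :
    |u x| ≤ Real.exp (β / 2) * (R + R') :=
  (le_mul_of_one_le_left (abs_nonneg _) (one_le_weight hβ x)).trans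
    (h.weight_mul_abs_le hβ hu hp hR hR' x)

end L2Bound

/-! ### Weak second derivatives are classical second derivatives almost everywhere -/

theorem isPrimitive_of_contDiff {f : ℝ → ℝ} (hf : ContDiff ℝ 1 f) : IsPrimitive f (deriv f) :=
  .of_hasDerivAt (fun x => (hf.differentiable one_ne_zero x).hasDerivAt)
    (hf.continuous_deriv le_rfl)

theorem contDiff_deriv_infty {f : ℝ → ℝ} (hf : ContDiff ℝ ∞ f) : ContDiff ℝ ∞ (deriv f) :=
  (contDiff_infty_iff_deriv.1 hf).2

theorem integrable_mul_of_hasCompactSupport {f φ : ℝ → ℝ}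
    (hf : LocallyIntegrable f) (hφ : Continuous φ) (hc : HasCompactSupport φ) :
    Integrable fun x => f x * φ x := by
  simpa [mul_comm] using hf.integrable_smul_left_of_hasCompactSupport hφ hc

theorem IsPrimitive.integral_mul_deriv_eq_neg {f g φ : ℝ → ℝ} (h : IsPrimitive f g)
    (hφ : ContDiff ℝ 1 φ) (hc : HasCompactSupport φ) :
    ∫ x, f x * deriv φ x = -∫ x, g x * φ x :=
  h.integral_mul_eq_neg (isPrimitive_of_contDiff hφ)
    (integrable_mul_of_hasCompactSupport h.continuous.locallyIntegrable hφ.continuous hc)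
    (integrable_mul_of_hasCompactSupport h.locallyIntegrable hφ.continuous hc)
    (integrable_mul_of_hasCompactSupport h.continuous.locallyIntegrable
      (hφ.continuous_deriv le_rfl) hc.deriv)

theorem hasWeakSecondDeriv_of_isPrimitive {u p q : ℝ → ℝ} (hu : IsPrimitive u p)
    (hp : IsPrimitive p q) : HasWeakSecondDeriv u q := by
  refine ⟨hu.continuous.locallyIntegrable, hp.locallyIntegrable, fun φ hφ hc => ?_⟩
  rw [hu.integral_mul_deriv_eq_neg ((contDiff_deriv_infty hφ).of_le (by simp)) hc.deriv,
    hp.integral_mul_deriv_eq_neg (hφ.of_le (by simp)) hc, neg_neg]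

namespace HasWeakSecondDeriv

variable {f f' g g' : ℝ → ℝ}

theorem congr (h : HasWeakSecondDeriv f g) (hf : f =ᵐ[volume] f') (hg : g =ᵐ[volume] g') :
    HasWeakSecondDeriv f' g' := by
  refine ⟨fun x => (h.1 x).congr hf, fun x => (h.2.1 x).congr hg, fun φ hφ hc => ?_⟩
  rw [← integral_congr_ae (f := fun x => f x * deriv (deriv φ) x)
    (hf.mono fun x hx => by simp only [hx]), h.2.2 φ hφ hc]
  exact integral_congr_ae (hg.mono fun x hx => by simp only [hx])

theorem add (h : HasWeakSecondDeriv f g) (h' : HasWeakSecondDeriv f' g') :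
    HasWeakSecondDeriv (fun x => f x + f' x) (fun x => g x + g' x) := by
  refine ⟨h.1.add h'.1, h.2.1.add h'.2.1, fun φ hφ hc => ?_⟩
  have h2 := (contDiff_deriv_infty (contDiff_deriv_infty hφ)).continuous
  simp_rw [add_mul]
  rw [integral_add (integrable_mul_of_hasCompactSupport h.1 h2 hc.deriv.deriv)
      (integrable_mul_of_hasCompactSupport h'.1 h2 hc.deriv.deriv), h.2.2 φ hφ hc,
    h'.2.2 φ hφ hc, integral_add (integrable_mul_of_hasCompactSupport h.2.1 hφ.continuous hc)
      (integrable_mul_of_hasCompactSupport h'.2.1 hφ.continuous hc)]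

theorem const_mul (h : HasWeakSecondDeriv f g) (c : ℝ) :
    HasWeakSecondDeriv (fun x => c * f x) (fun x => c * g x) := by
  refine ⟨h.1.smul c, h.2.1.smul c, fun φ hφ hc => ?_⟩
  simp_rw [mul_assoc, integral_const_mul, h.2.2 φ hφ hc]

theorem sub (h : HasWeakSecondDeriv f g) (h' : HasWeakSecondDeriv f' g') :
    HasWeakSecondDeriv (fun x => f x - f' x) (fun x => g x - g' x) := by
  simpa [sub_eq_add_neg] using h.add (h'.const_mul (-1))

theorem ae_unique (h : HasWeakSecondDeriv f g) (h' : HasWeakSecondDeriv f g') :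
    g =ᵐ[volume] g' :=
  ae_eq_of_integral_contDiff_smul_eq h.2.1 h'.2.1 fun φ hφ hc => by
    simp_rw [smul_eq_mul, mul_comm (φ _), ← h.2.2 φ hφ hc, ← h'.2.2 φ hφ hc]

end HasWeakSecondDeriv

/-- A test function of mean zero has a primitive that is a test function. -/
theorem exists_testFunction_deriv_eq {ψ : ℝ → ℝ} (hψ : ContDiff ℝ ∞ ψ) (hc : HasCompactSupport ψ)
    (h0 : ∫ x, ψ x = 0) :
    ∃ Ψ : ℝ → ℝ, ContDiff ℝ ∞ Ψ ∧ HasCompactSupport Ψ ∧ deriv Ψ = ψ := by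
  obtain ⟨R, hR0, hR⟩ := hc.exists_pos_le_norm
  have hi : Integrable ψ := hψ.continuous.integrable_of_hasCompactSupport hc
  have hd : ∀ x, HasDerivAt (fun x => ∫ t in (-R)..x, ψ t) (ψ x) x := fun x =>
    (IsPrimitive.integral hψ.continuous.locallyIntegrable (-R)).hasDerivAt hψ.continuous x
  have hde : deriv (fun x => ∫ t in (-R)..x, ψ t) = ψ := funext fun x => (hd x).deriv
  refine ⟨fun x => ∫ t in (-R)..x, ψ t, ?_, ?_, hde⟩
  · rw [contDiff_infty_iff_deriv, hde]
    exact ⟨fun x => (hd x).differentiableAt, hψ⟩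
  · refine HasCompactSupport.intro (isCompact_Icc (a := -R) (b := R)) fun x hx => ?_
    have hz : ∀ y, y ≤ -R ∨ R ≤ y → ψ y = 0 := fun y hy => hR y (by
      rw [Real.norm_eq_abs, le_abs]
      rcases hy with hy | hy
      · right; linarith
      · left; exact hy)
    rcases lt_or_ge x (-R) with h | h
    · rw [intervalIntegral.integral_symm, neg_eq_zero]
      refine (intervalIntegral.integral_congr (g := fun _ => 0) fun y hy => ?_).trans (by simp)
      rw [Set.uIcc_of_le h.le] at hy
      exact hz y (Or.inl hy.2)
    · have hx' : R < x := by
        by_contra hxR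
        exact hx ⟨h, not_lt.1 hxR⟩
      rw [intervalIntegral.integral_of_le (by linarith), setIntegral_eq_integral_of_forall_compl_eq_zero, h0]
      intro y hy
      refine hz y ?_
      by_contra hcon
      push Not at hcon
      exact hy ⟨hcon.1, by linarith⟩

/-- The du Bois-Reymond lemma of second order: a function with weak second derivative `g` agrees
almost everywhere with a twice iterated indefinite integral of `g`. -/
theorem HasWeakSecondDeriv.exists_isPrimitive {f g : ℝ → ℝ} (h : HasWeakSecondDeriv f g) :
    ∃ u p : ℝ → ℝ, IsPrimitive u p ∧ IsPrimitive p g ∧ f =ᵐ[volume] u := by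
  have hP := IsPrimitive.integral h.2.1 0
  have hv := IsPrimitive.integral hP.continuous.locallyIntegrable 0
  set P : ℝ → ℝ := fun x => ∫ t in (0 : ℝ)..x, g t
  set v : ℝ → ℝ := fun x => ∫ t in (0 : ℝ)..x, P t
  -- The difference `d` annihilates all second derivatives of test functions, hence is affine.
  have hd : HasWeakSecondDeriv (fun x => f x - v x) (fun x => g x - g x) :=
    h.sub (hasWeakSecondDeriv_of_isPrimitive hv hP)
  set d : ℝ → ℝ := fun x => f x - v x
  let η₀ : ContDiffBump (0 : ℝ) := default
  set η : ℝ → ℝ := η₀.normed volume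
  have hη : ContDiff ℝ ∞ η := η₀.contDiff_normed
  have hηc : HasCompactSupport η := η₀.hasCompactSupport_normed
  have hη1 : ∫ x, η x = 1 := η₀.integral_normed
  have hid : ∀ {φ : ℝ → ℝ}, ContDiff ℝ ∞ φ → HasCompactSupport φ →
      Integrable fun x => d x * φ x := fun hφ hc =>
    integrable_mul_of_hasCompactSupport hd.1 hφ.continuous hc
  have hidx : ∀ {φ : ℝ → ℝ}, ContDiff ℝ ∞ φ → HasCompactSupport φ →
      Integrable fun x => x * φ x := fun hφ hc =>
    integrable_mul_of_hasCompactSupport continuous_id.locallyIntegrable hφ.continuous hc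
  have hii : ∀ {φ : ℝ → ℝ}, ContDiff ℝ ∞ φ → HasCompactSupport φ → Integrable φ := fun hφ hc =>
    hφ.continuous.integrable_of_hasCompactSupport hc
  set A := ∫ x, d x * η x
  set B := ∫ x, d x * deriv η x
  set m := ∫ x, x * η x
  have hmain : ∀ᵐ x, d x = A + m * B - B * x := by
    refine ae_eq_of_integral_contDiff_smul_eq hd.1
      (Continuous.locallyIntegrable (by fun_prop)) fun ψ hψ hψc => ?_
    set c₀ := ∫ x, ψ x
    have h1s : ContDiff ℝ ∞ fun x => ψ x - c₀ * η x := hψ.sub (contDiff_const.mul hη)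
    have h1c : HasCompactSupport fun x => ψ x - c₀ * η x := hψc.sub hηc.mul_left
    obtain ⟨Ψ, hΨ, hΨc, hΨd⟩ := exists_testFunction_deriv_eq h1s h1c (by
      rw [integral_sub (hii hψ hψc) ((hii hη hηc).const_mul _), integral_const_mul, hη1]
      simp [c₀])
    set c₁ := ∫ x, Ψ x
    have h2s : ContDiff ℝ ∞ fun x => Ψ x - c₁ * η x := hΨ.sub (contDiff_const.mul hη)
    have h2c : HasCompactSupport fun x => Ψ x - c₁ * η x := hΨc.sub hηc.mul_left
    obtain ⟨Φ, hΦ, hΦc, hΦd⟩ := exists_testFunction_deriv_eq h2s h2c (by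
      rw [integral_sub (hii hΨ hΨc) ((hii hη hηc).const_mul _), integral_const_mul, hη1]
      simp [c₁])
    have hΦdd : deriv (deriv Φ) = fun x => ψ x - c₀ * η x - c₁ * deriv η x := by
      rw [hΦd]
      ext x
      rw [deriv_fun_sub (hΨ.differentiable (by simp) x)
        ((hη.differentiable (by simp) x).const_mul c₁), deriv_const_mul_field, hΨd]
    have e1 : ∫ x, d x * deriv (deriv Φ) x = 0 := by
      rw [hd.2.2 Φ hΦ hΦc]; simp
    have e2 : ∫ x, d x * deriv (deriv Φ) x = (∫ x, d x * ψ x) - c₀ * A - c₁ * B := by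
      rw [hΦdd]
      have : ∀ x, d x * (ψ x - c₀ * η x - c₁ * deriv η x)
          = d x * ψ x - c₀ * (d x * η x) - c₁ * (d x * deriv η x) := fun x => by ring
      simp_rw [this]
      have i2 := (hid hη hηc).const_mul c₀
      have i3 := (hid (contDiff_deriv_infty hη) hηc.deriv).const_mul c₁
      have i1 : Integrable fun x => d x * ψ x - c₀ * (d x * η x) := (hid hψ hψc).sub i2
      rw [integral_sub i1 i3, integral_sub (hid hψ hψc) i2,
        integral_const_mul, integral_const_mul]
    have e3 : c₁ = -(∫ x, x * ψ x) + c₀ * m := by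
      have := (IsPrimitive.of_hasDerivAt (f := fun x : ℝ => x) (g := fun _ => 1)
        (fun x => hasDerivAt_id x) continuous_const).integral_mul_deriv_eq_neg
        (hΨ.of_le (by simp)) hΨc
      rw [hΨd] at this
      have e : ∀ x, x * (ψ x - c₀ * η x) = x * ψ x - c₀ * (x * η x) := fun x => by ring
      simp_rw [e] at this
      rw [integral_sub (hidx hψ hψc) ((hidx hη hηc).const_mul _), integral_const_mul] at this
      simp only [one_mul] at this
      linarith
    have e4 : ∫ x, ψ x • (A + m * B - B * x) = c₀ * (A + m * B) - B * ∫ x, x * ψ x := by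
      have : ∀ x, ψ x • (A + m * B - B * x) = (A + m * B) * ψ x - B * (x * ψ x) := fun x => by
        rw [smul_eq_mul]; ring
      simp_rw [this]
      rw [integral_sub ((hii hψ hψc).const_mul _) ((hidx hψ hψc).const_mul _),
        integral_const_mul, integral_const_mul]
      ring
    rw [e4]
    simp_rw [smul_eq_mul, mul_comm (ψ _)]
    rw [e2, e3] at e1
    linarith
  have haff : IsPrimitive (fun x : ℝ => A + m * B - B * x) fun _ => -B :=
    .of_hasDerivAt (fun x => by
      simpa using ((hasDerivAt_id x).const_mul B).const_sub (A + m * B)) continuous_const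
  have hconst : IsPrimitive (fun _ : ℝ => -B) fun _ => 0 :=
    .of_hasDerivAt (fun x => hasDerivAt_const x _) continuous_const
  refine ⟨_, _, hv.add haff, by simpa using hP.add hconst, ?_⟩
  filter_upwards [hmain] with x hx
  simp only [d] at hx
  linarith

/-! ### Fourier side: Sobolev norms and weak derivatives -/

open scoped SchwartzMap Laplacian

theorem laplacian_schwartzMap_apply (φ : 𝓢(ℝ, ℂ)) (x : ℝ) : (Δ φ) x = deriv (deriv φ) x := by
  rw [SchwartzMap.laplacian_apply]
  simp [InnerProductSpace.laplacian_eq_iteratedDeriv_real, iteratedDeriv_succ]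

theorem integral_mul_second_deriv_eq {u p q a a' a'' : ℝ → ℝ} (hu : IsPrimitive u p)
    (hp : IsPrimitive p q) (hu2 : MemLp u 2) (hp2 : MemLp p 2) (hq2 : MemLp q 2)
    (ha : IsPrimitive a a') (ha' : IsPrimitive a' a'')
    (ha2 : MemLp a 2) (ha2' : MemLp a' 2) (ha2'' : MemLp a'' 2) :
    ∫ x, u x * a'' x = ∫ x, q x * a x := by
  rw [hu.integral_mul_eq_neg ha' (hu2.integrable_mul ha2') (hp2.integrable_mul ha2')
      (hu2.integrable_mul ha2''),
    hp.integral_mul_eq_neg ha (hp2.integrable_mul ha2) (hq2.integrable_mul ha2)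
      (hp2.integrable_mul ha2'), neg_neg]

theorem toTemperedDistribution_toLp_ofReal_apply {u : ℝ → ℝ}
    (h : MemLp (fun x => (u x : ℂ)) 2 (volume : Measure ℝ)) (φ : 𝓢(ℝ, ℂ)) :
    Lp.toTemperedDistribution (h.toLp (fun x => (u x : ℂ))) φ = ∫ x, φ x • (u x : ℂ) := by
  rw [Lp.toTemperedDistribution_apply]
  refine integral_congr_ae ?_
  filter_upwards [h.coeFn_toLp] with x hx
  rw [hx]

/-- The `L²` function `q = u''` is the distributional Laplacian of `u`. -/
theorem laplacian_toTemperedDistribution {u p q : ℝ → ℝ} (hu : IsPrimitive u p)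
    (hp : IsPrimitive p q) (hp2 : MemLp p 2)
    (hu2 : MemLp (fun x => (u x : ℂ)) 2 (volume : Measure ℝ))
    (hq2 : MemLp (fun x => (q x : ℂ)) 2 (volume : Measure ℝ)) :
    Δ (Lp.toTemperedDistribution (hu2.toLp (fun x => (u x : ℂ)))) =
      Lp.toTemperedDistribution (hq2.toLp (fun x => (q x : ℂ))) := by
  ext φ
  rw [TemperedDistribution.laplacian_apply_apply, toTemperedDistribution_toLp_ofReal_apply,
    toTemperedDistribution_toLp_ofReal_apply]
  have hur : MemLp u 2 := by simpa using hu2.re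
  have hqr : MemLp q 2 := by simpa using hq2.re
  have hφ : ContDiff ℝ ∞ (φ : ℝ → ℂ) := φ.smooth ⊤
  have h0 : MemLp (φ : ℝ → ℂ) 2 := φ.memLp 2
  have hdS : ∀ ψ : 𝓢(ℝ, ℂ), (SchwartzMap.derivCLM ℂ ℂ ψ : ℝ → ℂ) = deriv ψ := fun ψ =>
    funext fun x => SchwartzMap.derivCLM_apply ℂ ψ x
  have h1 : MemLp (deriv φ) 2 := by
    rw [← hdS]
    exact (SchwartzMap.derivCLM ℂ ℂ φ).memLp 2
  have h2 : MemLp (deriv (deriv φ)) 2 := by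
    rw [← hdS, ← hdS]
    exact (SchwartzMap.derivCLM ℂ ℂ (SchwartzMap.derivCLM ℂ ℂ φ)).memLp 2
  have hd1 : ∀ x, HasDerivAt φ (deriv φ x) x := fun x =>
    (hφ.differentiable (by simp) x).hasDerivAt
  have hφ' : ContDiff ℝ ∞ (deriv φ) := (contDiff_infty_iff_deriv.1 hφ).2
  have hφ'' : ContDiff ℝ ∞ (deriv (deriv φ)) := (contDiff_infty_iff_deriv.1 hφ').2
  have hd2 : ∀ x, HasDerivAt (deriv φ) (deriv (deriv φ) x) x := fun x =>
    (hφ'.differentiable (by simp) x).hasDerivAt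
  have hre := integral_mul_second_deriv_eq hu hp hur hp2 hqr
    (IsPrimitive.of_hasDerivAt
      (fun x => Complex.reCLM.hasFDerivAt.comp_hasDerivAt x (hd1 x))
      (Complex.continuous_re.comp hφ'.continuous))
    (IsPrimitive.of_hasDerivAt
      (fun x => Complex.reCLM.hasFDerivAt.comp_hasDerivAt x (hd2 x))
      (Complex.continuous_re.comp hφ''.continuous)) h0.re h1.re h2.re
  have him := integral_mul_second_deriv_eq hu hp hur hp2 hqr
    (IsPrimitive.of_hasDerivAt
      (fun x => Complex.imCLM.hasFDerivAt.comp_hasDerivAt x (hd1 x))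
      (Complex.continuous_im.comp hφ'.continuous))
    (IsPrimitive.of_hasDerivAt
      (fun x => Complex.imCLM.hasFDerivAt.comp_hasDerivAt x (hd2 x))
      (Complex.continuous_im.comp hφ''.continuous)) h0.im h1.im h2.im
  simp_rw [laplacian_schwartzMap_apply]
  have i1 : Integrable fun x => deriv (deriv φ) x • (u x : ℂ) := h2.integrable_mul hu2
  have i2 : Integrable fun x => φ x • (q x : ℂ) := h0.integrable_mul hq2
  rw [← integral_re_add_im i1, ← integral_re_add_im i2]
  have e1 : ∀ (z : ℂ) (r : ℝ), RCLike.re (z • (r : ℂ)) = r * z.re := fun z r => by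
    simp [mul_comm]
  have e2 : ∀ (z : ℂ) (r : ℝ), RCLike.im (z • (r : ℂ)) = r * z.im := fun z r => by
    simp [mul_comm]
  simp_rw [e1, e2]
  have hre' : ∫ x, u x * (deriv (deriv φ) x).re = ∫ x, q x * (φ x).re := hre
  have him' : ∫ x, u x * (deriv (deriv φ) x).im = ∫ x, q x * (φ x).im := him
  rw [hre', him']

theorem fourier_laplacian_eq (T : 𝓢'(ℝ, ℂ)) :
    𝓕 (Δ T) = ((-(2 * Real.pi) ^ 2 : ℝ) : ℂ) •
      TemperedDistribution.smulLeftCLM ℂ (fun x : ℝ => ((‖x‖ ^ 2 : ℝ) : ℂ)) (𝓕 T) := by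
  rw [TemperedDistribution.laplacian_eq_fourierMultiplierCLM,
    TemperedDistribution.fourierMultiplierCLM_apply, ← Complex.coe_smul,
    FourierTransform.fourier_smul,
    FourierTransform.fourier_fourierInv_eq]

theorem hasTemperateGrowth_norm_sq :
    (fun x : ℝ => ((‖x‖ ^ 2 : ℝ) : ℂ)).HasTemperateGrowth := by fun_prop

/-- On the Fourier side, `u'' = q` reads `q̂ = -(2πξ)² û`. -/
theorem ae_fourier_eq_of_laplacian_eq {U Q : Lp ℂ 2 (volume : Measure ℝ)}
    (h : Δ (Lp.toTemperedDistribution U) = Lp.toTemperedDistribution Q) :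
    ∀ᵐ ξ, (𝓕 Q : Lp ℂ 2 (volume : Measure ℝ)) ξ =
      ((-(2 * Real.pi) ^ 2 * ‖ξ‖ ^ 2 : ℝ) : ℂ) * (𝓕 U : Lp ℂ 2 (volume : Measure ℝ)) ξ := by
  have h1 := congrArg 𝓕 h
  rw [fourier_laplacian_eq, Lp.fourier_toTemperedDistribution_eq,
    Lp.fourier_toTemperedDistribution_eq] at h1
  refine ae_eq_of_integral_contDiff_smul_eq ((Lp.memLp (𝓕 Q)).locallyIntegrable one_le_two) ?_
    fun g hg hgc => ?_
  · exact ((Lp.memLp (𝓕 U)).locallyIntegrable one_le_two).continuous_mul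
      (by fun_prop)
  · have hg₁ : HasCompactSupport (Complex.ofRealCLM ∘ g) := hgc.comp_left rfl
    have hg₂ : ContDiff ℝ ∞ (Complex.ofRealCLM ∘ g) := by fun_prop
    have h2 := DFunLike.congr_fun h1 (hg₁.toSchwartzMap hg₂)
    rw [Lp.toTemperedDistribution_apply] at h2
    simp only [smul_apply,
      TemperedDistribution.smulLeftCLM_apply_apply] at h2
    rw [Lp.toTemperedDistribution_apply] at h2
    have e1 : ∀ x, g x • (𝓕 Q : Lp ℂ 2 (volume : Measure ℝ)) x =
        (hg₁.toSchwartzMap hg₂) x • (𝓕 Q : Lp ℂ 2 (volume : Measure ℝ)) x := fun x => by simp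
    simp_rw [e1]
    rw [← h2, ← integral_smul]
    refine integral_congr_ae (Filter.Eventually.of_forall fun x => ?_)
    simp only [SchwartzMap.smulLeftCLM_apply_apply hasTemperateGrowth_norm_sq]
    simp
    ring

theorem laplacian_eq_of_ae_fourier_eq {U Q : Lp ℂ 2 (volume : Measure ℝ)}
    (h : ∀ᵐ ξ, (𝓕 Q : Lp ℂ 2 (volume : Measure ℝ)) ξ =
      ((-(2 * Real.pi) ^ 2 * ‖ξ‖ ^ 2 : ℝ) : ℂ) * (𝓕 U : Lp ℂ 2 (volume : Measure ℝ)) ξ) :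
    Δ (Lp.toTemperedDistribution U) = Lp.toTemperedDistribution Q := by
  rw [← FourierTransform.fourierInv_fourier_eq (F := 𝓢'(ℝ, ℂ)) (Δ (Lp.toTemperedDistribution U)),
    ← FourierTransform.fourierInv_fourier_eq (F := 𝓢'(ℝ, ℂ)) (Lp.toTemperedDistribution Q)]
  congr 1
  rw [fourier_laplacian_eq, Lp.fourier_toTemperedDistribution_eq,
    Lp.fourier_toTemperedDistribution_eq]
  ext g
  rw [Lp.toTemperedDistribution_apply]
  simp only [smul_apply,
    TemperedDistribution.smulLeftCLM_apply_apply]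
  rw [Lp.toTemperedDistribution_apply, ← integral_smul]
  refine integral_congr_ae ?_
  filter_upwards [h] with x hx
  rw [hx]
  simp only [SchwartzMap.smulLeftCLM_apply_apply hasTemperateGrowth_norm_sq]
  simp
  ring

theorem eLpNorm_ofReal (u : ℝ → ℝ) : eLpNorm (fun x => (u x : ℂ)) 2 volume = eLpNorm u 2 volume :=
  eLpNorm_congr_norm_ae (Filter.Eventually.of_forall fun x => by simp)

/-- The Fourier side of the `H^s` norm, for a function known to be in `L²`. -/
theorem eHsNorm_eq (s : ℝ) {f : ℝ → ℝ} (h : MemLp (fun x => (f x : ℂ)) 2 (volume : Measure ℝ)) :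
    eHsNorm s f = eLpNorm (fun ξ : ℝ => (((1 + ‖ξ‖ ^ 2) ^ (s / 2) : ℝ) : ℂ) *
      (𝓕 (h.toLp (fun x => (f x : ℂ))) : Lp ℂ 2 (volume : Measure ℝ)) ξ) 2 volume :=
  iInf_pos h

theorem norm_besselSymbol (s ξ : ℝ) :
    ‖(((1 + ‖ξ‖ ^ 2) ^ (s / 2) : ℝ) : ℂ)‖ = (1 + ‖ξ‖ ^ 2) ^ (s / 2) := by
  rw [Complex.norm_real, Real.norm_of_nonneg (by positivity)]

theorem eHsNorm_mono {s t : ℝ} (hst : s ≤ t) (f : ℝ → ℝ) : eHsNorm s f ≤ eHsNorm t f := by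
  refine le_iInf fun h => ?_
  rw [eHsNorm_eq s h]
  refine eLpNorm_mono fun ξ => ?_
  rw [norm_mul, norm_mul]
  refine mul_le_mul_of_nonneg_right ?_ (norm_nonneg _)
  rw [norm_besselSymbol, norm_besselSymbol]
  exact Real.rpow_le_rpow_of_exponent_le (le_add_of_nonneg_right (sq_nonneg _)) (by linarith)

theorem eHsNorm_zero {f : ℝ → ℝ} (h : MemLp f 2) : eHsNorm 0 f = eLpNorm f 2 volume := by
  have hC : MemLp (fun x => (f x : ℂ)) 2 (volume : Measure ℝ) := h.ofReal
  rw [eHsNorm_eq 0 hC, ← eLpNorm_ofReal, ← Lp.enorm_toLp hC]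
  simp only [zero_div, Real.rpow_zero, Complex.ofReal_one, one_mul]
  rw [← Lp.enorm_def, ← ofReal_norm, ← ofReal_norm, Lp.norm_fourier_eq]

theorem MemHs.memLp {s : ℝ} {f : ℝ → ℝ} (h : MemHs s f) : MemLp f 2 := by
  simpa using h.choose.re

theorem eLpNorm_le_eHsNorm {s : ℝ} (hs : 0 ≤ s) {f : ℝ → ℝ} (h : MemLp f 2) :
    eLpNorm f 2 volume ≤ eHsNorm s f := by
  rw [← eHsNorm_zero h]
  exact eHsNorm_mono hs f

theorem memHs_zero {f : ℝ → ℝ} (h : MemLp f 2) : MemHs 0 f := by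
  rw [memHs_iff 0 le_rfl, eHsNorm_zero h]
  exact h.2

theorem one_le_two_pi_sq : (1 : ℝ) ≤ (2 * Real.pi) ^ 2 := by
  nlinarith [Real.pi_gt_three]

/-- Two more derivatives: `‖u‖_{H^{s+2}} ≤ ‖u‖_{H^s} + ‖u''‖_{H^s}`. -/
theorem eHsNorm_add_two_le (s : ℝ) {u p q : ℝ → ℝ} (hu : IsPrimitive u p)
    (hp : IsPrimitive p q) (hu2 : MemLp u 2) (hp2 : MemLp p 2) (hq2 : MemLp q 2) :
    eHsNorm (s + 2) u ≤ eHsNorm s u + eHsNorm s q := by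
  have hue : MemLp (fun x => (u x : ℂ)) 2 (volume : Measure ℝ) := hu2.ofReal
  have hqe : MemLp (fun x => (q x : ℂ)) 2 (volume : Measure ℝ) := hq2.ofReal
  have hF := ae_fourier_eq_of_laplacian_eq (laplacian_toTemperedDistribution hu hp hp2 hue hqe)
  rw [eHsNorm_eq _ hue, eHsNorm_eq _ hue, eHsNorm_eq _ hqe]
  set U : Lp ℂ 2 (volume : Measure ℝ) := 𝓕 (hue.toLp fun x => (u x : ℂ))
  set Q : Lp ℂ 2 (volume : Measure ℝ) := 𝓕 (hqe.toLp fun x => (q x : ℂ))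
  have hw : Continuous fun ξ : ℝ => (((1 + ‖ξ‖ ^ 2) ^ (s / 2) : ℝ) : ℂ) :=
    Complex.continuous_ofReal.comp (Continuous.rpow_const (by fun_prop)
      fun x => Or.inl (by positivity))
  set A : ℝ → ℂ := fun ξ => (((1 + ‖ξ‖ ^ 2) ^ (s / 2) : ℝ) : ℂ) * U ξ with hA
  set B : ℝ → ℂ := fun ξ => (((1 + ‖ξ‖ ^ 2) ^ (s / 2) : ℝ) : ℂ) * Q ξ with hB
  have hAm : AEStronglyMeasurable A := hw.aestronglyMeasurable.mul (Lp.aestronglyMeasurable U)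
  have hBm : AEStronglyMeasurable B := hw.aestronglyMeasurable.mul (Lp.aestronglyMeasurable Q)
  have hadd := eLpNorm_add_le hAm.norm hBm.norm (p := 2) one_le_two
  rw [eLpNorm_norm, eLpNorm_norm] at hadd
  refine le_trans (eLpNorm_mono_ae ?_) hadd
  filter_upwards [hF] with ξ hξ
  have hpos : 0 < 1 + ‖ξ‖ ^ 2 := by positivity
  have e : (1 + ‖ξ‖ ^ 2) ^ ((s + 2) / 2) = (1 + ‖ξ‖ ^ 2) ^ (s / 2) * (1 + ‖ξ‖ ^ 2) := by
    rw [show (s + 2) / 2 = s / 2 + 1 by ring, Real.rpow_add hpos, Real.rpow_one]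
  have hQn : ‖Q ξ‖ = (2 * Real.pi) ^ 2 * ‖ξ‖ ^ 2 * ‖U ξ‖ := by
    rw [hξ, norm_mul, Complex.norm_real, norm_mul, norm_neg, Real.norm_of_nonneg (sq_nonneg _),
      Real.norm_of_nonneg (sq_nonneg _)]
  refine le_trans ?_ (le_abs_self _)
  simp only [Pi.add_apply, hA, hB]
  rw [norm_mul, norm_mul, norm_mul, norm_besselSymbol, norm_besselSymbol, e, hQn]
  have h1 : ‖ξ‖ ^ 2 ≤ (2 * Real.pi) ^ 2 * ‖ξ‖ ^ 2 :=
    le_mul_of_one_le_left (sq_nonneg _) one_le_two_pi_sq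
  have h2 : 0 ≤ (1 + ‖ξ‖ ^ 2) ^ (s / 2) * ‖U ξ‖ := by positivity
  nlinarith [mul_le_mul_of_nonneg_left h1 h2]

/-- A function in `H²` has a weak second derivative in `L²`, of norm at most `4π²` times the `H²`
norm. -/
theorem MemHs.exists_hasWeakSecondDeriv {u : ℝ → ℝ} (h : MemHs 2 u) :
    ∃ q : ℝ → ℝ, HasWeakSecondDeriv u q ∧ MemLp q 2 ∧
      eLpNorm q 2 volume ≤ ENNReal.ofReal ((2 * Real.pi) ^ 2) * eHsNorm 2 u := by
  have hu2 := h.memLp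
  have hue : MemLp (fun x => (u x : ℂ)) 2 (volume : Measure ℝ) := hu2.ofReal
  have hlt := (memHs_iff 2 zero_le_two u).1 h
  rw [eHsNorm_eq _ hue] at hlt ⊢
  set U : Lp ℂ 2 (volume : Measure ℝ) := 𝓕 (hue.toLp fun x => (u x : ℂ)) with hU
  have hle : eLpNorm (fun ξ : ℝ => ((-(2 * Real.pi) ^ 2 * ‖ξ‖ ^ 2 : ℝ) : ℂ) * U ξ) 2 volume ≤
      ENNReal.ofReal ((2 * Real.pi) ^ 2) *
        eLpNorm (fun ξ : ℝ => (((1 + ‖ξ‖ ^ 2) ^ ((2 : ℝ) / 2) : ℝ) : ℂ) * U ξ) 2 volume := by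
    rw [← Real.enorm_of_nonneg (sq_nonneg (2 * Real.pi)), ← eLpNorm_const_smul]
    refine eLpNorm_mono fun ξ => ?_
    rw [Pi.smul_apply, norm_smul, norm_mul, norm_mul, norm_besselSymbol, Complex.norm_real,
      norm_mul, norm_neg, div_self two_ne_zero, Real.rpow_one, mul_assoc,
      Real.norm_of_nonneg (sq_nonneg ‖ξ‖)]
    gcongr
    linarith
  have hG : MemLp (fun ξ : ℝ => ((-(2 * Real.pi) ^ 2 * ‖ξ‖ ^ 2 : ℝ) : ℂ) * U ξ) 2 volume :=
    ⟨(Continuous.aestronglyMeasurable (by fun_prop)).mul (Lp.aestronglyMeasurable U),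
      hle.trans_lt (ENNReal.mul_lt_top ENNReal.ofReal_lt_top hlt)⟩
  set Q : Lp ℂ 2 (volume : Measure ℝ) := 𝓕⁻ (hG.toLp _) with hQ
  have hQF : 𝓕 Q = hG.toLp _ := FourierTransform.fourier_fourierInv_eq _
  have hlap := laplacian_eq_of_ae_fourier_eq (U := hue.toLp fun x => (u x : ℂ)) (Q := Q) (by
    rw [hQF]
    exact hG.coeFn_toLp)
  have hQ2 := Lp.memLp Q
  refine ⟨fun x => (Q x).re, ⟨hu2.locallyIntegrable one_le_two,
    hQ2.re.locallyIntegrable one_le_two, fun φ hφ hc => ?_⟩, hQ2.re, ?_⟩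
  · have hg₁ : HasCompactSupport (Complex.ofRealCLM ∘ φ) := hc.comp_left rfl
    have hg₂ : ContDiff ℝ ∞ (Complex.ofRealCLM ∘ φ) := by fun_prop
    have h2 := DFunLike.congr_fun hlap (hg₁.toSchwartzMap hg₂)
    rw [TemperedDistribution.laplacian_apply_apply, toTemperedDistribution_toLp_ofReal_apply,
      Lp.toTemperedDistribution_apply] at h2
    simp_rw [laplacian_schwartzMap_apply] at h2
    have hd : ∀ {ψ : ℝ → ℝ}, ContDiff ℝ ∞ ψ →
        deriv (Complex.ofRealCLM ∘ ψ) = Complex.ofRealCLM ∘ deriv ψ := fun {ψ} hψ =>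
      funext fun x => (Complex.ofRealCLM.hasFDerivAt.comp_hasDerivAt x
        (hψ.differentiable (by simp) x).hasDerivAt).deriv
    have hcoe : ((hg₁.toSchwartzMap hg₂ : 𝓢(ℝ, ℂ)) : ℝ → ℂ) = Complex.ofRealCLM ∘ φ := by
      ext x; simp
    rw [hcoe, hd hφ, hd (contDiff_deriv_infty hφ)] at h2
    have e1 : ∫ x, (Complex.ofRealCLM ∘ deriv (deriv φ)) x • (u x : ℂ) =
        ((∫ x, u x * deriv (deriv φ) x : ℝ) : ℂ) := by
      rw [← integral_complex_ofReal]
      refine integral_congr_ae (Filter.Eventually.of_forall fun x => ?_)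
      simp [mul_comm]
    have hint : Integrable fun x => (Complex.ofRealCLM ∘ φ) x • Q x := by
      have := (hg₁.toSchwartzMap hg₂).memLp 2 (volume : Measure ℝ)
      rw [hcoe] at this
      exact this.integrable_mul hQ2
    have e2 : (∫ x, (Complex.ofRealCLM ∘ φ) x • Q x).re = ∫ x, (Q x).re * φ x := by
      have := integral_re hint
      refine this.symm.trans (integral_congr_ae (Filter.Eventually.of_forall fun x => ?_))
      simp [mul_comm]
    rw [← e2, ← h2, e1, Complex.ofReal_re]
  · refine le_trans ?_ hle
    have h3 : eLpNorm (fun x => (Q x).re) 2 volume ≤ eLpNorm Q 2 volume :=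
      eLpNorm_mono fun x => Complex.abs_re_le_norm _
    refine h3.trans (le_of_eq ?_)
    rw [← eLpNorm_congr_ae hG.coeFn_toLp, ← hQF, ← Lp.enorm_def, ← Lp.enorm_def, ← ofReal_norm,
      ← ofReal_norm, Lp.norm_fourier_eq]

/-! ### The space `H²_β` in terms of classical derivatives -/

theorem hasDerivAt_tanh (x : ℝ) : HasDerivAt Real.tanh (1 - Real.tanh x ^ 2) x := by
  have hf : Real.tanh = fun x => Real.sinh x / Real.cosh x :=
    funext fun x => Real.tanh_eq_sinh_div_cosh x
  rw [hf]
  have hc := (Real.cosh_pos x).ne'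
  convert! (Real.hasDerivAt_sinh x).div (Real.hasDerivAt_cosh x) hc using 1
  field_simp

theorem hasDerivAt_weight (b x : ℝ) :
    HasDerivAt (fun x => Real.cosh x ^ b) (b * Real.tanh x * Real.cosh x ^ b) x := by
  have hc := Real.cosh_pos x
  convert! (Real.hasDerivAt_cosh x).rpow_const (p := b) (Or.inl hc.ne') using 1
  rw [Real.rpow_sub_one hc.ne', Real.tanh_eq_sinh_div_cosh]
  field_simp

theorem continuous_tanh : Continuous Real.tanh :=
  continuous_iff_continuousAt.2 fun x => (hasDerivAt_tanh x).continuousAt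

theorem isPrimitive_weight (b : ℝ) :
    IsPrimitive (fun x => Real.cosh x ^ b) (fun x => b * Real.tanh x * Real.cosh x ^ b) :=
  .of_hasDerivAt (hasDerivAt_weight b)
    ((continuous_const.mul continuous_tanh).mul (continuous_weight b))

theorem isPrimitive_weight_deriv (b : ℝ) :
    IsPrimitive (fun x => b * Real.tanh x * Real.cosh x ^ b)
      (fun x => (b * (1 - Real.tanh x ^ 2) + b ^ 2 * Real.tanh x ^ 2) * Real.cosh x ^ b) := by
  refine .of_hasDerivAt (fun x => ?_) ?_
  · convert! ((hasDerivAt_tanh x).const_mul b).mul (hasDerivAt_weight b x) using 1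
    ring
  · have := continuous_tanh
    have := continuous_weight b
    fun_prop

theorem L2Bound.weight_mul {a b R M : ℝ} {u m : ℝ → ℝ} (h : L2Bound a R u)
    (hm : AEStronglyMeasurable m) (hM0 : 0 ≤ M)
    (hM : ∀ x, Real.cosh x ^ b * |m x| ≤ M * Real.cosh x ^ a) :
    L2Bound b (M * R) fun x => m x * u x := by
  refine ⟨hm.mul h.1, ?_⟩
  rw [ENNReal.ofReal_mul hM0]
  refine le_trans ?_ (mul_le_mul_right h.2 _)
  rw [← Real.enorm_of_nonneg hM0, ← eLpNorm_const_smul]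
  refine eLpNorm_mono fun x => ?_
  simp only [Pi.smul_apply, smul_eq_mul, norm_mul, ← mul_assoc]
  refine mul_le_mul_of_nonneg_right ?_ (norm_nonneg _)
  rw [Real.norm_of_nonneg (weight_pos b x).le, Real.norm_of_nonneg (weight_pos a x).le,
    Real.norm_of_nonneg hM0]
  exact hM x

/-- `f` is twice differentiable (with `p = f'` absolutely continuous and `q = f''` a.e.), and the
norms of `f`, `f'`, `f''` in `L²` with weight `cosh^β` are at most `R`. Up to constants, this says
that `‖f‖_{2,β} ≤ R` and that `f` is the continuous representative of its class. -/
structure H2Bound (β R : ℝ) (f p q : ℝ → ℝ) : Prop where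
  prim : IsPrimitive f p
  prim_deriv : IsPrimitive p q
  bound : L2Bound β R f
  bound_deriv : L2Bound β R p
  bound_second : L2Bound β R q

namespace H2Bound

variable {β R R' : ℝ} {f p q f' p' q' : ℝ → ℝ}

theorem mono (h : H2Bound β R f p q) (hR : R ≤ R') : H2Bound β R' f p q :=
  ⟨h.1, h.2, h.3.mono hR, h.4.mono hR, h.5.mono hR⟩

theorem sub (h : H2Bound β R f p q) (h' : H2Bound β R' f' p' q') (hR : 0 ≤ R) (hR' : 0 ≤ R') :
    H2Bound β (R + R') (fun x => f x - f' x) (fun x => p x - p' x) (fun x => q x - q' x) :=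
  ⟨h.1.sub h'.1, h.2.sub h'.2, h.3.sub h'.3 hR hR', h.4.sub h'.4 hR hR', h.5.sub h'.5 hR hR'⟩

theorem add (h : H2Bound β R f p q) (h' : H2Bound β R' f' p' q') (hR : 0 ≤ R) (hR' : 0 ≤ R') :
    H2Bound β (R + R') (fun x => f x + f' x) (fun x => p x + p' x) (fun x => q x + q' x) :=
  ⟨h.1.add h'.1, h.2.add h'.2, h.3.add h'.3 hR hR', h.4.add h'.4 hR hR', h.5.add h'.5 hR hR'⟩

theorem const_mul (h : H2Bound β R f p q) (c : ℝ) :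
    H2Bound β (|c| * R) (fun x => c * f x) (fun x => c * p x) (fun x => c * q x) :=
  ⟨h.1.const_mul c, h.2.const_mul c, h.3.const_mul c, h.4.const_mul c, h.5.const_mul c⟩

theorem of_ends (hβ : 0 ≤ β) (hR : 0 ≤ R) (hf : IsPrimitive f p) (hp : IsPrimitive p q)
    (h : L2Bound β R f) (hq : L2Bound β R q) :
    H2Bound β (Real.exp (β / 2) * 5 * R) f p q := by
  have h1 : 1 ≤ Real.exp (β / 2) := Real.one_le_exp (by positivity)
  have h2 : R ≤ Real.exp (β / 2) * 5 * R := le_mul_of_one_le_left hR (by linarith)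
  refine ⟨hf, hp, h.mono h2, ?_, hq.mono h2⟩
  exact (L2Bound.deriv_of_second hβ hf hp h hq hR hR).mono (by ring_nf; rfl)

theorem abs_le (h : H2Bound β R f p q) (hβ : 0 ≤ β) (hR : 0 ≤ R) (x : ℝ) :
    |f x| ≤ Real.exp (β / 2) * 2 * R :=
  (h.bound.abs_le hβ h.prim h.bound_deriv hR hR x).trans (by ring_nf; rfl)

theorem abs_deriv_le (h : H2Bound β R f p q) (hβ : 0 ≤ β) (hR : 0 ≤ R) (x : ℝ) :
    |p x| ≤ Real.exp (β / 2) * 2 * R :=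
  (h.bound_deriv.abs_le hβ h.prim_deriv h.bound_second hR hR x).trans (by ring_nf; rfl)

theorem continuous (h : H2Bound β R f p q) : Continuous f := h.prim.continuous

theorem continuous_deriv (h : H2Bound β R f p q) : Continuous p := h.prim_deriv.continuous

theorem hasDerivAt (h : H2Bound β R f p q) (x : ℝ) : HasDerivAt f (p x) x :=
  h.prim.hasDerivAt h.continuous_deriv x

theorem hasWeakSecondDeriv (h : H2Bound β R f p q) : HasWeakSecondDeriv f q :=
  hasWeakSecondDeriv_of_isPrimitive h.prim h.prim_deriv

/-- Multiplication by `cosh^e` is bounded from weight `cosh^(b+e)` to weight `cosh^b`. -/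
theorem weight_mul {b e : ℝ} (hR : 0 ≤ R) (h : H2Bound (b + e) R f p q) :
    ∃ p' q', H2Bound b ((1 + 3 * |e| + e ^ 2) * R) (fun x => Real.cosh x ^ e * f x) p' q' := by
  have key : ∀ {M : ℝ} {m : ℝ → ℝ} {u : ℝ → ℝ}, 0 ≤ M → Continuous m → (∀ x, |m x| ≤ M) →
      L2Bound (b + e) R u → L2Bound b (M * R) fun x => (m x * Real.cosh x ^ e) * u x := by
    intro M m u hM0 hmc hM hu
    refine hu.weight_mul (hmc.mul (continuous_weight e)).aestronglyMeasurable hM0 fun x => ?_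
    rw [abs_mul, abs_of_pos (weight_pos e x), Real.rpow_add (Real.cosh_pos x)]
    have := mul_le_mul_of_nonneg_right (hM x)
      (mul_nonneg (weight_pos b x).le (weight_pos e x).le)
    nlinarith
  have ht := continuous_tanh
  have ht1 : ∀ x, Real.tanh x ^ 2 ≤ 1 := fun x => by
    exact (Real.tanh_sq_lt_one x).le
  have k0 : ∀ {u}, L2Bound (b + e) R u → L2Bound b (1 * R) fun x => Real.cosh x ^ e * u x :=
    fun {u} hu => by
      simpa using key (m := fun _ => 1) zero_le_one continuous_const (by simp) hu
  have k1 : ∀ {u}, L2Bound (b + e) R u →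
      L2Bound b (|e| * R) fun x => e * Real.tanh x * Real.cosh x ^ e * u x :=
    fun {u} hu => key (m := fun x => e * Real.tanh x) (abs_nonneg e) (by fun_prop) (fun x => by
      rw [abs_mul]
      exact mul_le_of_le_one_right (abs_nonneg e) ((Real.abs_tanh_lt_one x).le)) hu
  have k2 : ∀ {u}, L2Bound (b + e) R u → L2Bound b ((|e| + e ^ 2) * R) fun x =>
      (e * (1 - Real.tanh x ^ 2) + e ^ 2 * Real.tanh x ^ 2) * Real.cosh x ^ e * u x :=
    fun {u} hu => key (m := fun x => e * (1 - Real.tanh x ^ 2) + e ^ 2 * Real.tanh x ^ 2)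
      (by positivity) (by fun_prop) (fun x => by
      refine (abs_add_le _ _).trans (add_le_add ?_ ?_)
      · rw [abs_mul]
        refine mul_le_of_le_one_right (abs_nonneg e) ?_
        rw [abs_of_nonneg (by linarith [ht1 x])]
        linarith [sq_nonneg (Real.tanh x)]
      · rw [abs_mul, abs_of_nonneg (sq_nonneg e), abs_of_nonneg (sq_nonneg _)]
        exact mul_le_of_le_one_right (sq_nonneg e) (ht1 x)) hu
  have he := abs_nonneg e
  have he2 := sq_nonneg e
  have hRe : 0 ≤ |e| * R := by positivity
  have hRe2 : 0 ≤ e ^ 2 * R := by positivity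
  have hR1 : 0 ≤ 1 * R := by positivity
  have hR3 : 0 ≤ (|e| + e ^ 2) * R := by positivity
  refine ⟨_, _, (isPrimitive_weight e).mul h.prim,
    ((isPrimitive_weight_deriv e).mul h.prim).add ((isPrimitive_weight e).mul h.prim_deriv),
    (k0 h.bound).mono (by nlinarith), ?_, ?_⟩
  · exact ((k1 h.bound).add (k0 h.bound_deriv) hRe hR1).mono (by nlinarith)
  · refine (((k2 h.bound).add (k1 h.bound_deriv) hR3 hRe).add
      ((k1 h.bound_deriv).add (k0 h.bound_second) hRe hR1) (by positivity) (by positivity)).mono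
      (by nlinarith)

theorem memLp (h : H2Bound β R f p q) (hβ : 0 ≤ β) : MemLp f 2 := h.bound.memLp hβ

theorem memHs_of_zero (hR : 0 ≤ R) (h : H2Bound 0 R f p q) :
    MemHs 2 f ∧ eHsNorm 2 f ≤ ENNReal.ofReal (2 * R) := by
  have hf := h.memLp le_rfl
  have hq := h.bound_second.memLp le_rfl
  have hle : eHsNorm 2 f ≤ ENNReal.ofReal (2 * R) := by
    have h1 := eHsNorm_add_two_le 0 h.prim h.prim_deriv hf (h.bound_deriv.memLp le_rfl) hq
    rw [zero_add, eHsNorm_zero hf, eHsNorm_zero hq] at h1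
    refine h1.trans ?_
    rw [two_mul, ENNReal.ofReal_add hR hR]
    exact add_le_add (by simpa using h.bound.le) (by simpa using h.bound_second.le)
  exact ⟨(memHs_iff 2 zero_le_two f).2 (hle.trans_lt ENNReal.ofReal_lt_top), hle⟩

theorem of_weight_le (h : H2Bound β R f p q) (hβ : 0 ≤ β) : H2Bound 0 R f p q := by
  have key : ∀ {u}, L2Bound β R u → L2Bound 0 R u := fun {u} hu => by
    have := hu.weight_mul (b := 0) (m := fun _ => 1) aestronglyMeasurable_const zero_le_one
      fun x => by simpa using one_le_weight hβ x
    simpa using this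
  exact ⟨h.1, h.2, key h.3, key h.4, key h.5⟩

theorem memHsb (hβ : 0 ≤ β) (hR : 0 ≤ R) (h : H2Bound β R f p q) :
    MemHsb 2 β f ∧ eHsbNorm 2 β f ≤ ENNReal.ofReal (2 * (1 + 3 * |β| + β ^ 2) * R) := by
  obtain ⟨p', q', h'⟩ := weight_mul (b := 0) (e := β) hR (by simpa using h)
  have h1 := h'.memHs_of_zero (by positivity)
  exact ⟨⟨((h.of_weight_le hβ).memHs_of_zero hR).1, h1.1⟩, by
    rw [mul_assoc]
    exact h1.2⟩

end H2Bound

theorem exists_h2Bound_of_memHs {R : ℝ} {u : ℝ → ℝ} (hR : 0 ≤ R) (h : MemHs 2 u)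
    (hle : eHsNorm 2 u ≤ ENNReal.ofReal R) :
    ∃ v p q, u =ᵐ[volume] v ∧ H2Bound 0 (5 * (2 * Real.pi) ^ 2 * R) v p q := by
  obtain ⟨q, hq, hq2, hqle⟩ := h.exists_hasWeakSecondDeriv
  obtain ⟨v, p, hv, hp, huv⟩ := hq.exists_isPrimitive
  have h1 : L2Bound 0 ((2 * Real.pi) ^ 2 * R) u := by
    refine ⟨h.memLp.1, ?_⟩
    simp only [Real.rpow_zero, one_mul]
    refine ((eLpNorm_le_eHsNorm zero_le_two h.memLp).trans hle).trans (ENNReal.ofReal_le_ofReal ?_)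
    exact le_mul_of_one_le_left hR one_le_two_pi_sq
  have h2 : L2Bound 0 ((2 * Real.pi) ^ 2 * R) q := by
    refine ⟨hq2.1, ?_⟩
    simp only [Real.rpow_zero, one_mul]
    rw [ENNReal.ofReal_mul (sq_nonneg _)]
    exact hqle.trans (mul_le_mul_right hle _)
  refine ⟨v, p, q, huv, ?_⟩
  have := H2Bound.of_ends le_rfl (by positivity) hv hp (h1.congr huv) h2
  simpa [mul_assoc] using this

/-- The class of every `f ∈ H²_β` has a continuously differentiable representative, with bounds. -/
theorem exists_h2Bound_of_memHsb {β R : ℝ} {f : ℝ → ℝ} (hR : 0 ≤ R) (h : MemHsb 2 β f)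
    (hle : eHsbNorm 2 β f ≤ ENNReal.ofReal R) :
    ∃ v p q, f =ᵐ[volume] v ∧
      H2Bound β ((1 + 3 * |β| + β ^ 2) * (5 * (2 * Real.pi) ^ 2) * R) v p q := by
  obtain ⟨u, p, q, hu, hb⟩ := exists_h2Bound_of_memHs hR h.2 hle
  obtain ⟨p', q', h'⟩ := H2Bound.weight_mul (b := β) (e := -β)
    (R := 5 * (2 * Real.pi) ^ 2 * R) (f := u) (p := p) (q := q) (by positivity)
    (by simpa using hb)
  refine ⟨_, p', q', ?_, by simpa [mul_assoc] using h'⟩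
  filter_upwards [hu] with x hx
  rw [← hx, coshWeight, ← mul_assoc, ← Real.rpow_add (Real.cosh_pos x)]
  simp

/-! ### The difference operator -/

theorem Function.Even.delta_odd {f : ℝ → ℝ} (hf : Function.Even f) : Function.Odd (delta f) := by
  intro x
  rw [delta, delta, show -x + 1 / 2 = -(x - 1 / 2) by ring, hf,
    show -x - 1 / 2 = -(x + 1 / 2) by ring, hf]
  ring

theorem Function.Odd.delta_even {f : ℝ → ℝ} (hf : Function.Odd f) : Function.Even (delta f) := by
  intro x
  rw [delta, delta, show -x + 1 / 2 = -(x - 1 / 2) by ring, hf,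
    show -x - 1 / 2 = -(x + 1 / 2) by ring, hf]
  ring

theorem continuous_delta {f : ℝ → ℝ} (hf : Continuous f) : Continuous (delta f) := by
  unfold delta
  fun_prop

theorem delta_ae_congr {f g : ℝ → ℝ} (h : f =ᵐ[volume] g) : delta f =ᵐ[volume] delta g := by
  have h1 := (measurePreserving_add_right volume (1 / 2 : ℝ)).quasiMeasurePreserving.ae_eq_comp h
  have h2 := (measurePreserving_sub_right volume (1 / 2 : ℝ)).quasiMeasurePreserving.ae_eq_comp h
  filter_upwards [h1, h2] with x h1 h2
  simp only [Function.comp_apply] at h1 h2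
  rw [delta, delta, h1, h2]

theorem delta_sub (f g : ℝ → ℝ) : delta (fun x => f x - g x) = fun x => delta f x - delta g x := by
  ext x; simp only [delta]; ring

theorem delta_add (f g : ℝ → ℝ) : delta (fun x => f x + g x) = fun x => delta f x + delta g x := by
  ext x; simp only [delta]; ring

theorem delta_const_mul (c : ℝ) (f : ℝ → ℝ) : delta (fun x => c * f x) = fun x => c * delta f x := by
  ext x; simp only [delta]; ring

/-- A bound for the norm of `delta` on the weighted space. -/
def deltaConst (β : ℝ) : ℝ := 2 * Real.exp (β / 2)

theorem deltaConst_pos (β : ℝ) : 0 < deltaConst β := by unfold deltaConst; positivity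

theorem L2Bound.delta {β R : ℝ} {u : ℝ → ℝ} (hβ : 0 ≤ β) (hR : 0 ≤ R) (h : L2Bound β R u) :
    L2Bound β (deltaConst β * R) (delta u) := by
  have h1 := h.comp_add_right hβ (1 / 2)
  have h2 := h.comp_add_right hβ (-(1 / 2))
  rw [abs_neg] at h2
  have e : Real.exp (β * |1 / 2|) = Real.exp (β / 2) := by
    rw [abs_of_pos (by norm_num)]; congr 1; ring
  rw [e] at h1 h2
  refine (h1.sub h2 (by positivity) (by positivity)).mono (le_of_eq ?_)
  unfold deltaConst
  ring

theorem integrable_weight_neg {β : ℝ} (hβ : 0 < β) :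
    Integrable fun x => Real.cosh x ^ (-β) := by
  have hm : AEStronglyMeasurable (fun x => Real.cosh x ^ (-β)) :=
    (continuous_weight (-β)).aestronglyMeasurable
  have hle : ∀ x, ‖Real.cosh x ^ (-β)‖ ≤ 2 ^ β * Real.exp (-β * |x|) := fun x => by
    rw [Real.norm_of_nonneg (weight_pos _ _).le, Real.rpow_neg (Real.cosh_pos x).le,
      inv_le_iff_one_le_mul₀ (weight_pos β x)]
    have h1 : Real.exp |x| ≤ 2 * Real.cosh x := by
      rw [← Real.cosh_abs x, Real.cosh_eq]
      linarith [Real.exp_pos (-|x|)]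
    have h2 := Real.rpow_le_rpow (Real.exp_pos _).le h1 hβ.le
    rw [Real.mul_rpow zero_le_two (Real.cosh_pos x).le, ← Real.exp_mul] at h2
    calc (1 : ℝ) = Real.exp (-β * |x|) * Real.exp (|x| * β) := by
          rw [← Real.exp_add]; ring_nf; simp
      _ ≤ Real.exp (-β * |x|) * (2 ^ β * Real.cosh x ^ β) := by gcongr
      _ = _ := by ring
  have h1 : IntegrableOn (fun x => Real.cosh x ^ (-β)) (Set.Ioi 0) := by
    refine Integrable.mono' ((integrableOn_exp_mul_Ioi (neg_neg_of_pos hβ) 0).const_mul (2 ^ β))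
      hm.restrict ?_
    filter_upwards [ae_restrict_mem measurableSet_Ioi] with x hx
    simpa [abs_of_pos (Set.mem_Ioi.1 hx)] using hle x
  have h2 : IntegrableOn (fun x => Real.cosh x ^ (-β)) (Set.Iic 0) := by
    refine Integrable.mono' ((integrableOn_exp_mul_Iic hβ 0).const_mul (2 ^ β)) hm.restrict ?_
    filter_upwards [ae_restrict_mem measurableSet_Iic] with x hx
    simpa [abs_of_nonpos (Set.mem_Iic.1 hx)] using hle x
  rw [← integrableOn_univ, ← Set.Iic_union_Ioi (a := (0 : ℝ))]
  exact h2.union h1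

theorem L2Bound.integrable {β R : ℝ} {u : ℝ → ℝ} (hβ : 0 < β) (h : L2Bound β R u) :
    Integrable u := by
  have h1 : MemLp (fun x => Real.cosh x ^ (-β)) 2 := by
    rw [memLp_two_iff_integrable_sq (continuous_weight (-β)).aestronglyMeasurable]
    refine (integrable_weight_neg (β := 2 * β) (by positivity)).congr
      (Filter.Eventually.of_forall fun x => ?_)
    simp only
    rw [← Real.rpow_natCast, ← Real.rpow_mul (Real.cosh_pos x).le]
    congr 1; push_cast; ring
  refine (h1.integrable_mul h.memLp_weight).congr (Filter.Eventually.of_forall fun x => ?_)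
  simp only [Pi.mul_apply]
  rw [← mul_assoc, ← Real.rpow_add (Real.cosh_pos x)]
  simp

theorem integral_delta {u : ℝ → ℝ} (h : Integrable u) : ∫ x, delta u x = 0 := by
  unfold delta
  rw [integral_sub (h.comp_add_right _) (h.comp_sub_right _), integral_add_right_eq_self u,
    integral_sub_right_eq_self u, sub_self]

/-! ### The resolvent of the internal oscillator at a resonant frequency -/

/-- The angular frequency `2πn`. -/
def freq (n : ℕ) : ℝ := 2 * Real.pi * n

theorem freq_pos {n : ℕ} (hn : 1 ≤ n) : 0 < freq n := by
  have : (0 : ℝ) < n := by exact_mod_cast hn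
  unfold freq; positivity

theorem natCast_le_freq (n : ℕ) : (n : ℝ) ≤ freq n := by
  unfold freq
  exact le_mul_of_one_le_left (Nat.cast_nonneg n) (by linarith [Real.pi_gt_three])

theorem sin_freq (n : ℕ) : Real.sin (freq n) = 0 := by
  rw [freq, show 2 * Real.pi * (n : ℝ) = ((2 * n : ℕ) : ℝ) * Real.pi by push_cast; ring]
  exact Real.sin_nat_mul_pi _

theorem cos_freq (n : ℕ) : Real.cos (freq n) = 1 := by
  rw [freq, mul_comm]
  exact Real.cos_nat_mul_two_pi n

/-- `S h = (∂² + ω²)⁻¹ δ h` for `ω = 2πn`. Because `sin` has period `1` in these units, the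
solution of `y'' + ω² y = δ h` vanishing at `-∞` is convolution of `h` with a kernel supported
in `[-1/2, 1/2]`. -/
def osc (n : ℕ) (h : ℝ → ℝ) (x : ℝ) : ℝ :=
  (freq n)⁻¹ * ∫ t in (x - 1 / 2)..(x + 1 / 2), Real.sin (freq n * (x + 1 / 2 - t)) * h t

/-- The derivative of `osc n h`. -/
def oscDeriv (n : ℕ) (h : ℝ → ℝ) (x : ℝ) : ℝ :=
  ∫ t in (x - 1 / 2)..(x + 1 / 2), Real.cos (freq n * (x + 1 / 2 - t)) * h t

section

variable {n : ℕ} {h h' h'' : ℝ → ℝ}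

theorem hasDerivAt_integral_window {g : ℝ → ℝ} (hg : Continuous g) (x : ℝ) :
    HasDerivAt (fun x => ∫ t in (x - 1 / 2)..(x + 1 / 2), g t) (g (x + 1 / 2) - g (x - 1 / 2))
      x := by
  have hG := IsPrimitive.integral hg.locallyIntegrable 0
  have e : (fun x => ∫ t in (x - 1 / 2)..(x + 1 / 2), g t) = fun x =>
      (∫ t in (0 : ℝ)..(x + 1 / 2), g t) - ∫ t in (0 : ℝ)..(x - 1 / 2), g t :=
    funext fun x => (hG.sub_eq _ _).symm
  rw [e]
  exact ((hG.hasDerivAt hg (x + 1 / 2)).comp_add_const x (1 / 2)).sub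
    ((hG.hasDerivAt hg (x - 1 / 2)).comp_sub_const x (1 / 2))

theorem integral_sin_window (hh : LocallyIntegrable h) (r a b x : ℝ) :
    ∫ t in a..b, Real.sin (r * (x - t)) * h t =
      Real.sin (r * x) * (∫ t in a..b, Real.cos (r * t) * h t) -
        Real.cos (r * x) * ∫ t in a..b, Real.sin (r * t) * h t := by
  have i : ∀ {c : ℝ → ℝ}, Continuous c → IntervalIntegrable (fun t => c t * h t) volume a b :=
    fun hc => intervalIntegrable_of_locallyIntegrable (hh.continuous_mul hc) a b
  rw [← intervalIntegral.integral_const_mul, ← intervalIntegral.integral_const_mul,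
    ← intervalIntegral.integral_sub ((i (by fun_prop)).const_mul _) ((i (by fun_prop)).const_mul _)]
  refine intervalIntegral.integral_congr fun t _ => ?_
  rw [mul_sub, Real.sin_sub]
  ring

theorem integral_cos_window (hh : LocallyIntegrable h) (r a b x : ℝ) :
    ∫ t in a..b, Real.cos (r * (x - t)) * h t =
      Real.cos (r * x) * (∫ t in a..b, Real.cos (r * t) * h t) +
        Real.sin (r * x) * ∫ t in a..b, Real.sin (r * t) * h t := by
  have i : ∀ {c : ℝ → ℝ}, Continuous c → IntervalIntegrable (fun t => c t * h t) volume a b :=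
    fun hc => intervalIntegrable_of_locallyIntegrable (hh.continuous_mul hc) a b
  rw [← intervalIntegral.integral_const_mul, ← intervalIntegral.integral_const_mul,
    ← intervalIntegral.integral_add ((i (by fun_prop)).const_mul _) ((i (by fun_prop)).const_mul _)]
  refine intervalIntegral.integral_congr fun t _ => ?_
  rw [mul_sub, Real.cos_sub]
  ring

theorem sin_freq_window (n : ℕ) (x : ℝ) :
    Real.sin (freq n * (x + 1 / 2)) = Real.sin (freq n * (x - 1 / 2)) := by
  rw [show freq n * (x + 1 / 2) = freq n * (x - 1 / 2) + freq n by ring, Real.sin_add, sin_freq,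
    cos_freq]
  ring

theorem cos_freq_window (n : ℕ) (x : ℝ) :
    Real.cos (freq n * (x + 1 / 2)) = Real.cos (freq n * (x - 1 / 2)) := by
  rw [show freq n * (x + 1 / 2) = freq n * (x - 1 / 2) + freq n by ring, Real.cos_add, sin_freq,
    cos_freq]
  ring

theorem hasDerivAt_osc (hn : 1 ≤ n) (hh : Continuous h) (x : ℝ) :
    HasDerivAt (osc n h) (oscDeriv n h x) x := by
  have hω := (freq_pos hn).ne'
  have hl := hh.locallyIntegrable (μ := volume)
  have e : osc n h = fun x => (freq n)⁻¹ *
      (Real.sin (freq n * (x + 1 / 2)) *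
        (∫ t in (x - 1 / 2)..(x + 1 / 2), Real.cos (freq n * t) * h t) -
      Real.cos (freq n * (x + 1 / 2)) *
        ∫ t in (x - 1 / 2)..(x + 1 / 2), Real.sin (freq n * t) * h t) := funext fun x => by
    rw [osc, integral_sin_window hl]
  rw [e, oscDeriv, integral_cos_window hl]
  have hlin : HasDerivAt (fun x : ℝ => freq n * (x + 1 / 2)) (freq n) x := by
    simpa only [mul_one] using! ((hasDerivAt_id x).add_const (1 / 2)).const_mul (freq n)
  have hc := hasDerivAt_integral_window (g := fun t => Real.cos (freq n * t) * h t)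
    (by fun_prop) x
  have hs := hasDerivAt_integral_window (g := fun t => Real.sin (freq n * t) * h t)
    (by fun_prop) x
  convert! ((hlin.sin.mul hc).sub (hlin.cos.mul hs)).const_mul (freq n)⁻¹ using 1
  rw [← sin_freq_window, ← cos_freq_window]
  field_simp
  ring

theorem hasDerivAt_oscDeriv (hn : 1 ≤ n) (hh : Continuous h) (x : ℝ) :
    HasDerivAt (oscDeriv n h) (delta h x - freq n ^ 2 * osc n h x) x := by
  have hω := (freq_pos hn).ne'
  have hl := hh.locallyIntegrable (μ := volume)
  have e : oscDeriv n h = fun x => Real.cos (freq n * (x + 1 / 2)) *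
        (∫ t in (x - 1 / 2)..(x + 1 / 2), Real.cos (freq n * t) * h t) +
      Real.sin (freq n * (x + 1 / 2)) *
        ∫ t in (x - 1 / 2)..(x + 1 / 2), Real.sin (freq n * t) * h t := funext fun x => by
    rw [oscDeriv, integral_cos_window hl]
  have eS : freq n ^ 2 * osc n h x = freq n * (Real.sin (freq n * (x + 1 / 2)) *
        (∫ t in (x - 1 / 2)..(x + 1 / 2), Real.cos (freq n * t) * h t) -
      Real.cos (freq n * (x + 1 / 2)) *
        ∫ t in (x - 1 / 2)..(x + 1 / 2), Real.sin (freq n * t) * h t) := by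
    rw [osc, integral_sin_window hl]
    field_simp
  rw [e, eS]
  have hlin : HasDerivAt (fun x : ℝ => freq n * (x + 1 / 2)) (freq n) x := by
    simpa only [mul_one] using! ((hasDerivAt_id x).add_const (1 / 2)).const_mul (freq n)
  have hc := hasDerivAt_integral_window (g := fun t => Real.cos (freq n * t) * h t)
    (by fun_prop) x
  have hs := hasDerivAt_integral_window (g := fun t => Real.sin (freq n * t) * h t)
    (by fun_prop) x
  convert! (hlin.cos.mul hc).add (hlin.sin.mul hs) using 1
  rw [← sin_freq_window, ← cos_freq_window, delta]
  have := Real.sin_sq_add_cos_sq (freq n * (x + 1 / 2))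
  linear_combination (h (x - 1 / 2) - h (x + 1 / 2)) * this

theorem continuous_osc (hn : 1 ≤ n) (hh : Continuous h) : Continuous (osc n h) :=
  continuous_iff_continuousAt.2 fun x => (hasDerivAt_osc hn hh x).continuousAt

theorem continuous_oscDeriv (hn : 1 ≤ n) (hh : Continuous h) : Continuous (oscDeriv n h) :=
  continuous_iff_continuousAt.2 fun x => (hasDerivAt_oscDeriv hn hh x).continuousAt

/-- `S` commutes with differentiation. -/
theorem osc_deriv_eq (hn : 1 ≤ n) (hh : IsPrimitive h h') : osc n h' = oscDeriv n h := by
  ext x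
  have hω := (freq_pos hn).ne'
  have hs : IsPrimitive (fun t => Real.sin (freq n * (x + 1 / 2 - t)))
      (fun t => -freq n * Real.cos (freq n * (x + 1 / 2 - t))) :=
    .of_hasDerivAt (fun t => by
      convert! (((hasDerivAt_id t).const_sub (x + 1 / 2)).const_mul (freq n)).sin using 1
      simp; ring) (by fun_prop)
  rw [osc, oscDeriv, hs.integral_mul_eq hh]
  simp_rw [mul_assoc]
  rw [intervalIntegral.integral_const_mul,
    show freq n * (x + 1 / 2 - (x - 1 / 2)) = freq n by ring, sin_freq]
  simp
  field_simp

theorem oscDeriv_deriv_eq (hn : 1 ≤ n) (hh : IsPrimitive h h') (x : ℝ) :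
    oscDeriv n h' x = delta h x - freq n ^ 2 * osc n h x := by
  have hω := (freq_pos hn).ne'
  have hs : IsPrimitive (fun t => Real.cos (freq n * (x + 1 / 2 - t)))
      (fun t => freq n * Real.sin (freq n * (x + 1 / 2 - t))) :=
    .of_hasDerivAt (fun t => by
      convert! (((hasDerivAt_id t).const_sub (x + 1 / 2)).const_mul (freq n)).cos using 1
      simp; ring) (by fun_prop)
  rw [osc, oscDeriv, hs.integral_mul_eq hh]
  simp_rw [mul_assoc]
  rw [intervalIntegral.integral_const_mul,
    show freq n * (x + 1 / 2 - (x - 1 / 2)) = freq n by ring, cos_freq, delta]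
  simp
  field_simp

/-- Two integrations by parts: `ω² S h = δ h - S h''`. -/
theorem osc_second_eq (hn : 1 ≤ n) (hh : IsPrimitive h h') (hh' : IsPrimitive h' h'') (x : ℝ) :
    osc n h'' x = delta h x - freq n ^ 2 * osc n h x := by
  rw [osc_deriv_eq hn hh', oscDeriv_deriv_eq hn hh]

theorem isPrimitive_osc (hn : 1 ≤ n) (hh : IsPrimitive h h') :
    IsPrimitive (osc n h) (osc n h') := by
  rw [osc_deriv_eq hn hh]
  exact .of_hasDerivAt (hasDerivAt_osc hn hh.continuous) (continuous_oscDeriv hn hh.continuous)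

theorem osc_odd (hh : Function.Even h) : Function.Odd (osc n h) := by
  intro x
  rw [osc, osc, ← mul_neg]
  congr 1
  rw [← intervalIntegral.integral_neg]
  have := intervalIntegral.integral_comp_neg (a := x - 1 / 2) (b := x + 1 / 2)
    (fun t => Real.sin (freq n * (-x + 1 / 2 - t)) * h t)
  rw [show -(x + 1 / 2) = -x - 1 / 2 by ring, show -(x - 1 / 2) = -x + 1 / 2 by ring] at this
  rw [← this]
  refine intervalIntegral.integral_congr fun t _ => ?_
  rw [hh t, show freq n * (-x + 1 / 2 - -t) = freq n - freq n * (x + 1 / 2 - t) by ring,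
    Real.sin_sub, sin_freq, cos_freq]
  ring

theorem osc_sub {k : ℝ → ℝ} (hh : LocallyIntegrable h) (hk : LocallyIntegrable k) (x : ℝ) :
    osc n (fun x => h x - k x) x = osc n h x - osc n k x := by
  have i : ∀ {h : ℝ → ℝ}, LocallyIntegrable h → IntervalIntegrable
      (fun t => Real.sin (freq n * (x + 1 / 2 - t)) * h t) volume (x - 1 / 2) (x + 1 / 2) :=
    fun hh => intervalIntegrable_of_locallyIntegrable (hh.continuous_mul (by fun_prop)) _ _
  rw [osc, osc, osc, ← mul_sub, ← intervalIntegral.integral_sub (i hh) (i hk)]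
  congr 1
  refine intervalIntegral.integral_congr fun t _ => ?_
  ring

theorem abs_integral_window_le {c u : ℝ → ℝ} (hu : LocallyIntegrable u) (hc : ∀ t, |c t| ≤ 1)
    (x : ℝ) : |∫ t in (x - 1 / 2)..(x + 1 / 2), c t * u t| ≤
      ∫ t in (x - 1 / 2)..(x + 1 / 2), |u t| := by
  rw [← Real.norm_eq_abs]
  refine intervalIntegral.norm_integral_le_of_norm_le (by linarith)
    (Filter.Eventually.of_forall fun t _ => ?_) (intervalIntegrable_of_locallyIntegrable hu _ _).abs
  rw [norm_mul]
  exact mul_le_of_le_one_left (norm_nonneg _) (hc t)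

/-- `S` gains a factor `1 / ω` on weighted `L²`. -/
theorem L2Bound.osc {β R : ℝ} (hβ : 0 ≤ β) (hn : 1 ≤ n) (hh : L2Bound β R h)
    (hm : AEStronglyMeasurable (osc n h)) :
    L2Bound β (Real.exp (β / 2) * R / freq n) (osc n h) := by
  have hω := freq_pos hn
  have h1 := hh.const_mul (freq n)⁻¹
  have h2 := h1.of_window hβ hm fun x => by
    refine enorm_le_lintegral_window (h1.locallyIntegrable hβ) ?_
    simp_rw [abs_mul]
    rw [MassInMass.osc, abs_mul, intervalIntegral.integral_const_mul]
    exact mul_le_mul_of_nonneg_left (abs_integral_window_le (hh.locallyIntegrable hβ)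
      (fun _ => Real.abs_sin_le_one _) x) (abs_nonneg _)
  rw [abs_of_pos (inv_pos.2 hω)] at h2
  refine h2.mono (le_of_eq ?_)
  field_simp

theorem L2Bound.oscDeriv {β R : ℝ} (hβ : 0 ≤ β) (hh : L2Bound β R h)
    (hm : AEStronglyMeasurable (oscDeriv n h)) :
    L2Bound β (Real.exp (β / 2) * R) (oscDeriv n h) :=
  hh.of_window hβ hm fun x => enorm_le_lintegral_window (hh.locallyIntegrable hβ)
    (abs_integral_window_le (hh.locallyIntegrable hβ) (fun _ => Real.abs_cos_le_one _) x)

theorem continuous_osc_second (hn : 1 ≤ n) (hh : IsPrimitive h h') (hh' : IsPrimitive h' h'') :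
    Continuous (osc n h'') := by
  rw [funext (osc_second_eq hn hh hh')]
  exact (continuous_delta hh.continuous).sub (continuous_const.mul (continuous_osc hn hh.continuous))

theorem H2Bound.osc {β R : ℝ} (hβ : 0 ≤ β) (hn : 1 ≤ n) (hh : H2Bound β R h h' h'') :
    H2Bound β (Real.exp (β / 2) * R / freq n) (osc n h) (osc n h') (osc n h'') :=
  ⟨isPrimitive_osc hn hh.prim, isPrimitive_osc hn hh.prim_deriv,
    hh.bound.osc hβ hn (continuous_osc hn hh.continuous).aestronglyMeasurable,
    hh.bound_deriv.osc hβ hn (continuous_osc hn hh.continuous_deriv).aestronglyMeasurable,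
    hh.bound_second.osc hβ hn
      (continuous_osc_second hn hh.prim hh.prim_deriv).aestronglyMeasurable⟩

end

/-! ### Inverting the linearized operator -/

namespace H2Bound

variable {β R R' : ℝ} {f p q p' q' : ℝ → ℝ}

theorem congr_derivs (h : H2Bound β R f p' q') (hf : IsPrimitive f p) (hp : IsPrimitive p q) :
    H2Bound β R f p q := by
  have hpp : p' = p := funext fun x =>
    (h.hasDerivAt x).unique (hf.hasDerivAt hp.continuous x)
  subst hpp
  exact ⟨h.1, hp, h.3, h.4, h.5.congr (h.hasWeakSecondDeriv.ae_unique
    (hasWeakSecondDeriv_of_isPrimitive hf hp))⟩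

theorem of_eHsbNorm_le (hR : 0 ≤ R) (h : MemHsb 2 β f) (hf : Continuous f)
    (hle : eHsbNorm 2 β f ≤ ENNReal.ofReal R) :
    ∃ p q, H2Bound β ((1 + 3 * |β| + β ^ 2) * (5 * (2 * Real.pi) ^ 2) * R) f p q := by
  obtain ⟨v, p, q, hv, hb⟩ := exists_h2Bound_of_memHsb hR h hle
  obtain rfl : f = v := Measure.eq_of_ae_eq hv hf hb.continuous
  exact ⟨p, q, hb⟩

end H2Bound

theorem MemHsb.eHsbNorm_lt_top {β : ℝ} {f : ℝ → ℝ} (h : MemHsb 2 β f) : eHsbNorm 2 β f < ⊤ :=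
  (memHs_iff 2 zero_le_two _).1 h.2

theorem MemHsb.exists_h2Bound {β : ℝ} {f : ℝ → ℝ} (h : MemHsb 2 β f) (hf : Continuous f) :
    ∃ R p q, 0 ≤ R ∧ H2Bound β R f p q := by
  obtain ⟨p, q, hb⟩ := H2Bound.of_eHsbNorm_le ENNReal.toReal_nonneg h hf
    (ENNReal.ofReal_toReal h.eHsbNorm_lt_top.ne).ge
  exact ⟨_, p, q, by positivity, hb⟩

theorem L2Bound.memHsb_zero {β R : ℝ} {g : ℝ → ℝ} (hβ : 0 ≤ β) (h : L2Bound β R g) :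
    MemHsb 0 β g ∧ eHsbNorm 0 β g ≤ ENNReal.ofReal R := by
  refine ⟨⟨memHs_zero (h.memLp hβ), memHs_zero h.memLp_weight⟩, ?_⟩
  exact (eHsNorm_zero h.memLp_weight).trans_le h.le

theorem even_of_ae_even {f g : ℝ → ℝ} (hf : Function.Even f) (hfg : f =ᵐ[volume] g)
    (hg : Continuous g) : Function.Even g := by
  have h1 := (Measure.measurePreserving_neg (volume : Measure ℝ)).quasiMeasurePreserving.ae_eq_comp
    hfg
  have h2 : (fun x => g (-x)) = g := by
    refine Measure.eq_of_ae_eq (μ := volume) ?_ (by fun_prop) hg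
    filter_upwards [h1, hfg] with x h1 h2
    simp only [Function.comp_apply] at h1
    rw [← h1, ← h2, hf]
  exact fun x => congrFun h2 x

/-- The equation `ℋ f = δ Θ`. -/
def SolvesLinearized (W : ℝ → ℝ) (c : ℝ) (σ f q Θ : ℝ → ℝ) : Prop :=
  ∀ᵐ x, delta Θ x = c ^ 2 * q x - delta (delta fun y => deriv (deriv W) (σ y) * f y) x

theorem SolvesLinearized.sub {W : ℝ → ℝ} {c : ℝ} {σ f q Θ f' q' Θ' : ℝ → ℝ}
    (h : SolvesLinearized W c σ f q Θ) (h' : SolvesLinearized W c σ f' q' Θ') :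
    SolvesLinearized W c σ (fun x => f x - f' x) (fun x => q x - q' x)
      (fun x => Θ x - Θ' x) := by
  filter_upwards [h, h'] with x h1 h2
  simp only [mul_sub, delta_sub]
  rw [h1, h2]
  ring

theorem memEsbZero_delta {β R : ℝ} {Θ : ℝ → ℝ} (hβ : 0 < β) (hR : 0 ≤ R)
    (hodd : Function.Odd Θ) (h : L2Bound β R Θ) : MemEsbZero 0 β (delta Θ) :=
  ⟨⟨((h.delta hβ.le hR).memHsb_zero hβ.le).1, Function.Odd.delta_even hodd⟩,
    integral_delta (h.integrable hβ)⟩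

/-- Since differences of odd functions are even of mean zero, admissibility makes `ℋ f = δ Θ`
uniquely solvable for odd `Θ`, with an a priori bound. -/
theorem IsAdmissibleWith.exists_inverse {W : ℝ → ℝ} {c β : ℝ} {σ : ℝ → ℝ}
    (hadm : IsAdmissibleWith W c β σ) :
    ∃ K : ℝ, 0 < K ∧
      (∀ (Θ : ℝ → ℝ) (R : ℝ), 0 ≤ R → Function.Odd Θ → L2Bound β R Θ →
        ∃ f p q, H2Bound β (K * R) f p q ∧ Function.Even f ∧ SolvesLinearized W c σ f q Θ) ∧
      ∀ (Θ : ℝ → ℝ) (R : ℝ) (f p q : ℝ → ℝ) (R' : ℝ), 0 ≤ R → 0 ≤ R' → Function.Odd Θ →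
        L2Bound β R Θ → H2Bound β R' f p q → Function.Even f → SolvesLinearized W c σ f q Θ →
        H2Bound β (K * R) f p q := by
  have hβ := hadm.beta_pos
  obtain ⟨-, hsurj, K₀, hK₀⟩ := hadm.homeo
  rw [zero_add] at *
  set M := (1 + 3 * |β| + β ^ 2) * (5 * (2 * Real.pi) ^ 2)
  have hM : 0 ≤ M := by positivity
  have hd := (deltaConst_pos β).le
  set K := M * (max K₀ 0 * deltaConst β) + 1
  have hK : 0 < K := by positivity
  have hprior : ∀ (Θ : ℝ → ℝ) (R : ℝ) (f p q : ℝ → ℝ) (R' : ℝ), 0 ≤ R → 0 ≤ R' →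
      Function.Odd Θ → L2Bound β R Θ → H2Bound β R' f p q → Function.Even f →
      SolvesLinearized W c σ f q Θ → H2Bound β (K * R) f p q := by
    intro Θ R f p q R' hR hR' hodd hΘ hf heven hsol
    have h1 := (hK₀ f (delta Θ) ⟨(hf.memHsb hβ.le hR').1, heven⟩
      (memEsbZero_delta hβ hR hodd hΘ) ⟨q, hf.hasWeakSecondDeriv, hsol⟩).2
    have h2 : eHsbNorm 2 β f ≤ ENNReal.ofReal (max K₀ 0 * (deltaConst β * R)) := by
      rw [ENNReal.ofReal_mul (le_max_right _ _)]
      exact h1.trans (mul_le_mul' (ENNReal.ofReal_le_ofReal (le_max_left _ _))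
        ((hΘ.delta hβ.le hR).memHsb_zero hβ.le).2)
    obtain ⟨p', q', hb⟩ := H2Bound.of_eHsbNorm_le (by positivity) (hf.memHsb hβ.le hR').1
      hf.continuous h2
    refine (hb.congr_derivs hf.prim hf.prim_deriv).mono ?_
    change M * (max K₀ 0 * (deltaConst β * R)) ≤ (M * (max K₀ 0 * deltaConst β) + 1) * R
    nlinarith
  refine ⟨K, hK, fun Θ R hR hodd hΘ => ?_, hprior⟩
  obtain ⟨f₀, ⟨hf₀, hf₀e⟩, f'', hf'', hlin⟩ := hsurj _ (memEsbZero_delta hβ hR hodd hΘ)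
  obtain ⟨v, p, q, hv, hb⟩ := exists_h2Bound_of_memHsb ENNReal.toReal_nonneg hf₀
    (ENNReal.ofReal_toReal hf₀.eHsbNorm_lt_top.ne).ge
  have heven := even_of_ae_even hf₀e hv hb.continuous
  have hq : f'' =ᵐ[volume] q := (hf''.congr hv (Filter.EventuallyEq.refl _ _)).ae_unique
    hb.hasWeakSecondDeriv
  have hdd : delta (delta fun y => deriv (deriv W) (σ y) * f₀ y) =ᵐ[volume]
      delta (delta fun y => deriv (deriv W) (σ y) * v y) :=
    delta_ae_congr (delta_ae_congr (hv.mono fun x hx => by simp only [hx]))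
  have hsol : SolvesLinearized W c σ v q Θ := by
    filter_upwards [hlin, hq, hdd] with x h1 h2 h3
    rw [h1, h2, h3]
  exact ⟨v, p, q, hprior Θ R v p q _ hR (by positivity) hodd hΘ hb heven hsol, heven, hsol⟩

/-! ### Estimates for the nonlinearity -/

/-- On `[-A, A]` the function `G` and its first two derivatives have Lipschitz constant `M`, and
its first two derivatives are bounded by `M`. -/
structure LocalBounds (G : ℝ → ℝ) (A M : ℝ) : Prop where
  nonneg : 0 ≤ M
  lip : ∀ x y, |x| ≤ A → |y| ≤ A → |G x - G y| ≤ M * |x - y|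
  abs_deriv_le : ∀ x, |x| ≤ A → |deriv G x| ≤ M
  lip_deriv : ∀ x y, |x| ≤ A → |y| ≤ A → |deriv G x - deriv G y| ≤ M * |x - y|
  abs_second_le : ∀ x, |x| ≤ A → |deriv (deriv G) x| ≤ M
  lip_second : ∀ x y, |x| ≤ A → |y| ≤ A → |deriv (deriv G) x - deriv (deriv G) y| ≤ M * |x - y|

theorem exists_abs_le_on_Icc {F : ℝ → ℝ} (hF : Continuous F) (A : ℝ) :
    ∃ M, 0 ≤ M ∧ ∀ x, |x| ≤ A → |F x| ≤ M := by
  obtain ⟨M, hM⟩ := (isCompact_Icc (a := -A) (b := A)).exists_bound_of_continuousOn hF.continuousOn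
  exact ⟨max M 0, le_max_right _ _, fun x hx => (hM x (abs_le.1 hx)).trans (le_max_left _ _)⟩

theorem abs_sub_le_of_abs_deriv_le {F : ℝ → ℝ} (hF : Differentiable ℝ F) {A M : ℝ}
    (hM : ∀ x, |x| ≤ A → |deriv F x| ≤ M) {x y : ℝ} (hx : |x| ≤ A) (hy : |y| ≤ A) :
    |F x - F y| ≤ M * |x - y| :=
  (convex_Icc (-A) A).norm_image_sub_le_of_norm_deriv_le (fun z _ => hF z)
    (fun z hz => hM z (abs_le.2 hz)) (abs_le.1 hy) (abs_le.1 hx)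

theorem contDiff_deriv_of_succ {F : ℝ → ℝ} {k m : ℕ∞ω} (hF : ContDiff ℝ m F) (h : k + 1 ≤ m) :
    ContDiff ℝ k (deriv F) := by
  have := hF.of_le h
  exact this.deriv'

theorem exists_localBounds {G : ℝ → ℝ} (hG : ContDiff ℝ 3 G) (A : ℝ) :
    ∃ M, LocalBounds G A M := by
  have h1 : ContDiff ℝ 2 (deriv G) := contDiff_deriv_of_succ hG (by norm_num)
  have h2 : ContDiff ℝ 1 (deriv (deriv G)) := contDiff_deriv_of_succ h1 (by norm_num)
  obtain ⟨M1, hM1, b1⟩ := exists_abs_le_on_Icc h1.continuous A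
  obtain ⟨M2, hM2, b2⟩ := exists_abs_le_on_Icc h2.continuous A
  obtain ⟨M3, hM3, b3⟩ := exists_abs_le_on_Icc (h2.continuous_deriv le_rfl) A
  have l1 : M1 ≤ M1 + M2 + M3 := by linarith
  have l2 : M2 ≤ M1 + M2 + M3 := by linarith
  have l3 : M3 ≤ M1 + M2 + M3 := by linarith
  refine ⟨M1 + M2 + M3, by positivity, fun x y hx hy => ?_, fun x hx => (b1 x hx).trans l1,
    fun x y hx hy => ?_, fun x hx => (b2 x hx).trans l2, fun x y hx hy => ?_⟩
  · exact abs_sub_le_of_abs_deriv_le (hG.differentiable (by norm_num))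
      (fun x hx => (b1 x hx).trans l1) hx hy
  · exact abs_sub_le_of_abs_deriv_le (h1.differentiable (by norm_num))
      (fun x hx => (b2 x hx).trans l2) hx hy
  · exact abs_sub_le_of_abs_deriv_le (h2.differentiable (by norm_num))
      (fun x hx => (b3 x hx).trans l3) hx hy

/-- The derivative of `G ∘ ρ`, where `p = ρ'`. -/
def compDeriv (G ρ p : ℝ → ℝ) (x : ℝ) : ℝ := deriv G (ρ x) * p x

/-- The second derivative of `G ∘ ρ`, where `p = ρ'` and `q = ρ''`. -/
def compSecond (G ρ p q : ℝ → ℝ) (x : ℝ) : ℝ :=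
  deriv (deriv G) (ρ x) * p x * p x + deriv G (ρ x) * q x

theorem IsPrimitive.comp_left {G ρ p : ℝ → ℝ} (hG : ContDiff ℝ 1 G) (hρ : IsPrimitive ρ p)
    (hp : Continuous p) : IsPrimitive (fun x => G (ρ x)) (compDeriv G ρ p) :=
  .of_hasDerivAt (fun x => (hG.differentiable one_ne_zero (ρ x)).hasDerivAt.comp x
    (hρ.hasDerivAt hp x)) (((hG.continuous_deriv le_rfl).comp hρ.continuous).mul hp)

theorem IsPrimitive.compDeriv {G ρ p q : ℝ → ℝ} (hG : ContDiff ℝ 2 G) (hρ : IsPrimitive ρ p)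
    (hp : IsPrimitive p q) : IsPrimitive (compDeriv G ρ p) (compSecond G ρ p q) :=
  (hρ.comp_left (contDiff_deriv_of_succ hG (by norm_num)) hp.continuous).mul hp

section

variable {β R A M P Q D r : ℝ} {G ρ p q ρ' p' q' : ℝ → ℝ}

theorem H2Bound.comp_left (hR : 0 ≤ R) (hG : ContDiff ℝ 2 G) (hG0 : G 0 = 0)
    (hM : LocalBounds G A M) (h : H2Bound β R ρ p q) (hA : ∀ x, |ρ x| ≤ A) (hP : ∀ x, |p x| ≤ P) :
    H2Bound β (M * (1 + P) * R) (fun x => G (ρ x)) (MassInMass.compDeriv G ρ p)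
      (compSecond G ρ p q) := by
  have hM0 := hM.nonneg
  have hP0 : 0 ≤ P := (abs_nonneg _).trans (hP 0)
  have hA0 : |(0 : ℝ)| ≤ A := by simpa using (abs_nonneg _).trans (hA 0)
  have hc := h.continuous
  have hcp := h.continuous_deriv
  have hG1 : Continuous (deriv G) := hG.continuous_deriv (by norm_num)
  have hG2 : Continuous (deriv (deriv G)) :=
    (contDiff_deriv_of_succ (k := 1) hG (by norm_num)).continuous_deriv le_rfl
  have e1 : M * R ≤ M * (1 + P) * R := by nlinarith [mul_nonneg (mul_nonneg hM0 hP0) hR]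
  refine ⟨h.prim.comp_left (hG.of_le (by norm_num)) h.continuous_deriv,
    h.prim.compDeriv hG h.prim_deriv, ?_, ?_, ?_⟩
  · have h1 := h.bound.const_mul M
    rw [abs_of_nonneg hM0] at h1
    refine (h1.mono e1).of_norm_le (hG.continuous.comp hc).aestronglyMeasurable
      (Filter.Eventually.of_forall fun x => ?_)
    rw [abs_mul, abs_of_nonneg hM0]
    simpa [hG0] using hM.lip (ρ x) 0 (hA x) hA0
  · exact (h.bound_deriv.bdd_mul (m := fun x => deriv G (ρ x))
      (hG1.comp hc).aestronglyMeasurable (fun x => hM.abs_deriv_le _ (hA x))).mono e1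
  · have h1 := h.bound_deriv.bdd_mul (m := fun x => deriv (deriv G) (ρ x) * p x) (M := M * P)
      ((hG2.comp hc).mul hcp).aestronglyMeasurable (fun x => by
        rw [abs_mul]
        exact mul_le_mul (hM.abs_second_le _ (hA x)) (hP x) (abs_nonneg _) hM0)
    have h2 := h.bound_second.bdd_mul (m := fun x => deriv G (ρ x))
      (hG1.comp hc).aestronglyMeasurable (fun x => hM.abs_deriv_le _ (hA x))
    exact (h1.add h2 (by positivity) (by positivity)).mono (by nlinarith)

theorem compSecond_lipschitz (hβ : 0 ≤ β) (hD : 0 ≤ D) (hR : 0 ≤ R) (hG : ContDiff ℝ 2 G)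
    (hM : LocalBounds G A M) (h : H2Bound β R ρ p q) (h' : H2Bound β R ρ' p' q')
    (hd : H2Bound β D (fun x => ρ x - ρ' x) (fun x => p x - p' x) (fun x => q x - q' x))
    (hA : ∀ x, |ρ x| ≤ A) (hA' : ∀ x, |ρ' x| ≤ A) (hP : ∀ x, |p x| ≤ P) (hP' : ∀ x, |p' x| ≤ P) :
    L2Bound β (M * (P ^ 2 + 2 * P + Real.exp (β / 2) * 2 * R + 1) * D)
      (fun x => compSecond G ρ p q x - compSecond G ρ' p' q' x) := by
  have hM0 := hM.nonneg
  have hP0 : 0 ≤ P := (abs_nonneg _).trans (hP 0)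
  have hc := h.continuous
  have hc' := h'.continuous
  have hcp := h.continuous_deriv
  have hcp' := h'.continuous_deriv
  have hG1 : Continuous (deriv G) := hG.continuous_deriv (by norm_num)
  have hG2 : Continuous (deriv (deriv G)) :=
    (contDiff_deriv_of_succ (k := 1) hG (by norm_num)).continuous_deriv le_rfl
  have t1 : L2Bound β (M * P ^ 2 * D)
      fun x => (deriv (deriv G) (ρ x) - deriv (deriv G) (ρ' x)) * (p x * p x) := by
    have := hd.bound.const_mul (M * P ^ 2)
    rw [abs_of_nonneg (by positivity)] at this
    refine this.of_norm_le (Continuous.aestronglyMeasurable (by fun_prop))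
      (Filter.Eventually.of_forall fun x => ?_)
    rw [abs_mul, abs_mul, abs_mul, abs_of_nonneg (show 0 ≤ M * P ^ 2 by positivity)]
    have a1 := hM.lip_second _ _ (hA x) (hA' x)
    have a2 : |p x| * |p x| ≤ P ^ 2 := by nlinarith [hP x, abs_nonneg (p x)]
    calc _ ≤ (M * |ρ x - ρ' x|) * P ^ 2 := mul_le_mul a1 a2 (by positivity) (by positivity)
      _ = _ := by ring
  have t2 : L2Bound β (M * (2 * P) * D)
      fun x => (deriv (deriv G) (ρ' x) * (p x + p' x)) * (p x - p' x) := by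
    refine hd.bound_deriv.bdd_mul (Continuous.aestronglyMeasurable (by fun_prop)) fun x => ?_
    rw [abs_mul]
    refine mul_le_mul (hM.abs_second_le _ (hA' x)) ?_ (abs_nonneg _) hM0
    exact (abs_add_le _ _).trans (by linarith [hP x, hP' x])
  have t3 : L2Bound β (M * (Real.exp (β / 2) * 2 * D) * R)
      fun x => (deriv G (ρ x) - deriv G (ρ' x)) * q x := by
    refine h.bound_second.bdd_mul (Continuous.aestronglyMeasurable (by fun_prop)) fun x => ?_
    exact (hM.lip_deriv _ _ (hA x) (hA' x)).trans
      (mul_le_mul_of_nonneg_left (hd.abs_le hβ hD x) hM0)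
  have t4 : L2Bound β (M * D) fun x => deriv G (ρ' x) * (q x - q' x) :=
    hd.bound_second.bdd_mul (Continuous.aestronglyMeasurable (by fun_prop))
      fun x => hM.abs_deriv_le _ (hA' x)
  have := ((t1.add t2 (by positivity) (by positivity)).add t3 (by positivity)
    (by positivity)).add t4 (by positivity) (by positivity)
  refine (this.mono (le_of_eq (by ring))).congr (Filter.Eventually.of_forall fun x => ?_)
  simp only [compSecond]
  ring

/-- The Taylor remainder `G(σ + f) - G(σ) - G'(σ) f`. -/
def taylorRem (G σ f : ℝ → ℝ) (x : ℝ) : ℝ := G (σ x + f x) - G (σ x) - deriv G (σ x) * f x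

/-- The right-hand side of the traveling wave problem: `σ + f` is a traveling wave if and only if
`ℋ f = δ Θ(f)`. By `osc_second_eq` the second term is `μ S (G(σ + f))''`. -/
def Theta (n : ℕ) (μ : ℝ) (G σ f : ℝ → ℝ) (x : ℝ) : ℝ :=
  delta (taylorRem G σ f) x + μ * (delta (fun y => G (σ y + f y)) x -
    freq n ^ 2 * osc n (fun y => G (σ y + f y)) x)

theorem taylorRem_lipschitz {σ f f' : ℝ → ℝ} (hG : Differentiable ℝ G) (hM : LocalBounds G A M)
    {x : ℝ} (hσ : |σ x| + r ≤ A) (hf : |f x| ≤ r) (hf' : |f' x| ≤ r) :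
    |taylorRem G σ f x - taylorRem G σ f' x| ≤ M * r * |f x - f' x| := by
  have hr : 0 ≤ r := (abs_nonneg _).trans hf
  have hd : ∀ y, HasDerivAt (fun y => G (σ x + y) - deriv G (σ x) * y)
      (deriv G (σ x + y) - deriv G (σ x)) y := fun y => by
    have h1 : HasDerivAt (fun y => G (σ x + y)) (deriv G (σ x + y)) y :=
      (hG (σ x + y)).hasDerivAt.comp_const_add (σ x) y
    simpa using! h1.sub ((hasDerivAt_id y).const_mul (deriv G (σ x)))
  have := abs_sub_le_of_abs_deriv_le (A := r) (M := M * r) (fun y => (hd y).differentiableAt)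
    (fun y hy => by
      rw [(hd y).deriv]
      refine (hM.lip_deriv _ _ ((abs_add_le _ _).trans (by linarith)) (by linarith)).trans ?_
      rw [add_sub_cancel_left]
      exact mul_le_mul_of_nonneg_left hy hM.nonneg) hf hf'
  refine le_trans (le_of_eq ?_) this
  congr 1
  simp only [taylorRem]
  ring

theorem Theta_eq {n : ℕ} (hn : 1 ≤ n) (μ : ℝ) {σ σ₁ σ₂ f : ℝ → ℝ} (hG : ContDiff ℝ 2 G)
    (hσ : H2Bound β R σ σ₁ σ₂) (hf : H2Bound β r f p q) :
    Theta n μ G σ f = fun x => delta (taylorRem G σ f) x +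
      μ * osc n (compSecond G (fun x => σ x + f x) (fun x => σ₁ x + p x) (fun x => σ₂ x + q x)) x := by
  have h1 := hσ.prim.add hf.prim
  have h2 := hσ.prim_deriv.add hf.prim_deriv
  ext x
  rw [Theta, osc_second_eq hn (h1.comp_left (hG.of_le (by norm_num)) h2.continuous)
    (h1.compDeriv hG h2)]

theorem Theta_odd {n : ℕ} (μ : ℝ) {σ f : ℝ → ℝ} (hσ : Function.Even σ) (hf : Function.Even f) :
    Function.Odd (Theta n μ G σ f) := by
  have h1 : Function.Even (taylorRem G σ f) := fun x => by
    rw [taylorRem, taylorRem, hσ, hf]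
  have h2 : Function.Even fun y => G (σ y + f y) := fun x => by
    simp only
    rw [hσ, hf]
  intro x
  rw [Theta, Theta, Function.Even.delta_odd h1, Function.Even.delta_odd h2, osc_odd h2]
  ring

theorem continuous_taylorRem {σ f : ℝ → ℝ} (hG : ContDiff ℝ 1 G) (hσ : Continuous σ)
    (hf : Continuous f) : Continuous (taylorRem G σ f) := by
  have := hG.continuous
  have := hG.continuous_deriv le_rfl
  unfold taylorRem
  fun_prop

/-- On a ball of radius `r` the map `Θ` has Lipschitz constant `O(r + 1/n)`: the Taylor remainder
is quadratic, and `S` gains a factor `1/n`. -/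
theorem exists_Theta_lipschitz (hβ : 0 ≤ β) (μ : ℝ) (hG : ContDiff ℝ 3 G) {σ σ₁ σ₂ : ℝ → ℝ}
    (hR : 0 ≤ R) (hσ : H2Bound β R σ σ₁ σ₂) :
    ∃ L : ℝ, 0 < L ∧ ∀ (n : ℕ) (r D : ℝ) (f p q f' p' q' : ℝ → ℝ), 1 ≤ n → 0 ≤ r → r ≤ 1 → 0 ≤ D →
      H2Bound β r f p q → H2Bound β r f' p' q' →
      H2Bound β D (fun x => f x - f' x) (fun x => p x - p' x) (fun x => q x - q' x) →
      L2Bound β (L * (r + 1 / n) * D) fun x => Theta n μ G σ f x - Theta n μ G σ f' x := by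
  set S := Real.exp (β / 2) * 2 with hS
  have hS0 : 0 < S := by positivity
  obtain ⟨M, hM⟩ := exists_localBounds hG (S * R + S)
  have hM0 := hM.nonneg
  have hG2 : ContDiff ℝ 2 G := hG.of_le (by norm_num)
  set P := S * (R + 1) with hP
  have hP0 : 0 ≤ P := by positivity
  set L₁ := deltaConst β * (M * S)
  set L₂ := |μ| * (Real.exp (β / 2) * (M * (P ^ 2 + 2 * P + S * (R + 1) + 1)))
  have hL₁ : 0 ≤ L₁ := mul_nonneg (deltaConst_pos β).le (by positivity)
  have hL₂ : 0 ≤ L₂ := by positivity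
  refine ⟨L₁ + L₂ + 1, by positivity, fun n r D f p q f' p' q' hn hr hr1 hD hf hf' hd => ?_⟩
  have hn0 : (0 : ℝ) < n := by exact_mod_cast hn
  have hσA : ∀ x, |σ x| ≤ S * R := hσ.abs_le hβ hR
  have hfS : ∀ {f p q}, H2Bound β r f p q → ∀ x, |f x| ≤ S * r := fun h => h.abs_le hβ hr
  have hSr : S * r ≤ S := mul_le_of_le_one_right hS0.le hr1
  have hsum : ∀ {f p q}, H2Bound β r f p q →
      H2Bound β (R + 1) (fun x => σ x + f x) (fun x => σ₁ x + p x) (fun x => σ₂ x + q x) :=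
    fun h => (hσ.add h hR hr).mono (by linarith)
  have hsumA : ∀ {f p q}, H2Bound β r f p q → ∀ x, |σ x + f x| ≤ S * R + S := fun h x =>
    (abs_add_le _ _).trans (by linarith [hσA x, hfS h x])
  have hsumP : ∀ {f p q}, H2Bound β r f p q → ∀ x, |σ₁ x + p x| ≤ P := fun h x =>
    (hsum h).abs_deriv_le hβ (by positivity) x
  have t1 : L2Bound β (M * (S * r) * D) fun x => taylorRem G σ f x - taylorRem G σ f' x := by
    have := hd.bound.const_mul (M * (S * r))
    rw [abs_of_nonneg (by positivity)] at this
    refine this.of_norm_le ((continuous_taylorRem (hG.of_le (by norm_num)) hσ.continuous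
      hf.continuous).sub (continuous_taylorRem (hG.of_le (by norm_num)) hσ.continuous
      hf'.continuous)).aestronglyMeasurable (Filter.Eventually.of_forall fun x => ?_)
    rw [abs_mul, abs_of_nonneg (show 0 ≤ M * (S * r) by positivity)]
    exact taylorRem_lipschitz (hG.differentiable (by norm_num)) hM (by linarith [hσA x])
      (hfS hf x) (hfS hf' x)
  have t2 := t1.delta hβ (by positivity)
  have hdsum : H2Bound β D (fun x => σ x + f x - (σ x + f' x)) (fun x => σ₁ x + p x - (σ₁ x + p' x))
      (fun x => σ₂ x + q x - (σ₂ x + q' x)) := by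
    simpa only [add_sub_add_left_eq_sub] using hd
  have t3 := compSecond_lipschitz hβ hD (by positivity) hG2 hM (hsum hf) (hsum hf') hdsum
    (hsumA hf) (hsumA hf') (hsumP hf) (hsumP hf')
  have hl : ∀ {f p q}, H2Bound β r f p q → LocallyIntegrable (compSecond G (fun x => σ x + f x)
      (fun x => σ₁ x + p x) (fun x => σ₂ x + q x)) := fun h =>
    ((hsum h).prim.compDeriv hG2 (hsum h).prim_deriv).locallyIntegrable
  have hco : ∀ {f p q}, H2Bound β r f p q → Continuous (osc n (compSecond G (fun x => σ x + f x)
      (fun x => σ₁ x + p x) (fun x => σ₂ x + q x))) := fun h =>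
    continuous_osc_second hn ((hsum h).prim.comp_left (hG.of_le (by norm_num))
      (hsum h).continuous_deriv) ((hsum h).prim.compDeriv hG2 (hsum h).prim_deriv)
  have t4 := (t3.osc hβ hn (by
    rw [funext (osc_sub (hl hf) (hl hf'))]
    exact ((hco hf).sub (hco hf')).aestronglyMeasurable)).const_mul μ
  rw [delta_sub] at t2
  rw [funext (osc_sub (hl hf) (hl hf'))] at t4
  have hω := freq_pos hn
  have t5 := t2.add t4 (mul_nonneg (deltaConst_pos β).le (by positivity)) (by positivity)
  rw [Theta_eq hn μ hG2 hσ hf, Theta_eq hn μ hG2 hσ hf']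
  refine (t5.mono ?_).congr (Filter.Eventually.of_forall fun x => by simp only; ring)
  have e1 : (deltaConst β * (M * (S * r) * D)) = L₁ * r * D := by ring
  have e2 : |μ| * (Real.exp (β / 2) *
      (M * (P ^ 2 + 2 * P + Real.exp (β / 2) * 2 * (R + 1) + 1) * D) / freq n) =
      L₂ * D * (1 / freq n) := by ring
  rw [e1, e2]
  have e3 : 1 / freq n ≤ 1 / n := one_div_le_one_div_of_le hn0 (natCast_le_freq n)
  have e4 : 0 ≤ 1 / (n : ℝ) := by positivity
  calc L₁ * r * D + L₂ * D * (1 / freq n) ≤ L₁ * r * D + L₂ * D * (1 / n) := by gcongr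
    _ ≤ (L₁ + L₂ + 1) * (r + 1 / n) * D := by
        have := mul_nonneg hr hD
        have := mul_nonneg e4 hD
        nlinarith [mul_nonneg hL₁ (mul_nonneg e4 hD), mul_nonneg hL₂ (mul_nonneg hr hD)]

/-- `Θ(0) = O(1/n)`. -/
theorem exists_Theta_zero_bound (hβ : 0 ≤ β) (μ : ℝ) (hG : ContDiff ℝ 3 G) (hG0 : G 0 = 0)
    {σ σ₁ σ₂ : ℝ → ℝ} (hR : 0 ≤ R) (hσ : H2Bound β R σ σ₁ σ₂) :
    ∃ L : ℝ, 0 < L ∧ ∀ n : ℕ, 1 ≤ n → L2Bound β (L / n) (Theta n μ G σ fun _ => 0) := by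
  set S := Real.exp (β / 2) * 2 with hS
  obtain ⟨M, hM⟩ := exists_localBounds hG (S * R)
  have hM0 := hM.nonneg
  have hG2 : ContDiff ℝ 2 G := hG.of_le (by norm_num)
  have hcomp := hσ.comp_left hR hG2 hG0 hM (hσ.abs_le hβ hR) (hσ.abs_deriv_le hβ hR)
  have hP : 0 ≤ S * R := by positivity
  refine ⟨|μ| * (Real.exp (β / 2) * (M * (1 + S * R) * R)) + 1, by positivity, fun n hn => ?_⟩
  have hn0 : (0 : ℝ) < n := by exact_mod_cast hn
  have hω := freq_pos hn
  have h1 := (hcomp.osc hβ hn).bound_second.const_mul μ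
  have h2 : ∀ x, osc n (compSecond G σ σ₁ σ₂) x = delta (fun y => G (σ y)) x -
      freq n ^ 2 * osc n (fun y => G (σ y)) x := osc_second_eq hn hcomp.prim hcomp.prim_deriv
  refine (h1.mono ?_).congr (Filter.Eventually.of_forall fun x => ?_)
  · have e3 : 1 / freq n ≤ 1 / n := one_div_le_one_div_of_le hn0 (natCast_le_freq n)
    have e0 : 0 ≤ |μ| * (Real.exp (β / 2) * (M * (1 + S * R) * R)) := by positivity
    calc _ = |μ| * (Real.exp (β / 2) * (M * (1 + S * R) * R)) * (1 / freq n) := by ring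
      _ ≤ |μ| * (Real.exp (β / 2) * (M * (1 + S * R) * R)) * (1 / n) := by gcongr
      _ ≤ _ := by rw [mul_one_div]; gcongr; linarith
  · have h3 : taylorRem G σ (fun _ => 0) = fun _ => 0 := funext fun x => by simp [taylorRem]
    simp only [Theta, h2, h3, add_zero]
    simp [delta]

end

/-! ### The fixed point problem -/

section

variable {β R r D : ℝ} {σ σ₁ σ₂ f p q f' p' q' : ℝ → ℝ}

/-- The odd function `(u(x) - u(-x)) / (2 cosh^β x)`; the quotient spaces `L²` are thus turned into
honest odd functions of weighted norm at most `‖u‖`. -/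
def oddPart (β : ℝ) (u : ℝ → ℝ) (x : ℝ) : ℝ := 1 / 2 * (Real.cosh x ^ (-β) * (u x - u (-x)))

theorem oddPart_odd (β : ℝ) (u : ℝ → ℝ) : Function.Odd (oddPart β u) := by
  intro x
  simp only [oddPart, Real.cosh_neg, neg_neg]
  ring

theorem oddPart_ae_congr {u v : ℝ → ℝ} (h : u =ᵐ[volume] v) :
    oddPart β u =ᵐ[volume] oddPart β v := by
  have h1 := (Measure.measurePreserving_neg (volume : Measure ℝ)).quasiMeasurePreserving.ae_eq_comp h
  filter_upwards [h, h1] with x h h1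
  simp only [Function.comp_apply] at h1
  rw [oddPart, oddPart, h, h1]

theorem oddPart_weight_mul {Θ : ℝ → ℝ} (h : Function.Odd Θ) :
    oddPart β (fun x => Real.cosh x ^ β * Θ x) = Θ := by
  ext x
  simp only [oddPart, Real.cosh_neg, h x]
  have := Real.rpow_add (Real.cosh_pos x) (-β) β
  rw [neg_add_cancel, Real.rpow_zero] at this
  linear_combination (-Θ x) * this

theorem l2Bound_oddPart (u : Lp ℝ 2 (volume : Measure ℝ)) : L2Bound β ‖u‖ (oddPart β u) := by
  have h0 : L2Bound β ‖u‖ fun x => Real.cosh x ^ (-β) * u x := by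
    refine ⟨(continuous_weight (-β)).aestronglyMeasurable.mul (Lp.aestronglyMeasurable u), ?_⟩
    rw [ofReal_norm, Lp.enorm_def]
    refine eLpNorm_mono fun x => le_of_eq ?_
    rw [← mul_assoc, ← Real.rpow_add (Real.cosh_pos x)]
    simp
  have h1 := (h0.sub h0.comp_neg (norm_nonneg u) (norm_nonneg u)).const_mul (1 / 2)
  refine (h1.mono (le_of_eq ?_)).congr (Filter.Eventually.of_forall fun x => ?_)
  · rw [abs_of_pos (by norm_num)]; ring
  · simp only [oddPart, Real.cosh_neg]; ring

theorem oddPart_sub_ae (u v : Lp ℝ 2 (volume : Measure ℝ)) :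
    oddPart β (u - v : Lp ℝ 2 (volume : Measure ℝ)) =ᵐ[volume]
      fun x => oddPart β u x - oddPart β v x := by
  refine (oddPart_ae_congr (Lp.coeFn_sub u v)).trans (Filter.Eventually.of_forall fun x => ?_)
  simp only [oddPart, Pi.sub_apply]
  ring

theorem L2Bound.norm_toLp_le {Θ : ℝ → ℝ} (hR : 0 ≤ R) (h : L2Bound β R Θ) :
    ‖h.memLp_weight.toLp‖ ≤ R := by
  rw [Lp.norm_toLp]
  exact ENNReal.toReal_le_of_le_ofReal hR h.le

theorem h2Bound_zero : H2Bound β 0 (fun _ => 0) (fun _ => 0) (fun _ => 0) := by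
  have : IsPrimitive (fun _ : ℝ => (0 : ℝ)) (fun _ => 0) :=
    .of_hasDerivAt (fun x => hasDerivAt_const x _) continuous_const
  exact ⟨this, this, .zero, .zero, .zero⟩

theorem SolvesLinearized.congr_right {W : ℝ → ℝ} {c : ℝ} {Θ Θ' : ℝ → ℝ}
    (h : SolvesLinearized W c σ f q Θ) (hΘ : Θ =ᵐ[volume] Θ') : SolvesLinearized W c σ f q Θ' := by
  filter_upwards [h, delta_ae_congr hΘ] with x h1 h2
  rw [← h2, h1]

/-- Iterating `D ↦ D / 2` shows that a bound that can always be halved is zero. -/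
theorem H2Bound.eq_of_halving (hD : 0 ≤ D)
    (h : H2Bound β D (fun x => f x - f' x) (fun x => p x - p' x) (fun x => q x - q' x))
    (hhalf : ∀ D, 0 ≤ D →
      H2Bound β D (fun x => f x - f' x) (fun x => p x - p' x) (fun x => q x - q' x) →
      H2Bound β (D / 2) (fun x => f x - f' x) (fun x => p x - p' x) (fun x => q x - q' x)) :
    f = f' := by
  have hall : ∀ k : ℕ,
      H2Bound β (D / 2 ^ k) (fun x => f x - f' x) (fun x => p x - p' x) (fun x => q x - q' x) := by
    intro k
    induction k with
    | zero => simpa using h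
    | succ k ih =>
      rw [pow_succ, ← div_div]
      exact hhalf _ (by positivity) ih
  have hlim : Filter.Tendsto (fun k : ℕ => ENNReal.ofReal (D / 2 ^ k)) Filter.atTop (nhds 0) := by
    rw [← ENNReal.ofReal_zero]
    refine ENNReal.tendsto_ofReal ?_
    have := (tendsto_pow_atTop_nhds_zero_of_lt_one (r := (1 / 2 : ℝ)) (by norm_num)
      (by norm_num)).const_mul D
    simpa [div_eq_mul_inv] using this
  have h0 : L2Bound β 0 fun x => f x - f' x := by
    refine ⟨h.bound.1, ?_⟩
    rw [ENNReal.ofReal_zero]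
    exact ge_of_tendsto' hlim fun k => (hall k).bound.le
  have := Measure.eq_of_ae_eq h0.ae_eq_zero h.continuous continuous_zero
  ext x
  have := congrFun this x
  simpa [sub_eq_zero] using this

/-- For large `n` the equation `ℋ f = δ Θ(f)` has an even solution of size `O(1/n)`, by the
contraction principle. It is the only even solution in the ball of radius `a' / n`, for every
prescribed `a'`. -/
theorem IsAdmissibleWith.exists_solution {W : ℝ → ℝ} {c β : ℝ} {σ : ℝ → ℝ}
    (hadm : IsAdmissibleWith W c β σ) (hW : ContDiff ℝ 4 W) (hW0 : deriv W 0 = 0) (μ : ℝ) :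
    ∃ a : ℝ, 0 < a ∧ ∀ a' : ℝ, ∃ N : ℕ, 1 ≤ N ∧ ∀ n : ℕ, N ≤ n →
      (∃ f p q, H2Bound β (a / n) f p q ∧ Function.Even f ∧
        SolvesLinearized W c σ f q (Theta n μ (deriv W) σ f)) ∧
      ∀ f p q f' p' q', H2Bound β (a' / n) f p q → H2Bound β (a' / n) f' p' q' →
        Function.Even f → Function.Even f' →
        SolvesLinearized W c σ f q (Theta n μ (deriv W) σ f) →
        SolvesLinearized W c σ f' q' (Theta n μ (deriv W) σ f') → f = f' := by
  have hβ := hadm.beta_pos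
  have hG : ContDiff ℝ 3 (deriv W) := contDiff_deriv_of_succ hW (by norm_num)
  have hG1 : ContDiff ℝ 1 (deriv W) := hG.of_le (by norm_num)
  obtain ⟨R, σ₁, σ₂, hR, hσ⟩ := hadm.mem.1.exists_h2Bound hadm.continuous
  have hσe := hadm.mem.2
  obtain ⟨K, hK, hinv, hprior⟩ := hadm.exists_inverse
  obtain ⟨L, hL, hlip⟩ := exists_Theta_lipschitz hβ.le μ hG hR hσ
  obtain ⟨L₀, hL₀, hzero⟩ := exists_Theta_zero_bound hβ.le μ hG hW0 hR hσ
  set G := deriv W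
  refine ⟨K * (2 * L₀), by positivity, fun a' => ?_⟩
  -- Both the contraction radius and the radius for uniqueness are covered by `A / n`.
  set A := max (K * (2 * L₀)) a' with hA
  have hA0 : 0 < A := lt_max_of_lt_left (by positivity)
  -- This `N` gives `A / n ≤ 1` and the Lipschitz constant `K L (A + 1) / n ≤ 1 / 2`.
  obtain ⟨N, hN⟩ := exists_nat_ge (A + K * L * (A + 1) * 2 + 1)
  have hN1 : (1 : ℝ) ≤ N := le_trans (by nlinarith [mul_pos hK hL, mul_pos (mul_pos hK hL) hA0]) hN
  refine ⟨N, by exact_mod_cast hN1, fun n hn => ?_⟩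
  have hnN : (N : ℝ) ≤ n := by exact_mod_cast hn
  have hn1 : 1 ≤ n := by exact_mod_cast hN1.trans hnN
  have hn0 : (0 : ℝ) < n := by exact_mod_cast hn1
  have hr1 : A / n ≤ 1 := by
    rw [div_le_one hn0]
    nlinarith [mul_pos hK hL, mul_pos (mul_pos hK hL) hA0]
  have hr0 : 0 ≤ A / n := by positivity
  have hcontr : K * (L * (A / n + 1 / n)) ≤ 1 / 2 := by
    have : K * (L * (A / n + 1 / n)) = K * L * (A + 1) / n := by field_simp
    rw [this, div_le_iff₀ hn0]
    nlinarith
  have key : ∀ {f p q f' p' q' : ℝ → ℝ} {D : ℝ}, 0 ≤ D →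
      H2Bound β (A / n) f p q → H2Bound β (A / n) f' p' q' →
      H2Bound β D (fun x => f x - f' x) (fun x => p x - p' x) (fun x => q x - q' x) →
      L2Bound β (L * (A / n + 1 / n) * D) fun x => Theta n μ G σ f x - Theta n μ G σ f' x :=
    fun hD hf hf' hd => hlip n (A / n) _ _ _ _ _ _ _ hn1 hr0 hr1 hD hf hf' hd
  constructor
  · set b := 2 * L₀ / n with hb
    have hb0 : 0 ≤ b := by positivity
    have hb2 : b / 2 = L₀ / n := by rw [hb]; ring
    have hKb : K * b ≤ A / n := by
      rw [hb, ← mul_div_assoc]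
      gcongr
      exact le_max_left _ _
    -- The unknown is `u = cosh^β Θ` in the complete space `L²`; `F u` solves `ℋ (F u) = δ Θ` for
    -- the odd function `Θ` encoded by `u`, and the contraction is `u ↦ cosh^β Θ(F u)`.
    choose F P Q hF hFe hFs using fun u : Metric.closedBall (0 : Lp ℝ 2 (volume : Measure ℝ)) b =>
      hinv (oddPart β u.1) ‖u.1‖ (norm_nonneg _) (oddPart_odd β _) (l2Bound_oddPart u.1)
    have hub : ∀ u : Metric.closedBall (0 : Lp ℝ 2 (volume : Measure ℝ)) b, ‖u.1‖ ≤ b := fun u =>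
      mem_closedBall_zero_iff.1 u.2
    have hFA : ∀ u, H2Bound β (A / n) (F u) (P u) (Q u) := fun u => (hF u).mono
      ((mul_le_mul_of_nonneg_left (hub u) hK.le).trans hKb)
    have hdiff : ∀ u v, H2Bound β (K * ‖u.1 - v.1‖) (fun x => F u x - F v x)
        (fun x => P u x - P v x) (fun x => Q u x - Q v x) := fun u v => by
      refine hprior (oddPart β (u.1 - v.1 : Lp ℝ 2 (volume : Measure ℝ))) _ _ _ _ (A / n + A / n)
        (norm_nonneg _) (by positivity) (oddPart_odd β _) (l2Bound_oddPart _)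
        ((hFA u).sub (hFA v) hr0 hr0) (fun x => by simp only [hFe u x, hFe v x]) ?_
      exact ((hFs u).sub (hFs v)).congr_right (oddPart_sub_ae u.1 v.1).symm
    have hΘ : ∀ u, L2Bound β b (Theta n μ G σ (F u)) := fun u => by
      have h0 : H2Bound β (K * ‖u.1‖) (fun x => F u x - 0) (fun x => P u x - 0)
          (fun x => Q u x - 0) := by simpa using hF u
      have h1 := (key (by positivity) (hFA u) (h2Bound_zero.mono hr0) h0).add (hzero n hn1)
        (by positivity) (by positivity)
      refine (h1.mono ?_).congr (Filter.Eventually.of_forall fun x => by simp)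
      calc L * (A / n + 1 / n) * (K * ‖u.1‖) + L₀ / n
          = K * (L * (A / n + 1 / n)) * ‖u.1‖ + b / 2 := by rw [hb2]; ring
        _ ≤ 1 / 2 * b + b / 2 := by
            have := hub u
            gcongr
        _ = b := by ring
    let Ψ : Metric.closedBall (0 : Lp ℝ 2 (volume : Measure ℝ)) b →
        Metric.closedBall (0 : Lp ℝ 2 (volume : Measure ℝ)) b := fun u =>
      ⟨(hΘ u).memLp_weight.toLp, mem_closedBall_zero_iff.2 ((hΘ u).norm_toLp_le hb0)⟩
    have hΨ : ContractingWith (1 / 2) Ψ := by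
      refine ⟨by norm_num, LipschitzWith.of_dist_le_mul fun u v => ?_⟩
      rw [Subtype.dist_eq, Subtype.dist_eq, dist_eq_norm, dist_eq_norm]
      have h1 := key (by positivity) (hFA u) (hFA v) (hdiff u v)
      have h2 : (Ψ u).1 - (Ψ v).1 = h1.memLp_weight.toLp := by
        change (hΘ u).memLp_weight.toLp - (hΘ v).memLp_weight.toLp = _
        rw [← MemLp.toLp_sub]
        exact MemLp.toLp_congr _ _ (Filter.Eventually.of_forall fun x => by
          simp only [Pi.sub_apply]; ring)
      rw [h2]
      refine (h1.norm_toLp_le (by positivity)).trans ?_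
      calc L * (A / n + 1 / n) * (K * ‖u.1 - v.1‖)
          = K * (L * (A / n + 1 / n)) * ‖u.1 - v.1‖ := by ring
        _ ≤ 1 / 2 * ‖u.1 - v.1‖ := by gcongr
        _ = _ := by norm_num
    have : Nonempty (Metric.closedBall (0 : Lp ℝ 2 (volume : Measure ℝ)) b) :=
      ⟨⟨0, Metric.mem_closedBall_self hb0⟩⟩
    have : CompleteSpace (Metric.closedBall (0 : Lp ℝ 2 (volume : Measure ℝ)) b) :=
      Metric.isClosed_closedBall.completeSpace_coe
    set u := hΨ.fixedPoint with hu
    have hfix : Ψ u = u := hΨ.fixedPoint_isFixedPt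
    refine ⟨F u, P u, Q u, (hF u).mono ?_, hFe u, (hFs u).congr_right ?_⟩
    · calc K * ‖u.1‖ ≤ K * b := mul_le_mul_of_nonneg_left (hub u) hK.le
        _ = K * (2 * L₀) / n := by rw [hb]; ring
    · have h1 : (u.1 : ℝ → ℝ) =ᵐ[volume] fun x => Real.cosh x ^ β * Theta n μ G σ (F u) x := by
        have h2 : (hΘ u).memLp_weight.toLp = u.1 := congrArg Subtype.val hfix
        rw [← h2]
        exact (hΘ u).memLp_weight.coeFn_toLp
      exact (oddPart_ae_congr h1).trans
        (Filter.EventuallyEq.of_eq (oddPart_weight_mul (Theta_odd μ hσe (hFe u))))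
  · intro f p q f' p' q' hf hf' he he' hs hs'
    have ha : a' / n ≤ A / n := by gcongr; exact le_max_right _ _
    have hf := hf.mono ha
    have hf' := hf'.mono ha
    refine H2Bound.eq_of_halving (by positivity) (hf.sub hf' hr0 hr0) fun D hD hd => ?_
    refine (hprior _ _ _ _ _ D (by positivity) hD (fun x => ?_) (key hD hf hf' hd) hd
      (fun x => by simp only [he x, he' x]) (hs.sub hs')).mono ?_
    · simp only [Theta_odd μ hσe he x, Theta_odd μ hσe he' x]; ring
    · calc K * (L * (A / n + 1 / n) * D) = K * (L * (A / n + 1 / n)) * D := by ring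
        _ ≤ 1 / 2 * D := by gcongr
        _ = D / 2 := by ring

end

/-! ### Reduction of the traveling wave system to the fixed point problem -/

section

variable {β R r : ℝ} {σ σ₁ σ₂ f p q : ℝ → ℝ} {n : ℕ} {V : ℝ → ℝ} {c μ : ℝ}

/-- Conservation of energy: a nonzero solution of `y'' + ω² y = 0` is not square integrable. -/
theorem H2Bound.eq_zero_of_oscillator (hβ : 0 ≤ β) {w : ℝ} (hw : 0 < w) (h : H2Bound β R f p q)
    (heq : ∀ᵐ x, q x = -(w ^ 2) * f x) : f = 0 := by
  have hp : IsPrimitive p fun x => -(w ^ 2) * f x := h.prim_deriv.congr_right heq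
  have hpd : ∀ x, HasDerivAt p (-(w ^ 2) * f x) x :=
    hp.hasDerivAt (continuous_const.mul h.continuous)
  have hE : ∀ x, HasDerivAt (fun x => p x ^ 2 + w ^ 2 * f x ^ 2) 0 x := fun x => by
    have := ((hpd x).pow 2).add (((h.hasDerivAt x).pow 2).const_mul (w ^ 2))
    convert! this using 1
    push_cast
    ring
  have hconst : ∀ x, p x ^ 2 + w ^ 2 * f x ^ 2 = p 0 ^ 2 + w ^ 2 * f 0 ^ 2 := fun x =>
    is_const_of_deriv_eq_zero (fun x => (hE x).differentiableAt) (fun x => (hE x).deriv) x 0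
  have hint : Integrable fun x => p x ^ 2 + w ^ 2 * f x ^ 2 :=
    (h.bound_deriv.memLp hβ).integrable_sq.add ((h.memLp hβ).integrable_sq.const_mul _)
  simp_rw [hconst] at hint
  have h0 : p 0 ^ 2 + w ^ 2 * f 0 ^ 2 = 0 := by
    rcases integrable_const_iff.1 hint with h | h
    · exact h
    · exact absurd h.measure_univ_lt_top (by simp)
  ext x
  have h1 := hconst x
  rw [h0] at h1
  have h2 : 0 ≤ w ^ 2 * f x ^ 2 := by positivity
  have h3 : w ^ 2 * f x ^ 2 = 0 := by linarith [sq_nonneg (p x)]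
  simpa [hw.ne'] using h3

/-- The displacement `-(1+μ)/c² S G(ρ)` of the internal oscillators driven by `ρ`. -/
def internalWave (n : ℕ) (c μ : ℝ) (G ρ : ℝ → ℝ) (x : ℝ) : ℝ :=
  -((1 + μ) / c ^ 2) * osc n (fun y => G (ρ y)) x

/-- The normalized potential `(1 + μ)⁻¹ V`. -/
def normPotential (μ : ℝ) (V : ℝ → ℝ) (x : ℝ) : ℝ := (1 + μ)⁻¹ * V x

theorem deriv_normPotential (μ : ℝ) (V : ℝ → ℝ) :
    deriv (normPotential μ V) = fun x => (1 + μ)⁻¹ * deriv V x :=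
  funext fun _ => deriv_const_mul_field _

theorem deriv_eq_mul_deriv_normPotential (hμ : 0 < μ) (V : ℝ → ℝ) :
    deriv V = fun x => (1 + μ) * deriv (normPotential μ V) x := by
  have : 1 + μ ≠ 0 := by positivity
  ext x
  rw [deriv_normPotential]
  field_simp

theorem kappa_eq (c μ : ℝ) (n : ℕ) : kappa c μ n = c ^ 2 * freq n ^ 2 * μ / (1 + μ) := by
  rw [kappa, freq]; ring

theorem exists_internalWave_bound (hβ : 0 ≤ β) (hR : 0 ≤ R) (c μ : ℝ) {G : ℝ → ℝ}
    (hG : ContDiff ℝ 3 G) (hG0 : G 0 = 0) :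
    ∃ C, 0 < C ∧ ∀ n : ℕ, 1 ≤ n → ∀ ρ p q, H2Bound β R ρ p q →
      ∃ p' q', H2Bound β (C / n) (internalWave n c μ G ρ) p' q' ∧
        ∀ x, q' x = -((1 + μ) / c ^ 2) * delta (fun y => G (ρ y)) x -
          freq n ^ 2 * internalWave n c μ G ρ x := by
  set S := Real.exp (β / 2) * 2
  have hS : 0 < S := by positivity
  obtain ⟨M, hM⟩ := exists_localBounds hG (S * R)
  have hM0 := hM.nonneg
  have hG2 : ContDiff ℝ 2 G := hG.of_le (by norm_num)
  set T := |-((1 + μ) / c ^ 2)| * (Real.exp (β / 2) * (M * (1 + S * R) * R)) with hT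
  have hT0 : 0 ≤ T := by positivity
  refine ⟨T + 1, by positivity, fun n hn ρ p q h => ?_⟩
  have hn0 : (0 : ℝ) < n := by exact_mod_cast hn
  have hcomp := h.comp_left hR hG2 hG0 hM (h.abs_le hβ hR) (h.abs_deriv_le hβ hR)
  have h1 := (hcomp.osc hβ hn).const_mul (-((1 + μ) / c ^ 2))
  refine ⟨_, _, h1.mono ?_, fun x => ?_⟩
  · rw [← mul_div_assoc, ← hT]
    exact (div_le_div_of_nonneg_left hT0 hn0 (natCast_le_freq n)).trans
      (by gcongr; linarith)
  · rw [osc_second_eq hn hcomp.prim hcomp.prim_deriv, internalWave]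
    ring

/-- The second equation determines the internal wave: at a resonant frequency the forced
oscillator has exactly one square integrable solution. -/
theorem eq_internalWave (hβ : 0 ≤ β) (hμ : 0 < μ) (hc : c ≠ 0) (hn : 1 ≤ n)
    (hV : ContDiff ℝ 5 V) (hV0 : deriv V 0 = 0) {ρ₁ ρ₂ p₁ q₁ p₂ q₂ : ℝ → ℝ} {R₂ : ℝ} (hR : 0 ≤ R)
    (hR₂ : 0 ≤ R₂) (h₁ : H2Bound β R ρ₁ p₁ q₁) (h₂ : H2Bound β R₂ ρ₂ p₂ q₂)
    (heq : ∀ᵐ x, c ^ 2 * μ * q₂ x + kappa c μ n * (1 + μ) * ρ₂ x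
      + μ * delta (fun y => deriv V (ρ₁ y)) x = 0) :
    ρ₂ = internalWave n c μ (deriv (normPotential μ V)) ρ₁ := by
  have hV1 : ContDiff ℝ 4 (deriv V) := contDiff_deriv_of_succ hV (by norm_num)
  have hG : ContDiff ℝ 3 (deriv (normPotential μ V)) := by
    rw [deriv_normPotential]
    exact contDiff_const.mul (hV1.of_le (by norm_num))
  have hG0 : deriv (normPotential μ V) 0 = 0 := by rw [deriv_normPotential]; simp [hV0]
  obtain ⟨C, hC, hb⟩ := exists_internalWave_bound hβ hR c μ hG hG0
  obtain ⟨p', q', hz, hzq⟩ := hb n hn ρ₁ p₁ q₁ h₁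
  have h0 := (h₂.sub hz hR₂ (by positivity)).eq_zero_of_oscillator hβ (freq_pos hn) (by
    filter_upwards [heq] with x hx
    have h1μ : 1 + μ ≠ 0 := by positivity
    rw [kappa_eq, deriv_eq_mul_deriv_normPotential hμ V, delta_const_mul] at hx
    rw [hzq]
    have hcμ : c ^ 2 * μ ≠ 0 := by positivity
    have hk : c ^ 2 * freq n ^ 2 * μ / (1 + μ) * (1 + μ) = c ^ 2 * μ * freq n ^ 2 := by
      field_simp
    rw [hk] at hx
    have hk2 : μ * ((1 + μ) * delta (fun y => deriv (normPotential μ V) (ρ₁ y)) x) =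
        c ^ 2 * μ * ((1 + μ) / c ^ 2 * delta (fun y => deriv (normPotential μ V) (ρ₁ y)) x) := by
      field_simp
    rw [hk2] at hx
    refine mul_left_cancel₀ hcμ ?_
    linear_combination hx)
  ext x
  have := congrFun h0 x
  simpa [sub_eq_zero] using this

/-- With the internal wave eliminated, the first equation says `ℋ f = δ Θ(f)`. -/
theorem first_equation_iff (hμ : 0 < μ) (hc : c ≠ 0)
    (hσ : ∀ᵐ x, c ^ 2 * σ₂ x -
      delta (delta fun y => deriv (normPotential μ V) (σ y)) x = 0) {ρ q₁ : ℝ → ℝ}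
    (hρ : ρ = fun x => σ x + f x) (hq : q₁ =ᵐ[volume] fun x => σ₂ x + q x) :
    (∀ᵐ x, c ^ 2 * q₁ x - delta (delta fun y => deriv V (ρ y)) x -
      kappa c μ n * delta (internalWave n c μ (deriv (normPotential μ V)) ρ) x = 0) ↔
    SolvesLinearized (normPotential μ V) c σ f q
      (Theta n μ (deriv (normPotential μ V)) σ f) := by
  subst hρ
  have h1μ : 1 + μ ≠ 0 := by positivity
  rw [deriv_eq_mul_deriv_normPotential hμ V]
  set G := deriv (normPotential μ V) with hG
  unfold SolvesLinearized
  rw [← hG]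
  have e1 : ∀ x, delta (internalWave n c μ G fun x => σ x + f x) x =
      -((1 + μ) / c ^ 2) * delta (osc n fun y => G (σ y + f y)) x := fun x => by
    unfold internalWave
    rw [delta_const_mul]
  have e2 : ∀ x, delta (Theta n μ G σ f) x = delta (delta fun y => G (σ y + f y)) x
      - delta (delta fun y => G (σ y)) x - delta (delta fun y => deriv G (σ y) * f y) x +
      μ * (delta (delta fun y => G (σ y + f y)) x -
        freq n ^ 2 * delta (osc n fun y => G (σ y + f y)) x) := fun x => by
    unfold Theta taylorRem
    simp only [delta_add, delta_sub, delta_const_mul]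
  have e3 : kappa c μ n * -((1 + μ) / c ^ 2) = -(μ * freq n ^ 2) := by
    rw [kappa_eq]; field_simp
  simp only [delta_const_mul]
  constructor
  · intro h
    filter_upwards [h, hσ, hq] with x h1 h2 h3
    rw [e1, h3, ← mul_assoc (kappa c μ n), e3] at h1
    rw [e2]
    linear_combination h2 - h1
  · intro h
    filter_upwards [h, hσ, hq] with x h1 h2 h3
    rw [e2] at h1
    rw [e1, h3, ← mul_assoc (kappa c μ n), e3]
    linear_combination h2 - h1

theorem SolvesMonatomic.ae_eq {W : ℝ → ℝ} (h : SolvesMonatomic W c σ) (hσ : H2Bound β R σ σ₁ σ₂) :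
    ∀ᵐ x, c ^ 2 * σ₂ x - delta (delta fun y => deriv W (σ y)) x = 0 := by
  obtain ⟨σ'', h1, h2⟩ := h
  filter_upwards [h2, h1.ae_unique hσ.hasWeakSecondDeriv] with x h3 h4
  rw [← h4, h3]

/-- A solitary wave consists of a small solution of the fixed point problem and its internal
wave. -/
theorem IsSolitaryWave.reduce (hμ : 0 < μ) (hc : c ≠ 0) (hn : 1 ≤ n)
    (hV : ContDiff ℝ 5 V) (hV0 : deriv V 0 = 0)
    (hadm : IsAdmissibleWith (normPotential μ V) c β σ) (hR : 0 ≤ R)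
    (hσ : H2Bound β R σ σ₁ σ₂) {ε : ℝ} (hε : 0 ≤ ε) {ρ : (ℝ → ℝ) × (ℝ → ℝ)}
    (h : IsSolitaryWave V c μ (kappa c μ n) β σ ε ρ) :
    ∃ p q, H2Bound β ((1 + 3 * |β| + β ^ 2) * (5 * (2 * Real.pi) ^ 2) * ε)
        (fun x => ρ.1 x - σ x) p q ∧
      Function.Even (fun x => ρ.1 x - σ x) ∧
      SolvesLinearized (normPotential μ V) c σ (fun x => ρ.1 x - σ x) q
        (Theta n μ (deriv (normPotential μ V)) σ fun x => ρ.1 x - σ x) ∧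
      ρ.2 = internalWave n c μ (deriv (normPotential μ V)) ρ.1 := by
  have hβ := hadm.beta_pos
  obtain ⟨R₁, p₁, q₁, hR₁, h₁⟩ := h.mem_fst.exists_h2Bound h.continuous_fst
  obtain ⟨R₂, p₂, q₂, hR₂, h₂⟩ := h.mem_snd.exists_h2Bound h.continuous_snd
  have hd := hσ.sub h₁ hR hR₁
  obtain ⟨p', q', hd'⟩ := H2Bound.of_eHsbNorm_le hε (hd.memHsb hβ.le (by positivity)).1
    hd.continuous (le_self_add.trans h.bound)
  have hd'' := (hd'.congr_derivs hd.prim hd.prim_deriv).const_mul (-1)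
  rw [abs_neg, abs_one, one_mul] at hd''
  have e : ∀ a b : ℝ, -1 * (a - b) = b - a := fun a b => by ring
  simp only [e] at hd''
  obtain ⟨⟨r₁, hr₁, heq₁⟩, r₂, hr₂, heq₂⟩ := h.solves
  have hint := eq_internalWave hβ.le hμ hc hn hV hV0 hR₁ hR₂ h₁ h₂ (by
    filter_upwards [heq₂, hr₂.ae_unique h₂.hasWeakSecondDeriv] with x hx hx'
    rw [← hx', hx])
  refine ⟨_, _, hd'', fun x => ?_, ?_, hint⟩
  · simp only [h.even_fst x, hadm.mem.2 x]
  · rw [hint] at heq₁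
    refine (first_equation_iff (q₁ := r₁) hμ hc (hadm.solves.ae_eq hσ) ?_ ?_).1 heq₁
    · ext x; ring
    · filter_upwards [hr₁.ae_unique h₁.hasWeakSecondDeriv] with x hx
      rw [hx]; ring

/-- Existence and uniqueness of the solitary wave near `σ`. -/
theorem IsAdmissibleWith.existsUnique_solitaryWave (hμ : 0 < μ) (hc : c ≠ 0)
    (hV : ContDiff ℝ 5 V) (hV0 : deriv V 0 = 0)
    (hadm : IsAdmissibleWith (normPotential μ V) c β σ) :
    ∃ C : ℝ, 0 < C ∧ ∃ N : ℕ, 1 ≤ N ∧ ∀ n : ℕ, N ≤ n → ∃! ρ : (ℝ → ℝ) × (ℝ → ℝ),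
      IsSolitaryWave V c μ (kappa c μ n) β σ (C / n) ρ := by
  have hβ := hadm.beta_pos
  have hW : ContDiff ℝ 4 (normPotential μ V) :=
    (contDiff_const.mul hV).of_le (by norm_num)
  have hG : ContDiff ℝ 3 (deriv (normPotential μ V)) := contDiff_deriv_of_succ hW (by norm_num)
  have hG0 : deriv (normPotential μ V) 0 = 0 := by rw [deriv_normPotential]; simp [hV0]
  obtain ⟨R, σ₁, σ₂, hR, hσ⟩ := hadm.mem.1.exists_h2Bound hadm.continuous
  have hσe := hadm.mem.2
  obtain ⟨a, ha, hsol⟩ := hadm.exists_solution hW hG0 μ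
  obtain ⟨C₂, hC₂, hint⟩ := exists_internalWave_bound (R := R + a) hβ.le (by positivity) c μ hG hG0
  set B := 2 * (1 + 3 * |β| + β ^ 2) with hB
  have hB0 : 0 < B := by positivity
  set C := B * a + B * C₂ with hC
  have hC0 : 0 < C := by positivity
  obtain ⟨N, hN, hN'⟩ := hsol ((1 + 3 * |β| + β ^ 2) * (5 * (2 * Real.pi) ^ 2) * C)
  refine ⟨C, hC0, N, hN, fun n hn => ?_⟩
  have hn1 : 1 ≤ n := hN.trans hn
  have hn0 : (0 : ℝ) < n := by exact_mod_cast hn1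
  obtain ⟨⟨f, p, q, hf, hfe, hfs⟩, huniq⟩ := hN' n hn
  have han : a / n ≤ a := div_le_self ha.le (by exact_mod_cast hn1)
  have hρ₁ := hσ.add hf hR (by positivity)
  obtain ⟨p₂, q₂, hρ₂, hq₂⟩ := hint n hn1 _ _ _ (hρ₁.mono (by linarith))
  have hexist : IsSolitaryWave V c μ (kappa c μ n) β σ (C / n)
      (fun x => σ x + f x, internalWave n c μ (deriv (normPotential μ V)) fun x => σ x + f x) := by
    have hev : Function.Even fun x => σ x + f x := fun x => by simp only [hσe x, hfe x]
    refine ⟨hρ₁.continuous, hρ₂.continuous, (hρ₁.memHsb hβ.le (by positivity)).1,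
      (hρ₂.memHsb hβ.le (by positivity)).1, ⟨⟨_, hρ₁.hasWeakSecondDeriv, ?_⟩,
        ⟨_, hρ₂.hasWeakSecondDeriv, Filter.Eventually.of_forall fun x => ?_⟩⟩, hev, fun x => ?_, ?_⟩
    · exact (first_equation_iff hμ hc (hadm.solves.ae_eq hσ) rfl
        (Filter.EventuallyEq.refl _ _)).2 hfs
    · simp only
      have h1μ : 1 + μ ≠ 0 := by positivity
      rw [hq₂, kappa_eq, deriv_eq_mul_deriv_normPotential hμ V, delta_const_mul]
      field_simp
      ring
    · simp only [internalWave]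
      rw [osc_odd (fun x => by simp only [hev x])]
      ring
    · have e1 : eHsbNorm 2 β (fun x => σ x - (σ x + f x)) ≤ ENNReal.ofReal (B * (a / n)) := by
        have h1 := hf.const_mul (-1)
        rw [abs_neg, abs_one, one_mul] at h1
        have e : (fun x => σ x - (σ x + f x)) = fun x => -1 * f x := by ext x; ring
        rw [e]
        exact (h1.memHsb hβ.le (by positivity)).2
      refine (add_le_add e1 (hρ₂.memHsb hβ.le (by positivity)).2).trans (le_of_eq ?_)
      rw [← ENNReal.ofReal_add (by positivity) (by positivity), ← hB, hC]
      congr 1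
      ring
  refine ⟨_, hexist, fun ρ hρ => ?_⟩
  obtain ⟨p₁, q₁, h1, h2, h3, h4⟩ := hρ.reduce hμ hc hn1 hV hV0 hadm hR hσ (by positivity)
  obtain ⟨p₀, q₀, h1', h2', h3', h4'⟩ := hexist.reduce hμ hc hn1 hV hV0 hadm hR hσ (by positivity)
  rw [← mul_div_assoc] at h1 h1'
  have hff := huniq _ _ _ _ _ _ h1 h1' h2 h2' h3 h3'
  have hfst : ρ.1 = fun x => σ x + f x := by
    ext x
    have := congrFun hff x
    simp only at this
    linarith
  refine Prod.ext hfst ?_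
  rw [h4, hfst]

end

/-! ### Families of smooth functions with uniformly bounded derivatives -/

section

variable {ι : Type*} {β : ℝ} {k : ℕ} {u v : ι → ℝ → ℝ}

/-- The functions `u i` are smooth, and bounded uniformly in `i` in the weighted `L²` norm. -/
def L2Bounded (β : ℝ) (u : ι → ℝ → ℝ) : Prop :=
  (∀ i, ContDiff ℝ ∞ (u i)) ∧ ∃ R, 0 ≤ R ∧ ∀ i, L2Bound β R (u i)

/-- The functions `u i` are smooth, and their derivatives of order at most `k` are bounded
uniformly in `i` in the weighted `L²` norm. -/
def SobolevBounded (β : ℝ) : ℕ → (ι → ℝ → ℝ) → Prop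
  | 0, u => L2Bounded β u
  | k + 1, u => L2Bounded β u ∧ SobolevBounded β k fun i => deriv (u i)

/-- The functions `u i` are smooth, and bounded uniformly in `i`. -/
def SupBoundedZero (u : ι → ℝ → ℝ) : Prop :=
  (∀ i, ContDiff ℝ ∞ (u i)) ∧ ∃ M, 0 ≤ M ∧ ∀ i x, |u i x| ≤ M

/-- The functions `u i` are smooth, and their derivatives of order at most `k` are bounded
uniformly in `i`. -/
def SupBounded : ℕ → (ι → ℝ → ℝ) → Prop
  | 0, u => SupBoundedZero u
  | k + 1, u => SupBoundedZero u ∧ SupBounded k fun i => deriv (u i)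

theorem differentiableAt_of_contDiff_infty {f : ℝ → ℝ} (hf : ContDiff ℝ ∞ f) (x : ℝ) :
    DifferentiableAt ℝ f x :=
  (hf.differentiable (by simp)).differentiableAt

theorem isPrimitive_deriv {f : ℝ → ℝ} (hf : ContDiff ℝ ∞ f) : IsPrimitive f (deriv f) :=
  isPrimitive_of_contDiff (hf.of_le (by exact_mod_cast le_top))

namespace SobolevBounded

theorem l2Bounded (h : SobolevBounded β k u) : L2Bounded β u := by
  cases k with
  | zero => exact h
  | succ k => exact h.1

theorem contDiff (h : SobolevBounded β k u) (i : ι) : ContDiff ℝ ∞ (u i) := h.l2Bounded.1 i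

theorem of_succ (h : SobolevBounded β (k + 1) u) : SobolevBounded β k u := by
  induction k generalizing u with
  | zero => exact h.1
  | succ k ih => exact ⟨h.1, ih h.2⟩

theorem mono {m : ℕ} (h : SobolevBounded β k u) (hm : m ≤ k) : SobolevBounded β m u := by
  induction hm with
  | refl => exact h
  | step _ ih => exact ih h.of_succ

theorem add (hu : SobolevBounded β k u) (hv : SobolevBounded β k v) :
    SobolevBounded β k fun i x => u i x + v i x := by
  have h0 : ∀ {u v : ι → ℝ → ℝ}, L2Bounded β u → L2Bounded β v →
      L2Bounded β fun i x => u i x + v i x := by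
    rintro u v ⟨h, R, hR, hu⟩ ⟨h', R', hR', hv⟩
    exact ⟨fun i => (h i).add (h' i), R + R', by positivity, fun i => (hu i).add (hv i) hR hR'⟩
  induction k generalizing u v with
  | zero => exact h0 hu hv
  | succ k ih =>
    refine ⟨h0 hu.1 hv.1, ?_⟩
    convert ih hu.2 hv.2 using 3 with i x
    exact deriv_fun_add (differentiableAt_of_contDiff_infty (hu.contDiff i) _)
      (differentiableAt_of_contDiff_infty (hv.contDiff i) _)

theorem const_mul (c : ℝ) (hu : SobolevBounded β k u) :
    SobolevBounded β k fun i x => c * u i x := by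
  have h0 : ∀ {u : ι → ℝ → ℝ}, L2Bounded β u → L2Bounded β fun i x => c * u i x := by
    rintro u ⟨h, R, hR, hu⟩
    exact ⟨fun i => contDiff_const.mul (h i), |c| * R, by positivity, fun i => (hu i).const_mul c⟩
  induction k generalizing u with
  | zero => exact h0 hu
  | succ k ih =>
    refine ⟨h0 hu.1, ?_⟩
    convert ih hu.2 using 3 with i x
    exact deriv_const_mul c (differentiableAt_of_contDiff_infty (hu.contDiff i) _)

theorem sub (hu : SobolevBounded β k u) (hv : SobolevBounded β k v) :
    SobolevBounded β k fun i x => u i x - v i x := by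
  convert hu.add (hv.const_mul (-1)) using 3
  ring

/-- A family that is bounded in `L²`, with second derivatives bounded in `H^k`, is bounded in
`H^{k+2}`: the first derivatives are controlled by interpolation. -/
theorem of_second (hβ : 0 ≤ β) (hu : L2Bounded β u)
    (h : SobolevBounded β k fun i => deriv (deriv (u i))) : SobolevBounded β (k + 2) u := by
  obtain ⟨hs, R, hR, hu'⟩ := hu
  obtain ⟨-, R', hR', hq⟩ := h.l2Bounded
  exact ⟨⟨hs, R, hR, hu'⟩, ⟨fun i => contDiff_deriv_infty (hs i), _, by positivity, fun i =>
    L2Bound.deriv_of_second hβ (isPrimitive_deriv (hs i))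
      (isPrimitive_deriv (contDiff_deriv_infty (hs i))) (hu' i) (hq i) hR hR'⟩, h⟩

end SobolevBounded

namespace SupBounded

theorem supBoundedZero (h : SupBounded k u) : SupBoundedZero u := by
  cases k with
  | zero => exact h
  | succ k => exact h.1

theorem contDiff (h : SupBounded k u) (i : ι) : ContDiff ℝ ∞ (u i) := h.supBoundedZero.1 i

theorem of_succ (h : SupBounded (k + 1) u) : SupBounded k u := by
  induction k generalizing u with
  | zero => exact h.1
  | succ k ih => exact ⟨h.1, ih h.2⟩

theorem const (c : ℝ) : SupBounded k fun (_ : ι) _ => c := by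
  have h0 : ∀ c : ℝ, SupBoundedZero fun (_ : ι) (_ : ℝ) => c := fun c =>
    ⟨fun _ => contDiff_const, |c|, abs_nonneg c, fun _ _ => le_rfl⟩
  induction k generalizing c with
  | zero => exact h0 c
  | succ k ih => exact ⟨h0 c, by simpa using! ih 0⟩

theorem add (hu : SupBounded k u) (hv : SupBounded k v) :
    SupBounded k fun i x => u i x + v i x := by
  have h0 : ∀ {u v : ι → ℝ → ℝ}, SupBoundedZero u → SupBoundedZero v →
      SupBoundedZero fun i x => u i x + v i x := by
    rintro u v ⟨h, R, hR, hu⟩ ⟨h', R', hR', hv⟩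
    exact ⟨fun i => (h i).add (h' i), R + R', by positivity, fun i x =>
      (abs_add_le _ _).trans (add_le_add (hu i x) (hv i x))⟩
  induction k generalizing u v with
  | zero => exact h0 hu hv
  | succ k ih =>
    refine ⟨h0 hu.1 hv.1, ?_⟩
    convert ih hu.2 hv.2 using 3 with i x
    exact deriv_fun_add (differentiableAt_of_contDiff_infty (hu.contDiff i) _)
      (differentiableAt_of_contDiff_infty (hv.contDiff i) _)

theorem mul (hu : SupBounded k u) (hv : SupBounded k v) :
    SupBounded k fun i x => u i x * v i x := by
  have h0 : ∀ {u v : ι → ℝ → ℝ}, SupBoundedZero u → SupBoundedZero v →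
      SupBoundedZero fun i x => u i x * v i x := by
    rintro u v ⟨h, R, hR, hu⟩ ⟨h', R', hR', hv⟩
    refine ⟨fun i => (h i).mul (h' i), R * R', by positivity, fun i x => ?_⟩
    rw [abs_mul]
    exact mul_le_mul (hu i x) (hv i x) (abs_nonneg _) hR
  induction k generalizing u v with
  | zero => exact h0 hu hv
  | succ k ih =>
    refine ⟨h0 hu.1 hv.1, ?_⟩
    convert (ih hu.2 hv.of_succ).add (ih hu.of_succ hv.2) using 3 with i x
    exact deriv_fun_mul (differentiableAt_of_contDiff_infty (hu.contDiff i) _)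
      (differentiableAt_of_contDiff_infty (hv.contDiff i) _)

end SupBounded

theorem deriv_comp_left {G f : ℝ → ℝ} (hG : ContDiff ℝ ∞ G) (hf : ContDiff ℝ ∞ f) (x : ℝ) :
    deriv (fun x => G (f x)) x = deriv G (f x) * deriv f x :=
  ((differentiableAt_of_contDiff_infty hG (f x)).hasDerivAt.comp x
    (differentiableAt_of_contDiff_infty hf x).hasDerivAt).deriv

theorem SupBounded.comp_left (hu : SupBounded k u) {G : ℝ → ℝ} (hG : ContDiff ℝ ∞ G) :
    SupBounded k fun i x => G (u i x) := by
  have h0 : ∀ {u : ι → ℝ → ℝ}, SupBoundedZero u → ∀ {G : ℝ → ℝ}, ContDiff ℝ ∞ G →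
      SupBoundedZero fun i x => G (u i x) := by
    rintro u ⟨h, A, -, hu⟩ G hG
    obtain ⟨M, hM, hM'⟩ := exists_abs_le_on_Icc hG.continuous A
    exact ⟨fun i => hG.comp (h i), M, hM, fun i x => hM' _ (hu i x)⟩
  induction k generalizing G with
  | zero => exact h0 hu hG
  | succ k ih =>
    refine ⟨h0 hu.1 hG, ?_⟩
    convert (ih hu.of_succ (contDiff_deriv_infty hG)).mul hu.2 using 3 with i x
    exact deriv_comp_left hG (hu.contDiff i) _

theorem supBounded_tanh : SupBounded k fun (_ : ι) => Real.tanh := by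
  have hs : ContDiff ℝ ∞ Real.tanh := by
    have e : Real.tanh = fun x => Real.sinh x / Real.cosh x :=
      funext fun x => Real.tanh_eq_sinh_div_cosh x
    rw [e]
    exact Real.contDiff_sinh.div Real.contDiff_cosh fun x => (Real.cosh_pos x).ne'
  have h0 : SupBoundedZero fun (_ : ι) => Real.tanh :=
    ⟨fun _ => hs, 1, zero_le_one, fun _ x => (Real.abs_tanh_lt_one x).le⟩
  induction k with
  | zero => exact h0
  | succ k ih =>
    refine ⟨h0, ?_⟩
    convert (SupBounded.const 1).add ((SupBounded.const (-1)).mul (ih.mul ih)) using 3 with i x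
    rw [(hasDerivAt_tanh _).deriv]
    ring

namespace SobolevBounded

theorem bdd_mul (hu : SobolevBounded β k u) {m : ι → ℝ → ℝ} (hm : SupBounded k m) :
    SobolevBounded β k fun i x => m i x * u i x := by
  have h0 : ∀ {u m : ι → ℝ → ℝ}, L2Bounded β u → SupBoundedZero m →
      L2Bounded β fun i x => m i x * u i x := by
    rintro u m ⟨h, R, hR, hu⟩ ⟨h', M, hM, hm⟩
    exact ⟨fun i => (h' i).mul (h i), M * R, by positivity, fun i =>
      (hu i).bdd_mul (h' i).continuous.aestronglyMeasurable (hm i)⟩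
  induction k generalizing u m with
  | zero => exact h0 hu hm
  | succ k ih =>
    refine ⟨h0 hu.1 hm.1, ?_⟩
    convert (ih hu.of_succ hm.2).add (ih hu.2 hm.of_succ) using 3 with i x
    exact deriv_fun_mul (differentiableAt_of_contDiff_infty (hm.contDiff i) _)
      (differentiableAt_of_contDiff_infty (hu.contDiff i) _)

theorem supBounded (hβ : 0 ≤ β) (hu : SobolevBounded β (k + 1) u) : SupBounded k u := by
  have h0 : ∀ {u : ι → ℝ → ℝ}, SobolevBounded β 1 u → SupBoundedZero u := by
    rintro u ⟨⟨h, R, hR, hu⟩, -, R', hR', hu'⟩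
    exact ⟨h, _, by positivity, fun i x =>
      (hu i).abs_le hβ (isPrimitive_deriv (h i)) (hu' i) hR hR' x⟩
  induction k generalizing u with
  | zero => exact h0 hu
  | succ k ih => exact ⟨h0 (hu.mono (by omega)), ih hu.2⟩

/-- Composition with a smooth function that vanishes at `0`. -/
theorem comp_left (hβ : 0 ≤ β) (hu : SobolevBounded β k u) (hA : SupBoundedZero u) {G : ℝ → ℝ}
    (hG : ContDiff ℝ ∞ G) (hG0 : G 0 = 0) : SobolevBounded β k fun i x => G (u i x) := by
  have h0 : L2Bounded β fun i x => G (u i x) := by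
    obtain ⟨h, A, hA0, hA⟩ := hA
    obtain ⟨-, R, hR, hu⟩ := hu.l2Bounded
    obtain ⟨M, hM, hM'⟩ := exists_abs_le_on_Icc (contDiff_deriv_infty hG).continuous A
    refine ⟨fun i => hG.comp (h i), |M| * R, by positivity, fun i => ((hu i).const_mul M).of_norm_le
      (hG.comp (h i)).continuous.aestronglyMeasurable (Filter.Eventually.of_forall fun x => ?_)⟩
    have := abs_sub_le_of_abs_deriv_le (hG.differentiable (by simp)) hM' (hA i x)
      (show |(0 : ℝ)| ≤ A by simpa using hA0)
    rw [abs_mul, abs_of_nonneg hM]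
    simpa [hG0] using this
  cases k with
  | zero => exact h0
  | succ k =>
    refine ⟨h0, ?_⟩
    convert hu.2.bdd_mul ((hu.supBounded hβ).comp_left (contDiff_deriv_infty hG)) using 3 with i x
    exact deriv_comp_left hG (hu.contDiff i) _

/-- If the differences `a i * (u i - v i)` are bounded in `H^k`, then so are the differences
`a i * (G (u i) - G (v i))`. -/
theorem comp_sub_comp {a : ι → ℝ} (h : SobolevBounded β k fun i x => a i * (u i x - v i x))
    (hu : SupBounded k u) (hv : SupBounded k v) {G : ℝ → ℝ} (hG : ContDiff ℝ ∞ G) :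
    SobolevBounded β k fun i x => a i * (G (u i x) - G (v i x)) := by
  have h0 : ∀ {G : ℝ → ℝ}, ContDiff ℝ ∞ G → L2Bounded β (fun i x => a i * (u i x - v i x)) →
      SupBoundedZero u → SupBoundedZero v →
      L2Bounded β fun i x => a i * (G (u i x) - G (v i x)) := by
    rintro G hG ⟨-, R, hR, h⟩ ⟨hu, A, hA, hA'⟩ ⟨hv, B, hB, hB'⟩
    obtain ⟨M, hM, hM'⟩ := exists_abs_le_on_Icc (contDiff_deriv_infty hG).continuous (A + B)
    have hs : ∀ i, ContDiff ℝ ∞ fun x => a i * (G (u i x) - G (v i x)) := fun i =>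
      contDiff_const.mul ((hG.comp (hu i)).sub (hG.comp (hv i)))
    refine ⟨hs, |M| * R, by positivity, fun i => ((h i).const_mul M).of_norm_le
      (hs i).continuous.aestronglyMeasurable (Filter.Eventually.of_forall fun x => ?_)⟩
    have := abs_sub_le_of_abs_deriv_le (hG.differentiable (by simp)) hM'
      ((hA' i x).trans (by linarith)) ((hB' i x).trans (by linarith))
    rw [abs_mul, abs_mul, abs_mul, abs_of_nonneg hM]
    nlinarith [abs_nonneg (a i)]
  induction k generalizing G with
  | zero => exact h0 hG h hu hv
  | succ k ih =>
    refine ⟨h0 hG h.1 hu.1 hv.1, ?_⟩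
    have h' := contDiff_deriv_infty hG
    have hd : SobolevBounded β k fun i x => a i * (deriv (u i) x - deriv (v i) x) := by
      convert h.2 using 3 with i x
      rw [deriv_const_mul, deriv_fun_sub]
      exacts [differentiableAt_of_contDiff_infty (hu.contDiff i) _,
        differentiableAt_of_contDiff_infty (hv.contDiff i) _,
        differentiableAt_of_contDiff_infty ((hu.contDiff i).sub (hv.contDiff i)) _]
    convert ((ih h.of_succ hu.of_succ hv.of_succ h').bdd_mul hu.2).add
      (hd.bdd_mul (hv.of_succ.comp_left h')) using 3 with i x
    rw [deriv_const_mul, deriv_fun_sub, deriv_comp_left hG (hu.contDiff i),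
      deriv_comp_left hG (hv.contDiff i)]
    · ring
    exacts [differentiableAt_of_contDiff_infty (hG.comp (hu.contDiff i)) _,
      differentiableAt_of_contDiff_infty (hG.comp (hv.contDiff i)) _,
      differentiableAt_of_contDiff_infty ((hG.comp (hu.contDiff i)).sub
        (hG.comp (hv.contDiff i))) _]

end SobolevBounded

/-! ### The operators `δ` and `S` on smooth families -/

theorem contDiff_delta {m : ℕ∞ω} {f : ℝ → ℝ} (hf : ContDiff ℝ m f) : ContDiff ℝ m (delta f) :=
  (hf.comp (contDiff_id.add contDiff_const)).sub (hf.comp (contDiff_id.sub contDiff_const))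

theorem deriv_delta {f : ℝ → ℝ} (hf : Differentiable ℝ f) : deriv (delta f) = delta (deriv f) := by
  ext x
  refine HasDerivAt.deriv (HasDerivAt.sub ?_ ?_)
  · exact (hf _).hasDerivAt.comp_add_const x _
  · exact (hf _).hasDerivAt.comp_sub_const x _

theorem SobolevBounded.delta (hβ : 0 ≤ β) (hu : SobolevBounded β k u) :
    SobolevBounded β k fun i => delta (u i) := by
  have h0 : ∀ {u : ι → ℝ → ℝ}, L2Bounded β u → L2Bounded β fun i => MassInMass.delta (u i) := by
    rintro u ⟨h, R, hR, hu⟩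
    exact ⟨fun i => contDiff_delta (h i), _, mul_nonneg (deltaConst_pos β).le hR, fun i =>
      (hu i).delta hβ hR⟩
  induction k generalizing u with
  | zero => exact h0 hu
  | succ k ih =>
    refine ⟨h0 hu.1, ?_⟩
    convert ih hu.2 using 3 with i
    exact deriv_delta ((hu.contDiff i).differentiable (by simp))

theorem deriv_osc {n : ℕ} (hn : 1 ≤ n) {f : ℝ → ℝ} (hf : ContDiff ℝ 1 f) :
    deriv (osc n f) = osc n (deriv f) := by
  rw [osc_deriv_eq hn (isPrimitive_of_contDiff hf)]
  exact funext fun x => (hasDerivAt_osc hn hf.continuous x).deriv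

theorem contDiff_osc {n : ℕ} (hn : 1 ≤ n) (m : ℕ) {f : ℝ → ℝ} (hf : ContDiff ℝ m f) :
    ContDiff ℝ m (osc n f) := by
  induction m generalizing f with
  | zero =>
    have := hf.continuous
    exact contDiff_zero.2 (continuous_osc hn this)
  | succ m ih =>
    have hf1 : ContDiff ℝ 1 f := hf.of_le (by exact_mod_cast Nat.le_add_left 1 m)
    rw [Nat.cast_succ, contDiff_succ_iff_deriv]
    refine ⟨fun x => (hasDerivAt_osc hn hf.continuous x).differentiableAt, by simp, ?_⟩
    rw [deriv_osc hn hf1]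
    exact ih (contDiff_deriv_of_succ hf (by simp))

theorem contDiff_osc_infty {n : ℕ} (hn : 1 ≤ n) {f : ℝ → ℝ} (hf : ContDiff ℝ ∞ f) :
    ContDiff ℝ ∞ (osc n f) :=
  contDiff_infty.2 fun m => contDiff_osc hn m (contDiff_infty.1 hf m)

theorem SobolevBounded.osc (hβ : 0 ≤ β) {n : ι → ℕ} (hn : ∀ i, 1 ≤ n i)
    (hu : SobolevBounded β k u) : SobolevBounded β k fun i => osc (n i) (u i) := by
  have h0 : ∀ {u : ι → ℝ → ℝ}, L2Bounded β u → L2Bounded β fun i => MassInMass.osc (n i) (u i) := by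
    rintro u ⟨h, R, hR, hu⟩
    refine ⟨fun i => contDiff_osc_infty (hn i) (h i), Real.exp (β / 2) * R, by positivity, fun i =>
      ((hu i).osc hβ (hn i) (contDiff_osc_infty (hn i)
        (h i)).continuous.aestronglyMeasurable).mono (div_le_self (by positivity) ?_)⟩
    exact le_trans (by exact_mod_cast hn i) (natCast_le_freq (n i))
  induction k generalizing u with
  | zero => exact h0 hu
  | succ k ih =>
    refine ⟨h0 hu.1, ?_⟩
    convert ih hu.2 using 3 with i
    exact deriv_osc (hn i) ((hu.contDiff i).of_le (by exact_mod_cast le_top))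

/-- `S` gains one derivative uniformly in `n`. -/
theorem SobolevBounded.osc_deriv (hβ : 0 ≤ β) {n : ι → ℕ} (hn : ∀ i, 1 ≤ n i)
    (hu : SobolevBounded β k u) : SobolevBounded β k fun i => MassInMass.osc (n i) (deriv (u i)) := by
  have h0 : ∀ {u : ι → ℝ → ℝ}, L2Bounded β u →
      L2Bounded β fun i => MassInMass.osc (n i) (deriv (u i)) := by
    rintro u ⟨h, R, hR, hu⟩
    have hs : ∀ i, ContDiff ℝ ∞ (MassInMass.osc (n i) (deriv (u i))) := fun i =>
      contDiff_osc_infty (hn i) (contDiff_deriv_infty (h i))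
    refine ⟨hs, Real.exp (β / 2) * R, by positivity, fun i => ?_⟩
    have hm := (hs i).continuous.aestronglyMeasurable (μ := volume)
    beta_reduce
    rw [osc_deriv_eq (hn i) (isPrimitive_deriv (h i))] at hm ⊢
    exact (hu i).oscDeriv hβ hm
  induction k generalizing u with
  | zero => exact h0 hu
  | succ k ih =>
    refine ⟨h0 hu.1, ?_⟩
    convert ih hu.2 using 3 with i
    exact deriv_osc (hn i) ((contDiff_deriv_infty (hu.contDiff i)).of_le (by exact_mod_cast le_top))

/-- On smooth functions `S = O(1/n²)`, because `ω² S u = δu - S u''`. -/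
theorem SobolevBounded.sq_mul_osc (hβ : 0 ≤ β) {n : ι → ℕ} (hn : ∀ i, 1 ≤ n i)
    (hu : SobolevBounded β (k + 2) u) :
    SobolevBounded β k fun i x => (n i : ℝ) ^ 2 * MassInMass.osc (n i) (u i) x := by
  have h := ((hu.mono (Nat.le_add_right k 2)).delta hβ).sub (hu.2.2.osc hβ hn)
  convert h.const_mul ((2 * Real.pi) ^ 2)⁻¹ using 3 with i x
  have hs := hu.contDiff i
  rw [osc_second_eq (hn i) (isPrimitive_deriv hs) (isPrimitive_deriv (contDiff_deriv_infty hs)),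
    freq]
  field_simp
  ring

/-! ### From bounds on derivatives to Sobolev norms -/

theorem SobolevBounded.weight_zero (hβ : 0 ≤ β) (hu : SobolevBounded β k u) :
    SobolevBounded 0 k u := by
  have h0 : ∀ {u : ι → ℝ → ℝ}, L2Bounded β u → L2Bounded 0 u := by
    rintro u ⟨h, R, hR, hu⟩
    refine ⟨h, 1 * R, by positivity, fun i => ?_⟩
    simpa using (hu i).weight_mul (b := 0) (m := fun _ => 1) aestronglyMeasurable_const zero_le_one
      fun x => by simpa using one_le_weight hβ x
  induction k generalizing u with
  | zero => exact h0 hu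
  | succ k ih => exact ⟨h0 hu.1, ih hu.2⟩

theorem SobolevBounded.coshWeight (hu : SobolevBounded β k u) :
    SobolevBounded 0 k fun i => coshWeight β (u i) := by
  have hw : ContDiff ℝ ∞ fun x => Real.cosh x ^ β :=
    Real.contDiff_cosh.rpow_const_of_ne fun x => (Real.cosh_pos x).ne'
  have h0 : ∀ {u : ι → ℝ → ℝ}, L2Bounded β u →
      L2Bounded 0 fun i => MassInMass.coshWeight β (u i) := by
    rintro u ⟨h, R, hR, hu⟩
    refine ⟨fun i => hw.mul (h i), 1 * R, by positivity, fun i => ?_⟩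
    exact (hu i).weight_mul hw.continuous.aestronglyMeasurable zero_le_one fun x => by
      simp [abs_of_pos (weight_pos β x)]
  induction k generalizing u with
  | zero => exact h0 hu
  | succ k ih =>
    refine ⟨h0 hu.1, ?_⟩
    convert ih ((hu.of_succ.bdd_mul
      ((SupBounded.const β).mul supBounded_tanh)).add hu.2) using 3 with i
    ext x
    refine (((hasDerivAt_weight β x).mul (differentiableAt_of_contDiff_infty
      (hu.contDiff i) x).hasDerivAt).congr_deriv ?_).deriv
    simp only [MassInMass.coshWeight]
    ring

theorem SobolevBounded.exists_eHsNorm_le {m : ℕ} (hu : SobolevBounded 0 (2 * m) u) :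
    ∃ K : ℝ, 0 ≤ K ∧ ∀ i, eHsNorm (2 * m) (u i) ≤ ENNReal.ofReal K := by
  have hL : ∀ {u : ι → ℝ → ℝ}, L2Bounded 0 u → ∀ i, MemLp (u i) 2 := by
    rintro u ⟨-, R, -, hu⟩ i
    exact (hu i).memLp le_rfl
  induction m generalizing u with
  | zero =>
    obtain ⟨-, R, hR, h⟩ := hu.l2Bounded
    refine ⟨R, hR, fun i => ?_⟩
    rw [Nat.cast_zero, mul_zero, eHsNorm_zero ((h i).memLp le_rfl)]
    simpa using (h i).le
  | succ m ih =>
    obtain ⟨K, hK, h⟩ := ih (hu.mono (by omega))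
    have h2 : SobolevBounded 0 (2 * m) fun i => deriv (deriv (u i)) := hu.2.2
    obtain ⟨K', hK', h'⟩ := ih h2
    refine ⟨K + K', by positivity, fun i => ?_⟩
    have hs := hu.contDiff i
    rw [Nat.cast_succ, mul_add, mul_one, ENNReal.ofReal_add hK hK']
    exact (eHsNorm_add_two_le _ (isPrimitive_deriv hs) (isPrimitive_deriv (contDiff_deriv_infty hs))
      (hL hu.1 i) (hL hu.2.1 i) (hL h2.l2Bounded i)).trans (add_le_add (h i) (h' i))

/-- A family that is bounded in the integer order spaces is bounded in `H^s_β` for real `s`. -/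
theorem SobolevBounded.exists_eHsbNorm_le (hβ : 0 ≤ β) (hu : ∀ k, SobolevBounded β k u) {s : ℝ}
    (hs : 0 ≤ s) :
    ∃ K : ℝ, 0 ≤ K ∧ ∀ i, MemHsb s β (u i) ∧ eHsbNorm s β (u i) ≤ ENNReal.ofReal K := by
  obtain ⟨m, hm⟩ := exists_nat_ge s
  have hsm : s ≤ 2 * m := by linarith
  obtain ⟨K₀, -, h₀⟩ := ((hu (2 * m)).weight_zero hβ).exists_eHsNorm_le
  obtain ⟨K, hK, h⟩ := (hu (2 * m)).coshWeight.exists_eHsNorm_le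
  have hle := fun i => (eHsNorm_mono hsm (u i)).trans (h₀ i)
  have hle' := fun i => (eHsNorm_mono hsm (MassInMass.coshWeight β (u i))).trans (h i)
  refine ⟨K, hK, fun i => ⟨⟨?_, ?_⟩, hle' i⟩⟩
  · exact (memHs_iff s hs _).2 ((hle i).trans_lt ENNReal.ofReal_lt_top)
  · exact (memHs_iff s hs _).2 ((hle' i).trans_lt ENNReal.ofReal_lt_top)

end

/-! ### Smooth solitary waves -/

section

variable {ι : Type*} {β R c μ : ℝ} {σ σ₁ σ₂ f p q ρ : ℝ → ℝ} {G V : ℝ → ℝ}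

/-- The right-hand side of the equation for `c² ρ''`, with the internal wave eliminated. For `μ = 0`
this is the right-hand side of the monatomic equation. -/
def travelingForce (n : ℕ) (μ : ℝ) (G ρ : ℝ → ℝ) (x : ℝ) : ℝ :=
  delta (delta fun y => G (ρ y)) x +
    μ * delta (fun y => delta (fun z => G (ρ z)) y - freq n ^ 2 * osc n (fun z => G (ρ z)) y) x

theorem SolvesLinearized.travelingForce_eq {W : ℝ → ℝ} {n : ℕ} (hσ : ∀ᵐ x, c ^ 2 * σ₂ x -
      delta (delta fun y => deriv W (σ y)) x = 0)
    (h : SolvesLinearized W c σ f q (Theta n μ (deriv W) σ f)) :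
    ∀ᵐ x, c ^ 2 * (σ₂ x + q x) = travelingForce n μ (deriv W) (fun x => σ x + f x) x := by
  filter_upwards [hσ, h] with x h1 h2
  simp only [travelingForce, delta, Theta, taylorRem] at h1 h2 ⊢
  linear_combination h1 - h2

theorem contDiff_travelingForce {n : ℕ} (hn : 1 ≤ n) (m : ℕ) (hG : ContDiff ℝ ∞ G)
    (hρ : ContDiff ℝ m ρ) : ContDiff ℝ m (travelingForce n μ G ρ) := by
  have h : ContDiff ℝ m fun y => G (ρ y) := (contDiff_infty.1 hG m).comp hρ
  exact (contDiff_delta (contDiff_delta h)).add (contDiff_const.mul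
    (contDiff_delta ((contDiff_delta h).sub (contDiff_const.mul (contDiff_osc hn m h)))))

/-- Regularity: the traveling wave equation expresses `ρ''` by terms that are as smooth as `ρ`. -/
theorem contDiff_of_travelingForce_eq {n : ℕ} (hc : c ≠ 0) (hn : 1 ≤ n) (hG : ContDiff ℝ ∞ G)
    (hρ : IsPrimitive ρ p) (hp : IsPrimitive p q)
    (heq : ∀ᵐ x, c ^ 2 * q x = travelingForce n μ G ρ x) :
    ContDiff ℝ ∞ ρ ∧ ∀ x, deriv (deriv ρ) x = (c ^ 2)⁻¹ * travelingForce n μ G ρ x := by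
  set F : ℝ → ℝ := fun x => (c ^ 2)⁻¹ * travelingForce n μ G ρ x with hF
  have hFs : ∀ m : ℕ, ContDiff ℝ m ρ → ContDiff ℝ m F := fun m h =>
    contDiff_const.mul (contDiff_travelingForce hn m hG h)
  have hpF : IsPrimitive p F := hp.congr_right (by
    filter_upwards [heq] with x hx
    simp only [hF]
    rw [← hx]
    field_simp)
  have hρ' : ∀ x, HasDerivAt ρ (p x) x := hρ.hasDerivAt hp.continuous
  have hp' : ∀ x, HasDerivAt p (F x) x :=
    hpF.hasDerivAt (hFs 0 (contDiff_zero.2 hρ.continuous)).continuous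
  have e1 : deriv ρ = p := funext fun x => (hρ' x).deriv
  have e2 : deriv p = F := funext fun x => (hp' x).deriv
  refine ⟨contDiff_infty.2 fun m => ?_, fun x => by rw [e1, e2]⟩
  induction m with
  | zero => exact contDiff_zero.2 hρ.continuous
  | succ m ih =>
    rw [Nat.cast_succ, contDiff_succ_iff_deriv, e1]
    refine ⟨fun x => (hρ' x).differentiableAt, by simp, ?_⟩
    have h1 : ContDiff ℝ (m + 1) p := by
      rw [contDiff_succ_iff_deriv, e2]
      exact ⟨fun x => (hp' x).differentiableAt, by simp, hFs m ih⟩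
    exact h1.of_le (by norm_cast; omega)

theorem sobolevBounded_one {u : ι → ℝ → ℝ} (hR : 0 ≤ R) (hs : ∀ i, ContDiff ℝ ∞ (u i))
    (h : ∀ i, ∃ p q, H2Bound β R (u i) p q) : SobolevBounded β 1 u := by
  refine ⟨⟨hs, R, hR, fun i => ?_⟩, fun i => contDiff_deriv_infty (hs i), R, hR, fun i => ?_⟩ <;>
    obtain ⟨p, q, h⟩ := h i
  · exact h.bound
  · beta_reduce
    rw [show deriv (u i) = p from funext fun x => (h.hasDerivAt x).deriv]
    exact h.bound_deriv

/-- `(S h)'' = δh - ω² S h` is `S h''` for smooth `h`. -/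
theorem osc_deriv_deriv {n : ℕ} (hn : 1 ≤ n) {h : ℝ → ℝ} (hh : ContDiff ℝ ∞ h) :
    osc n (deriv (deriv h)) = fun x => delta h x - freq n ^ 2 * osc n h x :=
  funext (osc_second_eq hn (isPrimitive_deriv hh) (isPrimitive_deriv (contDiff_deriv_infty hh)))

/-- Bootstrapping: solutions that are bounded in `H¹_β`, uniformly in `n`, are bounded in all
`H^k_β`. The force involves no more than one derivative of `ρ`, since `S` gains one. -/
theorem sobolevBounded_of_travelingForce_eq (hβ : 0 ≤ β) {n : ι → ℕ} (hn : ∀ i, 1 ≤ n i)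
    (hG : ContDiff ℝ ∞ G) (hG0 : G 0 = 0) {u : ι → ℝ → ℝ}
    (heq : ∀ i x, deriv (deriv (u i)) x = (c ^ 2)⁻¹ * travelingForce (n i) μ G (u i) x)
    (hu : SobolevBounded β 1 u) (k : ℕ) : SobolevBounded β k u := by
  have h0 : SupBoundedZero u := hu.supBounded (k := 0) hβ
  suffices h : ∀ k, SobolevBounded β (k + 1) u from (h k).of_succ
  intro k
  induction k with
  | zero => exact hu
  | succ k ih =>
    have hH := ih.comp_left hβ h0 hG hG0
    refine SobolevBounded.of_second (k := k) hβ ih.1 ?_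
    have hS := ((hH.2.osc_deriv hβ hn).delta hβ).const_mul μ
    convert ((((hH.of_succ.delta hβ).delta hβ).add hS).const_mul (c ^ 2)⁻¹) using 3 with i x
    rw [heq, travelingForce]
    beta_reduce
    rw [osc_deriv_deriv (hn i) (hH.contDiff i)]

theorem eHsNorm_const_mul (s a : ℝ) {f : ℝ → ℝ} (hf : MemLp f 2) :
    eHsNorm s (fun x => a * f x) = ENNReal.ofReal |a| * eHsNorm s f := by
  have h : MemLp (fun x => (f x : ℂ)) 2 (volume : Measure ℝ) := hf.ofReal
  have h' : MemLp (fun x => ((a * f x : ℝ) : ℂ)) 2 (volume : Measure ℝ) := (hf.const_mul a).ofReal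
  rw [eHsNorm_eq s h, eHsNorm_eq s h', ← Real.norm_eq_abs, ← Complex.norm_real, ofReal_norm,
    ← eLpNorm_const_smul]
  have e : h'.toLp (fun x => ((a * f x : ℝ) : ℂ)) = (a : ℂ) • h.toLp (fun x => (f x : ℂ)) := by
    rw [← MemLp.toLp_const_smul]
    congr 1
    ext x
    simp
  rw [e, FourierTransform.fourier_smul]
  refine eLpNorm_congr_ae ?_
  filter_upwards [Lp.coeFn_smul (a : ℂ) (𝓕 (h.toLp fun x => (f x : ℂ)))] with x hx
  rw [hx]
  simp
  ring

/-- A family is `O(a⁻¹)` in `H^s_β` if its product with `a` is bounded. -/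
theorem SobolevBounded.exists_eHsbNorm_le_div (hβ : 0 ≤ β) {a : ι → ℝ} (ha : ∀ i, 0 < a i)
    {u : ι → ℝ → ℝ} (hu : ∀ k, SobolevBounded β k fun i x => a i * u i x) {s : ℝ} (hs : 0 ≤ s) :
    ∃ K : ℝ, 0 ≤ K ∧ ∀ i, eHsbNorm s β (u i) ≤ ENNReal.ofReal (K / a i) := by
  obtain ⟨K, hK, h⟩ := SobolevBounded.exists_eHsbNorm_le hβ hu hs
  refine ⟨K, hK, fun i => ?_⟩
  have h1 : MassInMass.coshWeight β (u i) =
      fun x => (a i)⁻¹ * MassInMass.coshWeight β (fun x => a i * u i x) x := by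
    ext x
    have := (ha i).ne'
    simp only [MassInMass.coshWeight]
    field_simp
  rw [eHsbNorm, h1, eHsNorm_const_mul _ _ (h i).1.2.memLp, abs_of_pos (inv_pos.2 (ha i)),
    div_eq_inv_mul, ENNReal.ofReal_mul (inv_pos.2 (ha i)).le]
  gcongr
  exact (h i).2

/-- For smooth `V`, the solitary waves near `(σ, 0)` are smooth, and they are `O(1/n²)` close to
`(σ, 0)` in every `H^k_β`. -/
theorem IsAdmissibleWith.smooth_solitaryWaves (hμ : 0 < μ) (hc : c ≠ 0)
    (hV : ContDiff ℝ ∞ V) (hV0 : deriv V 0 = 0)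
    (hadm : IsAdmissibleWith (normPotential μ V) c β σ) {C : ℝ} (hC : 0 ≤ C) {n : ι → ℕ}
    (hn : ∀ i, 1 ≤ n i) {ρ : ι → (ℝ → ℝ) × (ℝ → ℝ)}
    (hρ : ∀ i, IsSolitaryWave V c μ (kappa c μ (n i)) β σ (C / n i) (ρ i)) :
    (∀ i, ContDiff ℝ ∞ (ρ i).1 ∧ ContDiff ℝ ∞ (ρ i).2) ∧
      ∀ k, SobolevBounded β k (fun i => (ρ i).1) ∧ SobolevBounded β k (fun i => (ρ i).2) ∧
        SobolevBounded β k (fun i x => (n i : ℝ) ^ 2 * (σ x - (ρ i).1 x)) ∧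
        SobolevBounded β k (fun i x => (n i : ℝ) ^ 2 * (ρ i).2 x) := by
  have hβ := hadm.beta_pos
  have hW : ContDiff ℝ ∞ (normPotential μ V) := contDiff_const.mul hV
  set G := deriv (normPotential μ V) with hGdef
  have hG : ContDiff ℝ ∞ G := contDiff_deriv_infty hW
  have hG0 : G 0 = 0 := by rw [hGdef, deriv_normPotential]; simp [hV0]
  have hn0 : ∀ i, (0 : ℝ) < n i := fun i => by exact_mod_cast hn i
  have hn2 : ∀ i, (0 : ℝ) < (n i : ℝ) ^ 2 := fun i => pow_pos (hn0 i) 2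
  obtain ⟨R, σ₁, σ₂, hR, hσ⟩ := hadm.mem.1.exists_h2Bound hadm.continuous
  have hσe := hadm.solves.ae_eq hσ
  obtain ⟨hσs, hσeq⟩ := contDiff_of_travelingForce_eq (n := 1) (μ := 0) hc le_rfl hG hσ.prim
    hσ.prim_deriv (by
      filter_upwards [hσe] with x hx
      simp only [travelingForce, zero_mul, add_zero]
      exact sub_eq_zero.1 hx)
  have hσb : ∀ k, SobolevBounded β k fun _ : ι => σ :=
    sobolevBounded_of_travelingForce_eq hβ.le (n := fun _ => 1) (fun _ => le_rfl) hG hG0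
      (fun _ => hσeq) (sobolevBounded_one hR (fun _ => hσs) fun _ => ⟨_, _, hσ⟩)
  set A := (1 + 3 * |β| + β ^ 2) * (5 * (2 * Real.pi) ^ 2) * C with hAdef
  have hA : 0 ≤ A := by positivity
  have hred : ∀ i, ∃ p q, H2Bound β (A / n i) (fun x => (ρ i).1 x - σ x) p q ∧
      Function.Even (fun x => (ρ i).1 x - σ x) ∧
      SolvesLinearized (normPotential μ V) c σ (fun x => (ρ i).1 x - σ x) q
        (Theta (n i) μ G σ fun x => (ρ i).1 x - σ x) ∧
      (ρ i).2 = internalWave (n i) c μ G (ρ i).1 := fun i => by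
    have h := (hρ i).reduce hμ hc (hn i) (by exact_mod_cast contDiff_infty.1 hV 5) hV0 hadm hR hσ
      (by positivity)
    rwa [← mul_div_assoc] at h
  choose p q hf hfe hfs hint using hred
  have hsum : ∀ i, H2Bound β (R + A) (ρ i).1 (fun x => σ₁ x + p i x) (fun x => σ₂ x + q i x) :=
    fun i => by
      have h := (hσ.add (hf i) hR (by positivity)).mono (R' := R + A)
        (by gcongr; exact div_le_self hA (by exact_mod_cast hn i))
      simpa only [add_sub_cancel] using h
  have hreg : ∀ i, ContDiff ℝ ∞ (ρ i).1 ∧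
      ∀ x, deriv (deriv (ρ i).1) x = (c ^ 2)⁻¹ * travelingForce (n i) μ G (ρ i).1 x := fun i =>
    contDiff_of_travelingForce_eq hc (hn i) hG (hsum i).prim (hsum i).prim_deriv (by
      simpa only [add_sub_cancel] using (hfs i).travelingForce_eq hσe)
  have hρb : ∀ k, SobolevBounded β k fun i => (ρ i).1 :=
    sobolevBounded_of_travelingForce_eq hβ.le hn hG hG0 (fun i => (hreg i).2)
      (sobolevBounded_one (by positivity) (fun i => (hreg i).1) fun i => ⟨_, _, hsum i⟩)
  have hHb : ∀ k, SobolevBounded β k fun i x => G ((ρ i).1 x) := fun k =>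
    (hρb k).comp_left hβ.le ((hρb 1).supBounded (k := 0) hβ.le) hG hG0
  -- The term `S H''` of the equation is `O(1/n²)` in all norms.
  have hSb : ∀ k, SobolevBounded β k fun i x =>
      (n i : ℝ) ^ 2 * osc (n i) (deriv (deriv fun x => G ((ρ i).1 x))) x := fun k =>
    (hHb (k + 4)).2.2.sq_mul_osc hβ.le hn
  have hint' : ∀ i x, (ρ i).2 x =
      -((1 + μ) / c ^ 2) * osc (n i) (fun x => G ((ρ i).1 x)) x := fun i x => by
    rw [hint i]; rfl
  have hρ₂b : ∀ k, SobolevBounded β k fun i => (ρ i).2 := fun k => by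
    convert ((hHb k).osc hβ.le hn).const_mul (-((1 + μ) / c ^ 2)) using 3 with i x
    exact hint' _ _
  have hρ₂b' : ∀ k, SobolevBounded β k fun i x => (n i : ℝ) ^ 2 * (ρ i).2 x := fun k => by
    convert ((hHb (k + 2)).sq_mul_osc hβ.le hn).const_mul (-((1 + μ) / c ^ 2)) using 3 with i x
    rw [hint']
    ring
  -- The bounded inverse of `ℋ` turns `Θ = O(1/n²)` into `ρ₁ - σ = O(1/n²)` in `H²_β`.
  have hbase : SobolevBounded β 1 fun i x => (n i : ℝ) ^ 2 * ((ρ i).1 x - σ x) := by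
    obtain ⟨K, hK, -, hprior⟩ := hadm.exists_inverse
    obtain ⟨-, T, hT, hST⟩ := hSb 0
    set S := Real.exp (β / 2) * 2 with hS
    have hG3 : ContDiff ℝ 3 G := by exact_mod_cast contDiff_infty.1 hG 3
    obtain ⟨M, hM⟩ := exists_localBounds hG3 (S * R + S * A)
    have hM0 := hM.nonneg
    have hS0 : 0 < S := by positivity
    set B := deltaConst β * (M * (S * A) * A) + |μ| * T with hB
    have hB0 : 0 ≤ B := add_nonneg (mul_nonneg (deltaConst_pos β).le (by positivity))
      (by positivity)
    have hfin : ∀ i, H2Bound β (K * (B / (n i : ℝ) ^ 2)) (fun x => (ρ i).1 x - σ x) (p i) (q i) := by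
      intro i
      refine hprior _ _ _ _ _ (A / n i) (by positivity) (by positivity)
        (Theta_odd μ hadm.mem.2 (hfe i)) ?_ (hf i) (hfe i) (hfs i)
      have hAn : A / n i ≤ A := div_le_self hA (by exact_mod_cast hn i)
      have hAn0 : 0 ≤ A / n i := by positivity
      have t1 : L2Bound β (M * (S * (A / n i)) * (A / n i))
          (taylorRem G σ fun x => (ρ i).1 x - σ x) := by
        have := (hf i).bound.const_mul (M * (S * (A / n i)))
        rw [abs_of_nonneg (by positivity)] at this
        refine this.of_norm_le (continuous_taylorRem (hG3.of_le (by norm_num)) hσ.continuous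
          (hf i).continuous).aestronglyMeasurable (Filter.Eventually.of_forall fun x => ?_)
        rw [abs_mul, abs_of_nonneg (show 0 ≤ M * (S * (A / n i)) by positivity)]
        have h := taylorRem_lipschitz (f := fun x => (ρ i).1 x - σ x) (f' := fun _ => 0)
          (r := S * (A / n i)) (x := x) (hG3.differentiable (by norm_num)) hM
          (add_le_add (hσ.abs_le hβ.le hR x) (by gcongr))
          ((hf i).abs_le hβ.le hAn0 x) (by rw [abs_zero]; positivity)
        simpa [taylorRem] using h
      have t2 := t1.delta hβ.le (by positivity)
      have t3 := (hST i).const_mul (μ * ((n i : ℝ) ^ 2)⁻¹)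
      have t4 := t2.add t3 (mul_nonneg (deltaConst_pos β).le (by positivity)) (by positivity)
      refine (t4.mono (le_of_eq ?_)).congr (Filter.Eventually.of_forall fun x => ?_)
      · rw [abs_mul, abs_of_pos (inv_pos.2 (hn2 i)), hB]
        have := (hn0 i).ne'
        field_simp
      · have := (hn0 i).ne'
        simp only [Theta, osc_deriv_deriv (hn i) ((hHb 0).contDiff i), add_sub_cancel]
        field_simp
    refine sobolevBounded_one (R := K * B) (by positivity)
      (fun i => contDiff_const.mul ((hreg i).1.sub hσs)) fun i =>
        ⟨_, _, ((hfin i).const_mul ((n i : ℝ) ^ 2)).mono (le_of_eq ?_)⟩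
    have := (hn0 i).ne'
    rw [abs_of_pos (hn2 i)]
    field_simp
  have hall : ∀ k, SobolevBounded β k fun i x => (n i : ℝ) ^ 2 * ((ρ i).1 x - σ x) := by
    suffices h : ∀ k, SobolevBounded β (k + 1) fun i x => (n i : ℝ) ^ 2 * ((ρ i).1 x - σ x) from
      fun k => (h k).of_succ
    intro k
    induction k with
    | zero => exact hbase
    | succ k ih =>
      refine SobolevBounded.of_second (k := k) hβ.le ih.1 ?_
      have h1 := (ih.of_succ.comp_sub_comp ((hρb (k + 1)).supBounded hβ.le)
        ((hσb (k + 1)).supBounded hβ.le) hG)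
      have h2 := (((h1.delta hβ.le).delta hβ.le).add
        (((hSb k).delta hβ.le).const_mul μ)).const_mul (c ^ 2)⁻¹
      convert h2 using 3 with i x
      have hs := (hreg i).1
      have e1 : deriv (fun x => (n i : ℝ) ^ 2 * ((ρ i).1 x - σ x)) =
          fun x => (n i : ℝ) ^ 2 * (deriv (ρ i).1 x - deriv σ x) := funext fun x =>
        (((differentiableAt_of_contDiff_infty hs x).hasDerivAt.sub
          (differentiableAt_of_contDiff_infty hσs x).hasDerivAt).const_mul _).deriv
      have e2 : deriv (fun x => (n i : ℝ) ^ 2 * (deriv (ρ i).1 x - deriv σ x)) =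
          fun x => (n i : ℝ) ^ 2 * (deriv (deriv (ρ i).1) x - deriv (deriv σ) x) :=
        funext fun x =>
        (((differentiableAt_of_contDiff_infty (contDiff_deriv_infty hs) x).hasDerivAt.sub
          (differentiableAt_of_contDiff_infty
            (contDiff_deriv_infty hσs) x).hasDerivAt).const_mul _).deriv
      rw [e1, e2]
      simp only [(hreg i).2, hσeq, travelingForce, osc_deriv_deriv (hn i) ((hHb 0).contDiff i),
        delta]
      ring
  refine ⟨fun i => ⟨(hreg i).1, (hρ₂b 0).contDiff i⟩, fun k => ⟨hρb k, hρ₂b k, ?_, hρ₂b' k⟩⟩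
  convert (hall k).const_mul (-1) using 3
  ring

/-- The `O(1/n²)` estimate in the norms of `H^s_β`, for real `s`. -/
theorem IsAdmissibleWith.exists_eHsbNorm_le (hμ : 0 < μ) (hc : c ≠ 0)
    (hV : ContDiff ℝ ∞ V) (hV0 : deriv V 0 = 0)
    (hadm : IsAdmissibleWith (normPotential μ V) c β σ) {C : ℝ} (hC : 0 ≤ C) {n : ι → ℕ}
    (hn : ∀ i, 1 ≤ n i) {ρ : ι → (ℝ → ℝ) × (ℝ → ℝ)}
    (hρ : ∀ i, IsSolitaryWave V c μ (kappa c μ (n i)) β σ (C / n i) (ρ i)) {s : ℝ} (hs : 0 ≤ s) :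
    ∃ K : ℝ, 0 < K ∧ ∀ i, MemHsb s β (ρ i).1 ∧ MemHsb s β (ρ i).2 ∧
      eHsbNorm s β (fun x => σ x - (ρ i).1 x) + eHsbNorm s β (ρ i).2 ≤
        ENNReal.ofReal (K / (n i : ℝ) ^ 2) := by
  have hβ := hadm.beta_pos
  have hn2 : ∀ i, (0 : ℝ) < (n i : ℝ) ^ 2 := fun i => pow_pos (by exact_mod_cast hn i) 2
  have h := (hadm.smooth_solitaryWaves hμ hc hV hV0 hC hn hρ).2
  obtain ⟨_, _, h1⟩ := SobolevBounded.exists_eHsbNorm_le hβ.le (fun k => (h k).1) hs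
  obtain ⟨_, _, h2⟩ := SobolevBounded.exists_eHsbNorm_le hβ.le (fun k => (h k).2.1) hs
  obtain ⟨K, hK, h3⟩ := SobolevBounded.exists_eHsbNorm_le_div (u := fun i x => σ x - (ρ i).1 x)
    hβ.le hn2 (fun k => (h k).2.2.1) hs
  obtain ⟨K', hK', h4⟩ := SobolevBounded.exists_eHsbNorm_le_div (u := fun i => (ρ i).2)
    hβ.le hn2 (fun k => (h k).2.2.2) hs
  refine ⟨K + K' + 1, by positivity, fun i => ⟨(h1 i).1, (h2 i).1,
    (add_le_add (h3 i) (h4 i)).trans ?_⟩⟩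
  have := hn2 i
  rw [← ENNReal.ofReal_add (by positivity) (by positivity), ← add_div]
  exact ENNReal.ofReal_le_ofReal (div_le_div_of_nonneg_right (by linarith) (hn2 i).le)

end

end MassInMass

end

theorem theorem2 (μ : ℝ) (hμ : 0 < μ) (V : ℝ → ℝ) (hV : ContDiff ℝ 5 V)
    (hV0 : deriv V 0 = 0) (c : ℝ) (hc : c ≠ 0) (β : ℝ) (σ : ℝ → ℝ)
    (hadm : MassInMass.IsAdmissibleWith (fun r => (1 + μ)⁻¹ * V r) c β σ) :
    ∃ C : ℝ, 0 < C ∧ ∃ N : ℕ, 1 ≤ N ∧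
      (∀ n : ℕ, N ≤ n → ∃! ρ : (ℝ → ℝ) × (ℝ → ℝ),
        MassInMass.IsSolitaryWave V c μ (MassInMass.kappa c μ n) β σ (C / n) ρ) ∧
      (ContDiff ℝ ∞ V →
        (∀ n : ℕ, N ≤ n → ∀ ρ : (ℝ → ℝ) × (ℝ → ℝ),
          MassInMass.IsSolitaryWave V c μ (MassInMass.kappa c μ n) β σ (C / n) ρ →
            ContDiff ℝ ∞ ρ.1 ∧ ContDiff ℝ ∞ ρ.2) ∧
        ∀ s : ℝ, 0 ≤ s → ∃ Cs : ℝ, 0 < Cs ∧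
          ∀ n : ℕ, N ≤ n → ∀ ρ : (ℝ → ℝ) × (ℝ → ℝ),
            MassInMass.IsSolitaryWave V c μ (MassInMass.kappa c μ n) β σ (C / n) ρ →
              MassInMass.MemHsb s β ρ.1 ∧ MassInMass.MemHsb s β ρ.2 ∧
              MassInMass.eHsbNorm s β (fun x => σ x - ρ.1 x) + MassInMass.eHsbNorm s β ρ.2
                ≤ ENNReal.ofReal (Cs / (n : ℝ) ^ 2)) := by
  obtain ⟨C, hC, N, hN, hex⟩ := hadm.existsUnique_solitaryWave hμ hc hV hV0
  refine ⟨C, hC, N, hN, hex, fun hVs => ?_⟩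
  -- All solitary waves with `n ≥ N` form one family, so that the constants do not depend on `n`.
  let ι := {w : ℕ × ((ℝ → ℝ) × (ℝ → ℝ)) // N ≤ w.1 ∧
    MassInMass.IsSolitaryWave V c μ (MassInMass.kappa c μ w.1) β σ (C / w.1) w.2}
  have hn : ∀ i : ι, 1 ≤ i.1.1 := fun i => hN.trans i.2.1
  refine ⟨fun n hNn ρ hρ => ?_, fun s hs => ?_⟩
  · exact (hadm.smooth_solitaryWaves hμ hc hVs hV0 hC.le hn (ρ := fun i : ι => i.1.2)
      fun i => i.2.2).1 ⟨(n, ρ), hNn, hρ⟩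
  · obtain ⟨K, hK, h⟩ := hadm.exists_eHsbNorm_le hμ hc hVs hV0 hC.le hn (ρ := fun i : ι => i.1.2)
      (fun i => i.2.2) hs
    exact ⟨K, hK, fun n hNn ρ hρ => h ⟨(n, ρ), hNn, hρ⟩⟩
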